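/- Let $n,d\ge 1$ be integers, $\mathcal A=\mathbb Z[v,v^{-1}]$, let $q$ be a prime power, $V=\mathbb F_q^d$, $G=GL_d(\mathbb F_q)$, and let $\mathscr X$ be the set of $n$-step flags $f=(0=V_0\subseteq V_1\subseteq\dots\subseteq V_n=V)$. Let $\Xi_{n|n,d}$ be the set of decorated matrices $(A,\Delta)$: $A=(a_{ij})$ is an $n\times n$ matrix over $\mathbb N$ with $\sum_{i,j}a_{ij}=d$, and $\Delta=\{(i_1,j_1),\dots,(i_k,j_k)\}$ with $i_1<\dots<i_k$, $j_k<\dots<j_1$ and $a_{ij}>0$ for all $(i,j)\in\Delta$. The $G$-orbit $\mathcal O_{A,\Delta}\subseteq\mathscr X\times\mathscr X\times V$ consists of the triples $(f,f',\omega)$ for which $V$ has a basis $e_{ijk}$ ($1\le k\le a_{ij}$) with $V_i=\langle e_{i'jk}: i'\le i\rangle$, $V'_j=\langle e_{ij'k}: j'\le j\rangle$ and $\omega=\sum_{(i,j)\in\Delta}e_{ij1}$. Let $e_{A,\Delta}$ be its characteristic function. The mirabolic quantum Schur algebra $\mathcal{MS}_{n,d}$ is the unital associative $\mathcal A$-algebra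 with basis $\{e_{A,\Delta}\}_{(A,\Delta)\in\Xi_{n|n,d}}$ whose structure constants specialise, at $v=\sqrt q$ for every prime power $q$, to those of the convolution product $$(g*h)(f,f',\omega)=\sum_{f''\in\mathscr X,\ \mu\in V}g(f,f'',\mu)\,h(f'',f',\omega-\mu).$$ Put $[A]_\Delta=v^{-d(A,\Delta)+r(A,\Delta)}e_{A,\Delta}$, where $d(A,\Delta)=\sum_{i<k\text{ or }j<l}a_{ij}a_{kl}+\sum a_{ij}$, the last sum being over all $(i,j)$ such that $i\le k$ and $j\le l$ for some $(k,l)\in\Delta$, and $r(A,\Delta)=\sum_{i<k}a_{ij}a_{kl}$. (1) The $e_{A,\Delta}$ span $\mathcal{MS}_{n,d}$ over $\mathcal A$, and the $\mathcal A$-algebra $\mathcal{MS}_{n,d}$ is generated by the elements $[B]_\emptyset$, $[C]_\emptyset$, $[D]_\emptyset$ and $[D']_{\{(1,1)\}}$ of $\mathcal{MS}_{n,d}$ such that $D$, $D'$, $B-R\,E_{i,i+1}$ and $C-R\,E_{i+1,i}$ are diagonal matrices for some $i\in[1,n-1]$ and some integer $R\ge 0$, and $d'_{11}>0$. (2) The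 $\mathbb Q(v)$-algebra $\mathbb Q(v)\otimes_{\mathcal A}\mathcal{MS}_{n,d}$ is already generated by the elements as in (1) with $R=1$. (3) For $i\in[1,n-1]$ and $a\in[1,n]$ let $$E_i=\sum[B]_\emptyset,\quad F_i=\sum[C]_\emptyset,\quad H_a^{\pm}=\sum v^{\mp d_{aa}}[D]_\emptyset,\quad L=\sum v^{-2d_{11}}[D]_\emptyset+\sum v^{-d'_{11}}[D']_{\{(1,1)\}},$$ where $(B,\emptyset),(C,\emptyset),(D,\emptyset),(D',\{(1,1)\})$ run over all elements of $\Xi_{n|n,d}$ such that $B-E_{i,i+1}$, $C-E_{i+1,i}$, $D$, $D'$, respectively, are diagonal. Then $E_i$, $F_i$ ($i\in[1,n-1]$), $H_a^{\pm}$ ($a\in[1,n]$) and $L$ generate $\mathbb Q(v)\otimes_{\mathcal A}\mathcal{MS}_{n,d}$ as a $\mathbb Q(v)$-algebra. -/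

import Mathlib

open scoped TensorProduct BigOperators

noncomputable section

namespace Mirabolic

/-! ### The convolution algebra of functions on `X × X × V` -/

/-- Real-valued functions `g (f, f', ω)` on `X × X × V`. -/
def ConvAlg (X V : Type) : Type := X → X → V → ℝ

namespace ConvAlg

variable {X V : Type}

instance : AddCommGroup (ConvAlg X V) := inferInstanceAs (AddCommGroup (X → X → V → ℝ))

instance : Module ℝ (ConvAlg X V) := inferInstanceAs (Module ℝ (X → X → V → ℝ))

@[ext] theorem ext {g h : ConvAlg X V} (H : ∀ f f' w, g f f' w = h f f' w) : g = h := by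
  funext f f' w
  exact H f f' w

theorem add_apply (g h : ConvAlg X V) (f f' : X) (w : V) :
    (g + h) f f' w = g f f' w + h f f' w := rfl

theorem zero_apply (f f' : X) (w : V) : (0 : ConvAlg X V) f f' w = 0 := rfl

theorem smul_apply (c : ℝ) (g : ConvAlg X V) (f f' : X) (w : V) :
    (c • g) f f' w = c * g f f' w := rfl

variable [AddCommGroup V]

open Classical in
/-- The characteristic function of the set of all triples `(f, f, 0)`. -/
instance : One (ConvAlg X V) := ⟨fun f f' w => if f = f' ∧ w = 0 then 1 else 0⟩

open Classical in
theorem one_apply (f f' : X) (w : V) :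
    (1 : ConvAlg X V) f f' w = if f = f' ∧ w = 0 then 1 else 0 := rfl

variable [Fintype X] [Fintype V]

/-- The convolution product
`(g ∗ h)(f, f', ω) = ∑_{f'' ∈ X, μ ∈ V} g(f, f'', μ) h(f'', f', ω - μ)`. -/
instance : Mul (ConvAlg X V) :=
  ⟨fun g h f f' w => ∑ f'' : X, ∑ m : V, g f f'' m * h f'' f' (w - m)⟩

theorem mul_apply (g h : ConvAlg X V) (f f' : X) (w : V) :
    (g * h) f f' w = ∑ f'' : X, ∑ m : V, g f f'' m * h f'' f' (w - m) := rfl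

protected theorem mul_assoc (g h k : ConvAlg X V) : g * h * k = g * (h * k) := by
  ext f f' w
  simp only [mul_apply, Finset.sum_mul, Finset.mul_sum]
  calc
    _ = ∑ b : X, ∑ a : X, ∑ l : V, ∑ m : V, g f b l * h b a (m - l) * k a f' (w - m) := by
        rw [Finset.sum_congr rfl fun a _ => Finset.sum_comm, Finset.sum_comm]
        refine Finset.sum_congr rfl fun b _ => Finset.sum_congr rfl fun a _ => ?_
        exact Finset.sum_comm
    _ = ∑ b : X, ∑ a : X, ∑ l : V, ∑ m : V, g f b l * (h b a m * k a f' (w - l - m)) := by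
        refine Finset.sum_congr rfl fun b _ => Finset.sum_congr rfl fun a _ =>
          Finset.sum_congr rfl fun l _ => ?_
        refine Fintype.sum_equiv (Equiv.subRight l) _ _ fun m => ?_
        simp only [Equiv.subRight_apply, sub_sub, add_sub_cancel, mul_assoc]
    _ = _ := by
        refine Finset.sum_congr rfl fun b _ => Finset.sum_comm

protected theorem one_mul (g : ConvAlg X V) : 1 * g = g := by
  ext f f' w
  rw [mul_apply, Fintype.sum_eq_single f, Fintype.sum_eq_single 0]
  · simp [one_apply]
  · intro m hm
    simp [one_apply, hm]
  · intro a ha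
    simp [one_apply, Ne.symm ha]

protected theorem mul_one (g : ConvAlg X V) : g * 1 = g := by
  ext f f' w
  rw [mul_apply, Fintype.sum_eq_single f', Fintype.sum_eq_single w]
  · simp [one_apply]
  · intro m hm
    simp [one_apply, sub_eq_zero, Ne.symm hm]
  · intro a ha
    simp [one_apply, ha]

instance : Ring (ConvAlg X V) where
  mul_assoc := ConvAlg.mul_assoc
  one_mul := ConvAlg.one_mul
  mul_one := ConvAlg.mul_one
  left_distrib g h k := by
    ext f f' w
    simp only [mul_apply, add_apply, mul_add, Finset.sum_add_distrib]
  right_distrib g h k := by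
    ext f f' w
    simp only [mul_apply, add_apply, add_mul, Finset.sum_add_distrib]
  zero_mul g := by
    ext f f' w
    simp [mul_apply, zero_apply]
  mul_zero g := by
    ext f f' w
    simp [mul_apply, zero_apply]
  neg_add_cancel := neg_add_cancel
  zsmul := fun z g => z • g
  zsmul_zero' := SubNegMonoid.zsmul_zero'
  zsmul_succ' := SubNegMonoid.zsmul_succ'
  zsmul_neg' := SubNegMonoid.zsmul_neg'

instance : Algebra ℝ (ConvAlg X V) :=
  Algebra.ofModule
    (fun c g h => by
      ext f f' w
      simp only [mul_apply, smul_apply, Finset.mul_sum, mul_assoc])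
    (fun c g h => by
      ext f f' w
      simp only [mul_apply, smul_apply, Finset.mul_sum, mul_left_comm])

end ConvAlg

/-! ### Flags, decorated matrices and orbits -/

/-- An `n`-step partial flag `0 = V_0 ⊆ V_1 ⊆ ⋯ ⊆ V_n = V` in `V = F^d`. -/
structure Flag (F : Type) [Field F] (n d : ℕ) where
  step : Fin (n + 1) → Submodule F (Fin d → F)
  mono : Monotone step
  bot : step 0 = ⊥
  top : step (Fin.last n) = ⊤

instance (F : Type) [Field F] [Finite F] (n d : ℕ) : Finite (Flag F n d) := by
  have : Finite (Submodule F (Fin d → F)) :=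
    Finite.of_injective (fun W => (W : Set (Fin d → F))) SetLike.coe_injective
  refine Finite.of_injective (fun f : Flag F n d => f.step) ?_
  rintro ⟨s, _, _, _⟩ ⟨t, _, _, _⟩ h
  cases h
  rfl

/-- Decorated matrices `(A, Δ)` of size `n × n` whose entries add up to `d`. The elements of `Δ`
can be numbered so that `i_1 < ⋯ < i_k` and `j_k < ⋯ < j_1`, and `a_{ij} > 0` on `Δ`. -/
@[ext] structure DecMat (n d : ℕ) where
  A : Matrix (Fin n) (Fin n) ℕ
  Δ : Finset (Fin n × Fin n)
  anti : ∀ p ∈ Δ, ∀ q ∈ Δ, p ≠ q → (p.1 < q.1 ∧ q.2 < p.2) ∨ (q.1 < p.1 ∧ p.2 < q.2)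
  pos : ∀ p ∈ Δ, 0 < A p.1 p.2
  total : ∑ i, ∑ j, A i j = d

theorem DecMat.entry_le {n d : ℕ} (x : DecMat n d) (i j : Fin n) : x.A i j ≤ d := by
  calc x.A i j ≤ ∑ l, x.A i l :=
        Finset.single_le_sum (f := fun l => x.A i l) (fun _ _ => Nat.zero_le _) (Finset.mem_univ j)
    _ ≤ ∑ k, ∑ l, x.A k l :=
        Finset.single_le_sum (f := fun k => ∑ l, x.A k l) (fun _ _ => Nat.zero_le _)
          (Finset.mem_univ i)
    _ = d := x.total

instance (n d : ℕ) : Finite (DecMat n d) := by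
  refine Finite.of_injective
    (fun x : DecMat n d =>
      ((fun i j => ⟨x.A i j, Nat.lt_succ_of_le (x.entry_le i j)⟩ : Fin n → Fin n → Fin (d + 1)),
        x.Δ)) ?_
  intro x y h
  rw [Prod.mk.injEq] at h
  refine DecMat.ext ?_ h.2
  ext i j
  exact congrArg Fin.val (congrFun (congrFun h.1 i) j)

instance (n d : ℕ) : Fintype (DecMat n d) := Fintype.ofFinite _

/-- The `GL_d(F)`-orbit of triples `(f, f', ω)` attached to `(A, Δ)`: there is a basis `e_{ijk}`,
`1 ≤ k ≤ a_{ij}`, of `F^d` such that `f` has the steps `⟨e_{i'jk} : i' ≤ i⟩`, `f'` has the steps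
`⟨e_{ij'k} : j' ≤ j⟩`, and `ω = ∑_{(i,j) ∈ Δ} e_{ij1}`. -/
def InOrbit {F : Type} [Field F] {n d : ℕ} (x : DecMat n d) (f f' : Flag F n d)
    (w : Fin d → F) : Prop :=
  ∃ b : Module.Basis (Σ p : Fin n × Fin n, Fin (x.A p.1 p.2)) F (Fin d → F),
    (∀ i : Fin n, f.step i.succ = Submodule.span F (b '' {s | s.1.1 ≤ i})) ∧
    (∀ j : Fin n, f'.step j.succ = Submodule.span F (b '' {s | s.1.2 ≤ j})) ∧
    w = ∑ p : {p // p ∈ x.Δ}, b ⟨p.1, ⟨0, x.pos p.1 p.2⟩⟩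

/-! ### The generic algebra over `𝒜 = ℤ[v, v⁻¹]` -/

/-- The ring `𝒜 = ℤ[v, v⁻¹]`. -/
abbrev 𝒜 : Type := LaurentPolynomial ℤ

/-- The field `ℚ(v)`, as the field of fractions of `ℤ[v, v⁻¹]`. -/
abbrev Qv : Type := FractionRing 𝒜

/-- The prime powers `q = p ^ k` with `p` prime and `k ≥ 1`. -/
structure PrimePower where
  p : ℕ
  k : ℕ
  prime : Fact p.Prime
  k_pos : 0 < k

namespace PrimePower

instance (Q : PrimePower) : Fact Q.p.Prime := Q.prime

/-- The number `q`. -/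
def q (Q : PrimePower) : ℕ := Q.p ^ Q.k

/-- The field with `q` elements. -/
abbrev Fq (Q : PrimePower) : Type := GaloisField Q.p Q.k

instance (Q : PrimePower) : Fintype Q.Fq := Fintype.ofFinite _

theorem sqrt_ne_zero (Q : PrimePower) : Real.sqrt (Q.q : ℝ) ≠ 0 :=
  (Real.sqrt_pos.mpr (Nat.cast_pos.mpr (pow_pos Q.prime.out.pos _))).ne'

/-- The specialization `v ↦ √q`. -/
def spec (Q : PrimePower) : 𝒜 →+* ℝ :=
  LaurentPolynomial.eval₂ (Int.castRingHom ℝ) (Units.mk0 (Real.sqrt (Q.q : ℝ)) Q.sqrt_ne_zero)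

end PrimePower

instance (Q : PrimePower) (n d : ℕ) : Fintype (Flag Q.Fq n d) := Fintype.ofFinite _

/-- The convolution algebra of functions on `𝒳 × 𝒳 × V` over the field with `q` elements. -/
def ConvAt (n d : ℕ) (Q : PrimePower) : Type := ConvAlg (Flag Q.Fq n d) (Fin d → Q.Fq)

instance (n d : ℕ) (Q : PrimePower) : Ring (ConvAt n d Q) :=
  inferInstanceAs (Ring (ConvAlg (Flag Q.Fq n d) (Fin d → Q.Fq)))

instance (n d : ℕ) (Q : PrimePower) : Algebra ℝ (ConvAt n d Q) :=
  inferInstanceAs (Algebra ℝ (ConvAlg (Flag Q.Fq n d) (Fin d → Q.Fq)))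

/-- `v` acts on functions over the field with `q` elements as `√q`. -/
instance (n d : ℕ) (Q : PrimePower) : Algebra 𝒜 (ConvAt n d Q) := Algebra.compHom _ Q.spec

/-- Families of functions, one over each finite field. An identity in this `𝒜`-algebra is an
identity that holds for all `q` with `v = √q`. -/
abbrev Families (n d : ℕ) : Type := ∀ Q : PrimePower, ConvAt n d Q

open Classical in
/-- The characteristic function `e_{A,Δ}` of the orbit of `(A, Δ)`, over all finite fields. -/
def charFamily {n d : ℕ} (x : DecMat n d) : Families n d :=
  fun _ f f' w => if InOrbit x f f' w then 1 else 0

/-- The mirabolic quantum Schur algebra: the `𝒜`-algebra of the `e_{A,Δ}` under convolution, the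
structure constants being the Laurent polynomials in `v` that give at `v = √q` the structure
constants over the field with `q` elements, for all `q`. -/
def MS (n d : ℕ) : Subalgebra 𝒜 (Families n d) :=
  Algebra.adjoin 𝒜 (Set.range (charFamily (n := n) (d := d)))

/-- The element `e_{A,Δ}`. -/
def e {n d : ℕ} (x : DecMat n d) : MS n d :=
  ⟨charFamily x, Algebra.subset_adjoin (Set.mem_range_self x)⟩

/-- The power `v^m`. -/
abbrev vpow (m : ℤ) : 𝒜 := LaurentPolynomial.T m

namespace DecMat

variable {n d : ℕ}

open Classical in
/-- The dimension `d(A, Δ)` of the orbit,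
`∑_{i < k or j < l} a_{ij} a_{kl} + ∑_{{(i,j)} ≤ Δ} a_{ij}`. -/
def orbitDim (x : DecMat n d) : ℕ :=
  (∑ i, ∑ j, ∑ k, ∑ l, if i < k ∨ j < l then x.A i j * x.A k l else 0) +
    ∑ i, ∑ j, if ∃ p ∈ x.Δ, i ≤ p.1 ∧ j ≤ p.2 then x.A i j else 0

/-- The dimension `r(A, Δ)` of the image of the orbit under the first projection,
`∑_{i < k} a_{ij} a_{kl}`. -/
def imageDim (x : DecMat n d) : ℕ :=
  ∑ i, ∑ j, ∑ k, ∑ l, if i < k then x.A i j * x.A k l else 0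

/-- `(A, Δ)` with `Δ = ∅` and `A - R E_{ij}` diagonal. -/
def IsElementary (R : ℕ) (i j : Fin n) (x : DecMat n d) : Prop :=
  x.Δ = ∅ ∧ (x.A.map (fun a : ℕ => (a : ℤ)) - Matrix.single i j (R : ℤ)).IsDiag

/-- `(D, ∅)` with `D` diagonal. -/
def IsDiagEmpty (x : DecMat n d) : Prop := x.Δ = ∅ ∧ x.A.IsDiag

/-- `(D', {(1, 1)})` with `D'` diagonal (so that `d'_{11} > 0`). -/
def IsDiagOne [NeZero n] (x : DecMat n d) : Prop := x.Δ = {(0, 0)} ∧ x.A.IsDiag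

end DecMat

/-- `[A]_Δ = v^{-d(A,Δ)+r(A,Δ)} e_{A,Δ}`. -/
def br {n d : ℕ} (x : DecMat n d) : MS n d :=
  vpow (-(x.orbitDim : ℤ) + x.imageDim) • e x

section Generators

variable (n d : ℕ)

/-- All `[B]_∅`, `[C]_∅`, `[D]_∅`, `[D']_{(1,1)}` with `D`, `D'`, `B - R E_{i,i+1}` and
`C - R E_{i+1,i}` diagonal for some `i` and some multiplicity `R` in the set `S`. -/
def gens [NeZero n] (S : Set ℕ) : Set (MS n d) :=
  {y | ∃ x : DecMat n d, br x = y ∧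
    ((∃ R ∈ S, ∃ i j : Fin n, (i : ℕ) + 1 = j ∧ (x.IsElementary R i j ∨ x.IsElementary R j i)) ∨
      x.IsDiagEmpty ∨ x.IsDiagOne)}

open Classical in
/-- The sum of all `[B]_∅` with `B - E_{ij}` diagonal: this is `E_i` for `j = i + 1`, and it is
`F_j` for `i = j + 1`. -/
def chevalley (i j : Fin n) : MS n d :=
  ∑ x : DecMat n d with x.IsElementary 1 i j, br x

open Classical in
/-- `H_a^+ = ∑ v^{-d_{aa}} [D]_∅` for `s = 1`, and `H_a^- = ∑ v^{d_{aa}} [D]_∅` for `s = -1`. -/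
def cartan (s : ℤˣ) (a : Fin n) : MS n d :=
  ∑ x : DecMat n d with x.IsDiagEmpty, vpow (-(s : ℤ) * x.A a a) • br x

open Classical in
/-- `L = ∑ v^{-2 d_{11}} [D]_∅ + ∑ v^{-d'_{11}} [D']_{(1,1)}`. -/
def L [NeZero n] : MS n d :=
  (∑ x : DecMat n d with x.IsDiagEmpty, vpow (-2 * (x.A 0 0 : ℤ)) • br x) +
    ∑ x : DecMat n d with x.IsDiagOne, vpow (-(x.A 0 0 : ℤ)) • br x

/-- The elements `E_i`, `F_i` (`1 ≤ i ≤ n - 1`), `H_a^±` (`1 ≤ a ≤ n`) and `L`. -/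
def quantumGens [NeZero n] : Set (MS n d) :=
  {y | (∃ i j : Fin n, (i : ℕ) + 1 = j ∧ (y = chevalley n d i j ∨ y = chevalley n d j i)) ∨
    (∃ (s : ℤˣ) (a : Fin n), y = cartan n d s a) ∨ y = L n d}

end Generators

/-- The scalar extension `ℚ(v) ⊗ 𝓜𝓢`. -/
abbrev MSQ (n d : ℕ) : Type := Qv ⊗[𝒜] MS n d

/-- The map `y ↦ 1 ⊗ y`. -/
def toQ {n d : ℕ} (y : MS n d) : MSQ n d := (1 : Qv) ⊗ₜ[𝒜] y

end Mirabolic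

end

open scoped TensorProduct BigOperators

noncomputable section

namespace Mirabolic

/-! ### Bases adapted to two flags and a vector -/

/-! The algebra sits inside the product of the convolution algebras over all finite fields, so the
existence of generic structure constants has to be proved along with generation.

A triple (f, f', w) has two invariants: the dimensions of V_k ∩ V'_l and the truth values of w ∈ V_k
+ V'_l. The orbits are exactly the fibres of these invariants (`inOrbit_iff`), and every orbit is
nonempty over every field. Hence the span of the e_{A,Δ} consists of the functions whose value on
each orbit is the specialization of one Laurent polynomial (`mem_spanFam_iff`).

Left multiplication by an elementary element preserves this span. It is a sum over the flags that
differ from f in one step by R dimensions, or over the translates of w by V_1. For R = 1 the sum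
over flags is replaced by a sum over the vectors, or linear forms, that define the new step; this
multiplies it by q^e (q - 1). The vectors fall into classes given by two chains of conditions, and
the sizes of the classes are polynomials in q (`Poly.sum_of_chains`). The factor can be removed
because a monic polynomial whose values at all primes divide those of P divides P
(`dvd_of_forall_prime_eval_dvd`). Larger R follow on dividing by 1 + q + ... + q^R. So the
subalgebra generated by the elementary elements lies in the span.

Conversely, every e_{A,Δ} lies in that subalgebra. By inclusion-exclusion it suffices to treat
`sumFam`: a fixed relative position ρ of the flags, with w in prescribed sums V_k + V'_l. This is an
induction on the integer `psi`. If the flags coincide, the function is an idempotent times the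
indicator of w ∈ V_m, and the recursion `vecFam_succ` leads from V_1 to V_m. Otherwise, up to
exchanging the flags, some V_k is not contained in V'_k, and one step is moved: either V'_m absorbs
V_i, or V_i is cut down to V_i ∩ V'_m. The function of the new position has smaller `psi`; its
product with a family `upper` is the wanted function plus terms of smaller `psi`
(`Good.sumFam_mem_of_leading`). The first move respects the conditions on w only if none of them
involves V_k + V'_m with k < i; if one does, it forces w into a step of f' along which the second
move is possible.

Thus span, algebra and generated subalgebra coincide. Over ℚ(v), a move by R dimensions is a product
of R single moves divided by nonzero quantum integers, so R = 1 suffices. Finally the Cartan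
elements separate the diagonal matrices; interpolation produces the diagonal idempotents, and these
cut the E_i, the F_i and L into single generators. -/

open Module Submodule in
/-- Any two finite flags have a common adapted basis. -/
theorem exists_basis_of_two_chains {F : Type*} [Field F] (n : ℕ) :
    ∀ (m : ℕ) (V : Type) [AddCommGroup V] [Module F V] [FiniteDimensional F V],
      finrank F V = m → ∀ A B : ℕ → Submodule F V, Monotone A → Monotone B → A 0 = ⊥ → B 0 = ⊥ →
      A n = ⊤ → B n = ⊤ → ∃ (b : Basis (Fin m) F V) (r c : Fin m → ℕ),
        (∀ k, A k = span F (b '' {s | r s < k})) ∧ (∀ k, B k = span F (b '' {s | c s < k})) := by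
  intro m
  induction m with
  | zero =>
    intro V _ _ _ hV A B _ _ _ _ _ _
    have : Subsingleton V := finrank_zero_iff.mp hV
    refine ⟨finBasisOfFinrankEq F V hV, fun _ => 0, fun _ => 0, fun k => ?_, fun k => ?_⟩ <;>
    exact Subsingleton.elim _ _
  | succ m ih =>
    intro V _ _ _ hV A B hA hB hA0 hB0 hAn hBn
    classical
    have hnt : Nontrivial V := nontrivial_of_finrank_eq_succ hV
    have hbt : (⊤ : Submodule F V) ≠ ⊥ := top_ne_bot
    have hn : n ≠ 0 := by rintro rfl; exact hbt (hAn.symm.trans hA0)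
    obtain ⟨n', rfl⟩ := Nat.exists_eq_succ_of_ne_zero hn
    -- The first basis vector y is taken in the first nonzero step of A, and there in the first step
    -- of B that meets it. It will occupy row `k0` and column `l0`.
    have h1 : ∃ k, A (k + 1) ≠ ⊥ := ⟨n', hAn.trans_ne hbt⟩
    obtain ⟨k0, hk0, hk0'⟩ : ∃ k, A (k + 1) ≠ ⊥ ∧ A k = ⊥ := by
      refine ⟨Nat.find h1, Nat.find_spec h1, ?_⟩
      rcases h : Nat.find h1 with _ | k
      · exact hA0
      · by_contra hk
        exact Nat.find_min h1 (m := k) (by omega) hk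
    have h2 : ∃ l, A (k0 + 1) ⊓ B (l + 1) ≠ ⊥ := ⟨n', by rw [hBn, inf_top_eq]; exact hk0⟩
    obtain ⟨l0, hl0, hl0'⟩ : ∃ l, A (k0 + 1) ⊓ B (l + 1) ≠ ⊥ ∧ A (k0 + 1) ⊓ B l = ⊥ := by
      refine ⟨Nat.find h2, Nat.find_spec h2, ?_⟩
      rcases h : Nat.find h2 with _ | k
      · rw [hB0, inf_bot_eq]
      · by_contra hk
        exact Nat.find_min h2 (m := k) (by omega) hk
    obtain ⟨y, hy, hy0⟩ := Submodule.exists_mem_ne_zero_of_ne_bot hl0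
    have hyB : y ∉ B l0 := fun h => hy0 (by
      have : y ∈ A (k0 + 1) ⊓ B l0 := ⟨hy.1, h⟩
      rwa [hl0', mem_bot] at this)
    -- The induction continues in a hyperplane that contains `B l0` but not y. Every step of either
    -- chain then contains y or lies in the hyperplane, so it splits as required by `key`.
    obtain ⟨ξ, hξ, hξB⟩ := Submodule.exists_le_ker_of_notMem hyB
    set H := LinearMap.ker ξ with hH
    have hHdim : finrank F H = m := by
      have h3 := LinearMap.finrank_range_add_finrank_ker ξ
      have h4 : finrank F (LinearMap.range ξ) = 1 := by
        rw [LinearMap.range_eq_top.mpr (LinearMap.surjective_of_ne_zero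
          (by rintro rfl; simp at hξ)), finrank_top, finrank_self]
      rw [hH]; omega
    obtain ⟨b', r', c', hr', hc'⟩ := ih H hHdim (fun k => (A k).comap H.subtype)
      (fun k => (B k).comap H.subtype) (fun _ _ h => comap_mono (hA h))
      (fun _ _ h => comap_mono (hB h)) (by simp [hA0]) (by simp [hB0]) (by simp [hAn])
      (by simp [hBn])
    have hsp : ∀ z : V, ∃ c : F, z + c • y ∈ H := fun z => ⟨-(ξ z / ξ y), by
      simp [hH, LinearMap.mem_ker, div_mul_cancel₀ _ hξ]⟩
    have hli : ∀ (c : F), ∀ x ∈ H, c • y + x = 0 → c = 0 := fun c x hx h => by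
      have := congrArg ξ h
      rw [map_add, LinearMap.mem_ker.mp hx, map_smul, map_zero, add_zero, smul_eq_mul] at this
      exact (mul_eq_zero.mp this).resolve_right hξ
    have key : ∀ (P : Submodule F V) (r : Fin m → ℕ) (a k : ℕ),
        P.comap H.subtype = span F (b' '' {s | r s < k}) → (a < k → y ∈ P) →
        (¬ a < k → P ≤ H) → P = span F ((Basis.mkFinCons y b' hli hsp) ''
          {s | (Fin.cons a r : Fin (m + 1) → ℕ) s < k}) := by
      intro P r a k hP h1 h2
      have hPH : H ⊓ P = span F ((fun s => (b' s : V)) '' {s | r s < k}) := by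
        rw [← map_comap_subtype, hP, map_span, Set.image_image]; rfl
      have hset : (Basis.mkFinCons y b' hli hsp) ''
          {s | (Fin.cons a r : Fin (m + 1) → ℕ) s < k} =
          (if a < k then {y} else ∅) ∪ (fun s => (b' s : V)) '' {s | r s < k} := by
        ext z
        rw [Basis.coe_mkFinCons]
        constructor
        · rintro ⟨s, hs, rfl⟩
          refine Fin.cases ?_ (fun s => ?_) s hs
          · intro h
            left
            simp only [Fin.cons_zero, Set.mem_ofPred_eq] at h
            simp [h]
          · intro h
            right
            exact ⟨s, by simpa using h, rfl⟩
        · rintro (h | ⟨s, hs, rfl⟩)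
          · split_ifs at h with hak
            · exact ⟨0, by simpa using hak, by simpa using h.symm⟩
            · exact h.elim
          · exact ⟨s.succ, by simpa using hs, rfl⟩
      rw [hset, span_union, ← hPH]
      split_ifs with hak
      · apply le_antisymm
        · intro x hx
          obtain ⟨c, hc⟩ := hsp x
          have : x = -c • y + (x + c • y) := by rw [neg_smul]; abel
          rw [this]
          exact add_mem (mem_sup_left (smul_mem _ _ (mem_span_singleton_self y)))
            (mem_sup_right ⟨hc, add_mem hx (smul_mem _ _ (h1 hak))⟩)
        · exact sup_le (by simpa using h1 hak) inf_le_right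
      · simp [h2 hak]
    refine ⟨Basis.mkFinCons y b' hli hsp, Fin.cons k0 r', Fin.cons l0 c', fun k => ?_, fun k => ?_⟩
    · refine key _ _ _ _ (hr' k) (fun h => hA h hy.1) (fun h => ?_)
      exact (hA (not_lt.mp h)).trans (hk0'.trans_le bot_le)
    · refine key _ _ _ _ (hc' k) (fun h => hB h hy.2) (fun h => ?_)
      exact (hB (not_lt.mp h)).trans hξB

open Module Submodule in
/-- A basis adapted to two chains can be changed so that a given vector becomes the sum of basis
vectors in pairwise incomparable positions. -/
theorem exists_basis_of_two_chains_and_vector {F V ι : Type*} [Field F] [AddCommGroup V]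
    [Module F V] [Fintype ι] (b : Basis ι F V) (r c : ι → ℕ) (A B : ℕ → Submodule F V)
    (hA : ∀ k, A k = span F (b '' {s | r s < k})) (hB : ∀ k, B k = span F (b '' {s | c s < k}))
    (w : V) : ∃ (b' : Basis ι F V) (T : Finset ι),
      (∀ k, A k = span F (b' '' {s | r s < k})) ∧ (∀ k, B k = span F (b' '' {s | c s < k})) ∧
      w = ∑ s ∈ T, b' s ∧
      ∀ s ∈ T, ∀ t ∈ T, s ≠ t → (r s < r t ∧ c t < c s) ∨ (r t < r s ∧ c s < c t) := by
  classical
  have : FiniteDimensional F V := Module.Finite.of_basis b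
  set P : Finset ι := (b.repr w).support with hP
  -- Each index in the support of w is sent to a chosen representative of a maximal occupied
  -- position above its own. Distinct maximal positions are incomparable, which in ℕ × ℕ means
  -- strictly ordered in opposite directions.
  obtain ⟨t, ht⟩ : ∃ t : ι → ι, ∀ s ∈ P, t s ∈ P ∧ (r s ≤ r (t s) ∧ c s ≤ c (t s)) ∧ t (t s) = t s ∧
      ∀ s' ∈ P, t s ≠ t s' → (r (t s) < r (t s') ∧ c (t s') < c (t s)) ∨
        (r (t s') < r (t s) ∧ c (t s) < c (t s')) := by
    rcases isEmpty_or_nonempty ι with hι | hι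
    · exact ⟨id, fun s => hι.elim s⟩
    set Q : Finset (ℕ × ℕ) := P.image fun s => (r s, c s) with hQ
    have hmax : ∀ p ∈ Q, ∃ q, p ≤ q ∧ Maximal (· ∈ Q) q := fun p hp => by
      simpa using Q.exists_le_maximal hp
    choose! m hm hmm using hmax
    have hsec : ∀ q ∈ Q, ∃ s ∈ P, (r s, c s) = q := fun q hq => by simpa [hQ] using hq
    choose! σ hσ hσ' using hsec
    have hin : ∀ s ∈ P, (r s, c s) ∈ Q := fun s hs => Finset.mem_image_of_mem _ hs
    have hval : ∀ s ∈ P, (r (σ (m (r s, c s))), c (σ (m (r s, c s)))) = m (r s, c s) := fun s hs =>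
      hσ' _ (hmm _ (hin s hs)).1
    refine ⟨fun s => σ (m (r s, c s)), fun s hs => ⟨hσ _ (hmm _ (hin s hs)).1, ?_, ?_, ?_⟩⟩
    · have h1 := hm _ (hin s hs)
      rw [← hval s hs] at h1
      exact h1
    · dsimp only
      rw [hval s hs]
      have h1 := hmm _ (hin s hs)
      rw [h1.eq_of_le (hmm _ h1.1).1 (hm _ h1.1) |>.symm]
    · intro s' hs' hne
      have h1 := hmm _ (hin s hs)
      have h2 := hmm _ (hin s' hs')
      have hne' : m (r s, c s) ≠ m (r s', c s') := fun h => hne (by dsimp only; rw [h])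
      have h3 : ¬ m (r s, c s) ≤ m (r s', c s') := fun h => hne' (h1.eq_of_le h2.1 h)
      have h4 : ¬ m (r s', c s') ≤ m (r s, c s) := fun h => hne' (h2.eq_of_le h1.1 h).symm
      rw [← hval s hs, ← hval s' hs', Prod.mk_le_mk] at h3 h4
      dsimp only
      omega
  set T : Finset ι := P.image t with hT
  have htT : ∀ s ∈ T, s ∈ P ∧ t s = s := by
    intro s hs
    obtain ⟨u, hu, rfl⟩ := Finset.mem_image.mp hs
    exact ⟨(ht u hu).1, (ht u hu).2.2.1⟩
  -- A representative collects the part of w attached to it, so w becomes the sum of the new vectors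
  -- over T. No step changes, because only vectors of lower or equal position are added.
  set β : ι → V := fun s => if s ∈ T then ∑ u ∈ P with t u = s, b.repr w u • b u else b s with hβ
  -- The coefficient of `b s` in `β s` is nonzero since s lies in the support of w, and the other
  -- terms are unchanged basis vectors; hence `b s` can be recovered.
  have hspan : ⊤ ≤ span F (Set.range β) := by
    have hns : ∀ s ∉ T, b s ∈ span F (Set.range β) := fun s hs =>
      subset_span ⟨s, by simp [hβ, hs]⟩
    rw [← b.span_eq, span_le]
    rintro _ ⟨s, rfl⟩
    by_cases hs : s ∈ T
    · have h1 : β s ∈ span F (Set.range β) := subset_span ⟨s, rfl⟩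
      have h2 : β s = b.repr w s • b s + ∑ u ∈ (P.filter fun u => t u = s).erase s,
          b.repr w u • b u := by
        have hmem : s ∈ P.filter fun u => t u = s := Finset.mem_filter.mpr (htT s hs)
        rw [Finset.add_sum_erase _ (fun u => b.repr w u • b u) hmem]
        simp [hβ, hs]
      have h3 : ∑ u ∈ (P.filter fun u => t u = s).erase s, b.repr w u • b u ∈
          span F (Set.range β) := by
        refine sum_mem fun u hu => smul_mem _ _ (hns u fun huT => ?_)
        rw [Finset.mem_erase, Finset.mem_filter] at hu
        exact hu.1 ((htT u huT).2.symm.trans hu.2.2)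
      have h4 : b.repr w s • b s ∈ span F (Set.range β) := by
        rw [h2] at h1
        exact (add_mem_cancel_right h3).mp h1
      exact (smul_mem_iff _ (Finsupp.mem_support_iff.mp (htT s hs).1)).mp h4
    · exact hns s hs
  have hcard : Fintype.card ι = finrank F V := (finrank_eq_card_basis b).symm
  set b' : Basis ι F V := basisOfTopLeSpanOfCardEqFinrank β hspan hcard with hb'
  have hb'β : ⇑b' = β := coe_basisOfTopLeSpanOfCardEqFinrank _ _ _
  have key : ∀ (r : ι → ℕ) (A : ℕ → Submodule F V), (∀ k, A k = span F (b '' {s | r s < k})) →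
      (∀ s ∈ P, r s ≤ r (t s)) → ∀ k, A k = span F (b' '' {s | r s < k}) := by
    intro r A hA hr k
    symm
    have hle : span F (b' '' {s | r s < k}) ≤ A k := by
      rw [span_le]
      rintro _ ⟨s, hs, rfl⟩
      rw [hb'β, hA]
      simp only [hβ]
      split_ifs
      · refine sum_mem fun u hu => smul_mem _ _ (subset_span ⟨u, ?_, rfl⟩)
        rw [Finset.mem_filter] at hu
        have := hr u hu.1
        rw [hu.2] at this
        exact this.trans_lt hs
      · exact subset_span ⟨s, hs, rfl⟩
    refine eq_of_le_of_finrank_eq hle ?_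
    rw [hA, Set.image_eq_range, Set.image_eq_range, finrank_span_eq_card, finrank_span_eq_card]
    · exact b.linearIndependent.comp _ Subtype.val_injective
    · exact b'.linearIndependent.comp _ Subtype.val_injective
  refine ⟨b', T, key r A hA fun s hs => (ht s hs).2.1.1, key c B hB fun s hs => (ht s hs).2.1.2,
    ?_, ?_⟩
  · rw [hb'β]
    have h1 : ∑ s ∈ T, β s = ∑ s ∈ T, ∑ u ∈ P with t u = s, b.repr w u • b u :=
      Finset.sum_congr rfl fun s hs => by simp [hβ, hs]
    rw [h1, Finset.sum_fiberwise_of_maps_to (g := t) (fun u hu => Finset.mem_image_of_mem t hu)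
      (fun u => b.repr w u • b u)]
    conv_lhs => rw [← b.linearCombination_repr w]
    rfl
  · intro s hs s' hs' hne
    obtain ⟨u, hu, rfl⟩ := Finset.mem_image.mp hs
    obtain ⟨u', hu', rfl⟩ := Finset.mem_image.mp hs'
    exact (ht u hu).2.2.2 u' hu' hne

namespace Flag

variable {F : Type} [Field F] {n d : ℕ}

/-- The steps of a flag, indexed by all natural numbers. -/
def sub (f : Flag F n d) (k : ℕ) : Submodule F (Fin d → F) := f.step ⟨min k n, by omega⟩

theorem sub_mono (f : Flag F n d) : Monotone f.sub := fun k l h =>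
  f.mono (by rw [Fin.mk_le_mk]; omega)

theorem sub_zero (f : Flag F n d) : f.sub 0 = ⊥ := by
  rw [← f.bot]; exact congrArg f.step (Fin.ext (by simp))

theorem sub_of_le (f : Flag F n d) {k : ℕ} (h : n ≤ k) : f.sub k = ⊤ := by
  rw [← f.top]; exact congrArg f.step (Fin.ext (by simp [h]))

theorem step_eq_sub (f : Flag F n d) (i : Fin (n + 1)) : f.step i = f.sub i :=
  congrArg f.step (Fin.ext (by simp; omega))

theorem step_succ (f : Flag F n d) (i : Fin n) : f.step i.succ = f.sub (i + 1) := by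
  rw [step_eq_sub, Fin.val_succ]

theorem ext_sub {f g : Flag F n d} (h : ∀ k, f.sub k = g.sub k) : f = g := by
  have h1 : f.step = g.step := funext fun i => by rw [step_eq_sub, step_eq_sub, h]
  cases f; cases g; cases h1; rfl

/-- The flag with prescribed steps. -/
def ofSub (S : ℕ → Submodule F (Fin d → F)) (hS : Monotone S) (h0 : S 0 = ⊥) (hn : S n = ⊤) :
    Flag F n d where
  step i := S i
  mono _ _ h := hS h
  bot := h0
  top := hn

theorem sub_ofSub (S : ℕ → Submodule F (Fin d → F)) (hS : Monotone S) (h0 : S 0 = ⊥)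
    (hn : S n = ⊤) (k : ℕ) : (ofSub S hS h0 hn : Flag F n d).sub k = S k := by
  rcases le_total k n with h | h
  · exact congrArg S (by simp [h])
  · rw [sub_of_le _ h, eq_comm, eq_top_iff, ← hn]; exact hS h

/-- One step of a flag can be replaced by any subspace between the two neighbouring steps. -/
theorem exists_update (f : Flag F n d) {i : ℕ} (hi : 0 < i) (hin : i < n)
    {W : Submodule F (Fin d → F)} (h1 : f.sub (i - 1) ≤ W) (h2 : W ≤ f.sub (i + 1)) :
    ∃ g : Flag F n d, g.sub i = W ∧ ∀ k, k ≠ i → g.sub k = f.sub k := by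
  classical
  have hm : Monotone (Function.update f.sub i W) := by
    refine monotone_nat_of_le_succ fun k => ?_
    by_cases hk : k = i
    · subst hk; simpa using h2
    · by_cases hk' : k + 1 = i
      · subst hk'; simpa [hk] using h1
      · simpa [hk, hk'] using f.sub_mono (Nat.le_succ k)
  refine ⟨ofSub (Function.update f.sub i W) hm ?_ ?_, ?_, fun k hk => ?_⟩
  · rw [Function.update_of_ne hi.ne, sub_zero]
  · rw [Function.update_of_ne hin.ne', sub_of_le _ le_rfl]
  · rw [sub_ofSub, Function.update_self]
  · rw [sub_ofSub, Function.update_of_ne hk]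

end Flag

/-! ### The invariants of a triple -/

/-- The possible values of the invariants of a triple `(f, f', w)`. -/
abbrev Inv : Type := (ℕ → ℕ → ℕ) × (ℕ → ℕ → Prop)

section

variable {F : Type} [Field F] {n d : ℕ}

/-- The dimensions of `V_k ∩ V'_l`, and the truth values of `w ∈ V_k + V'_l`. -/
def inv (f f' : Flag F n d) (w : Fin d → F) : Inv :=
  (fun k l => Module.finrank F ↥(f.sub k ⊓ f'.sub l), fun k l => w ∈ f.sub k ⊔ f'.sub l)

/-- The index set of the bases attached to `(A, Δ)`. -/
abbrev DecMat.Idx (x : DecMat n d) : Type := Σ p : Fin n × Fin n, Fin (x.A p.1 p.2)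

/-- The invariants of the triples in the orbit of `(A, Δ)`. -/
def DecMat.inv (x : DecMat n d) : Inv :=
  (fun k l => Fintype.card {s : x.Idx // (s.1.1 : ℕ) < k ∧ (s.1.2 : ℕ) < l},
    fun k l => ∀ p ∈ x.Δ, (p.1 : ℕ) < k ∨ (p.2 : ℕ) < l)

theorem DecMat.card_idx (x : DecMat n d) : Fintype.card x.Idx = d := by
  simp only [Fintype.card_sigma, Fintype.card_fin, Fintype.sum_prod_type]
  exact x.total

/-- The basis of `F^d` indexed by the positions `(i, j, k)` is adapted to a triple. -/
def Adapted (x : DecMat n d) (b : Module.Basis x.Idx F (Fin d → F)) (f f' : Flag F n d)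
    (w : Fin d → F) : Prop :=
  (∀ k, f.sub k = Submodule.span F (b '' {s | (s.1.1 : ℕ) < k})) ∧
    (∀ l, f'.sub l = Submodule.span F (b '' {s | (s.1.2 : ℕ) < l})) ∧
    w = ∑ p : {p // p ∈ x.Δ}, b ⟨p.1, ⟨0, x.pos p.1 p.2⟩⟩

/-- Rows are numbered from 0, so the step k is spanned by the rows with number less than k. The
conditions at k = 0 and beyond n hold automatically. -/
theorem span_eq_of_steps {ι : Type} (b : Module.Basis ι F (Fin d → F)) (f : Flag F n d)
    (r : ι → Fin n) : (∀ i : Fin n, f.step i.succ = Submodule.span F (b '' {s | r s ≤ i})) ↔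
      ∀ k, f.sub k = Submodule.span F (b '' {s | (r s : ℕ) < k}) := by
  constructor
  · rintro h (_ | k)
    · simp [Flag.sub_zero]
    · rcases lt_or_ge k n with hk | hk
      · have := h ⟨k, hk⟩
        rw [Flag.step_succ] at this
        simpa [Nat.lt_succ_iff, Fin.le_def] using this
      · rw [Flag.sub_of_le _ (by omega)]
        have : {s | (r s : ℕ) < k + 1} = Set.univ := Set.eq_univ_of_forall fun s => by
          have := (r s).2
          simp only [Set.mem_ofPred_eq]; omega
        rw [this, Set.image_univ, b.span_eq]
  · intro h i
    rw [Flag.step_succ, h]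
    exact congrArg (fun t => Submodule.span F (b '' t)) (Set.ext fun s => Nat.lt_succ_iff)

theorem inOrbit_iff_adapted {x : DecMat n d} {f f' : Flag F n d} {w : Fin d → F} :
    InOrbit x f f' w ↔ ∃ b, Adapted x b f f' w :=
  exists_congr fun b => and_congr (span_eq_of_steps b f fun s => s.1.1)
    (and_congr_left' (span_eq_of_steps b f' fun s => s.1.2))

/-! ### Spans of subsets of a basis -/

section

open Submodule Module

variable {ι : Type} (b : Basis ι F (Fin d → F))

theorem _root_.Module.Basis.span_image_sup (s t : Set ι) :
    span F (b '' s) ⊔ span F (b '' t) = span F (b '' (s ∪ t)) := by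
  rw [Set.image_union, span_union]

theorem _root_.Module.Basis.span_image_inf (s t : Set ι) :
    span F (b '' s) ⊓ span F (b '' t) = span F (b '' (s ∩ t)) := by
  ext v
  rw [mem_inf, b.mem_span_image, b.mem_span_image, b.mem_span_image, Set.subset_inter_iff]

theorem _root_.Module.Basis.finrank_span_image [Finite ι] (s : Set ι) :
    finrank F (span F (b '' s)) = Nat.card s := by
  have := Fintype.ofFinite s
  rw [Set.image_eq_range, finrank_span_eq_card, Nat.card_eq_fintype_card]
  exact b.linearIndependent.comp _ Subtype.val_injective

theorem _root_.Module.Basis.span_image_le_iff (s t : Set ι) :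
    span F (b '' s) ≤ span F (b '' t) ↔ s ⊆ t := by
  refine ⟨fun h i hi => ?_, fun h => span_mono (Set.image_mono h)⟩
  have := h (subset_span ⟨i, hi, rfl⟩)
  rw [b.mem_span_image, b.repr_self] at this
  exact this (by simp)

end

namespace Adapted

open Submodule

variable {x : DecMat n d} {b : Module.Basis x.Idx F (Fin d → F)} {f f' : Flag F n d}
  {w : Fin d → F}

theorem mem_span_iff (h : Adapted x b f f' w) (t : Set x.Idx) :
    w ∈ span F (b '' t) ↔ ∀ (p) (hp : p ∈ x.Δ), (⟨p, ⟨0, x.pos p hp⟩⟩ : x.Idx) ∈ t := by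
  have hinj : Function.Injective
      fun p : {p // p ∈ x.Δ} => (⟨p.1, ⟨0, x.pos p.1 p.2⟩⟩ : x.Idx) := fun p q hpq =>
    Subtype.ext (congrArg Sigma.fst hpq)
  constructor
  · intro hw p hp
    rw [b.mem_span_image] at hw
    refine hw ?_
    rw [Finset.mem_coe, Finsupp.mem_support_iff, h.2.2, map_sum, Finsupp.finsetSum_apply,
      Finset.sum_eq_single ⟨p, hp⟩]
    · simp
    · intro q _ hq
      rw [b.repr_self, Finsupp.single_apply, if_neg]
      exact fun h => hq (hinj h)
    · simp
  · intro ht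
    rw [h.2.2]
    exact sum_mem fun p _ => subset_span ⟨_, ht p.1 p.2, rfl⟩

theorem inv_eq (h : Adapted x b f f' w) : inv f f' w = x.inv := by
  refine Prod.ext (funext₂ fun k l => ?_) (funext₂ fun k l => propext ?_)
  · change Module.finrank F ↥(f.sub k ⊓ f'.sub l) = _
    rw [h.1, h.2.1, b.span_image_inf, b.finrank_span_image]
    change _ = Fintype.card _
    rw [← Nat.card_eq_fintype_card]
    rfl
  · change w ∈ f.sub k ⊔ f'.sub l ↔ _
    rw [h.1, h.2.1, b.span_image_sup, h.mem_span_iff]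
    rfl

end Adapted

/-- The matrix entry is the mixed second difference of the dimensions of the intersections; this
recovers A from the invariants. -/
theorem DecMat.inv_fst_succ (x : DecMat n d) (i j : Fin n) :
    x.inv.1 (i + 1) (j + 1) + x.inv.1 i j =
      x.inv.1 i (j + 1) + x.inv.1 (i + 1) j + x.A i j := by
  classical
  simp only [DecMat.inv, Fintype.card_subtype]
  have h : x.A i j = (Finset.univ.filter fun s : x.Idx => s.1 = (i, j)).card := by
    rw [← Fintype.card_subtype, ← Fintype.card_fin (x.A i j)]
    exact Fintype.card_congr (Equiv.sigmaSubtype (β := fun p => Fin (x.A p.1 p.2)) (i, j)).symm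
  rw [h]
  simp only [Finset.card_filter, ← Finset.sum_add_distrib]
  refine Finset.sum_congr rfl fun s _ => ?_
  have e1 : s.1 = (i, j) ↔ (s.1.1 : ℕ) = i ∧ (s.1.2 : ℕ) = j := by
    rw [Prod.ext_iff, Fin.ext_iff, Fin.ext_iff]
  simp only [e1]
  split_ifs <;> omega

/-- The set Δ consists of the corners of the region where w ∈ V_k + V'_l fails. The converse
direction rests on the fact that a failure at p and success at both neighbours pin down one element
of Δ. -/
theorem DecMat.mem_Δ_iff (x : DecMat n d) (p : Fin n × Fin n) : p ∈ x.Δ ↔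
    ¬ x.inv.2 p.1 p.2 ∧ x.inv.2 (p.1 + 1) p.2 ∧ x.inv.2 p.1 (p.2 + 1) := by
  simp only [DecMat.inv]
  constructor
  · intro hp
    refine ⟨fun h => by simpa using h p hp, fun q hq => ?_, fun q hq => ?_⟩ <;>
    · by_cases hqp : q = p
      · subst hqp; omega
      · have := x.anti q hq p hp hqp
        omega
  · rintro ⟨h1, h2, h3⟩
    push Not at h1
    obtain ⟨q, hq, h4, h5⟩ := h1
    have h2 := h2 q hq
    have h3 := h3 q hq
    have : p = q := Prod.ext (Fin.ext (by omega)) (Fin.ext (by omega))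
    rwa [this]

theorem DecMat.inv_injective : Function.Injective (DecMat.inv (n := n) (d := d)) := by
  intro x y h
  refine DecMat.ext ?_ ?_
  · ext i j
    have h1 := x.inv_fst_succ i j
    have h2 := y.inv_fst_succ i j
    rw [h] at h1
    omega
  · ext p
    rw [x.mem_Δ_iff, y.mem_Δ_iff, h]

/-- Every triple lies in some orbit. -/
theorem exists_inOrbit (f f' : Flag F n d) (w : Fin d → F) : ∃ x : DecMat n d, InOrbit x f f' w := by
  classical
  obtain ⟨b₀, r, c, hr, hc⟩ := exists_basis_of_two_chains n d (Fin d → F) (by simp) f.sub f'.sub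
    f.sub_mono f'.sub_mono f.sub_zero f'.sub_zero (f.sub_of_le le_rfl) (f'.sub_of_le le_rfl)
  obtain ⟨b, T, hr, hc, hw, hT⟩ := exists_basis_of_two_chains_and_vector b₀ r c _ _ hr hc w
  have hlt : ∀ (g : Flag F n d) (r : Fin d → ℕ),
      (∀ k, g.sub k = Submodule.span F (b '' {s | r s < k})) → ∀ s, r s < n := fun g r hr s => by
    have h1 := hr n
    rw [g.sub_of_le le_rfl, ← b.span_eq, ← Set.image_univ] at h1
    exact ((b.span_image_le_iff _ _).mp h1.le) (Set.mem_univ s)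
  set p : Fin d → Fin n × Fin n := fun s => (⟨r s, hlt f r hr s⟩, ⟨c s, hlt f' c hc s⟩) with hp
  set A : Matrix (Fin n) (Fin n) ℕ := fun i j => Fintype.card {s // p s = (i, j)} with hA
  have hpos : ∀ s, 0 < A (p s).1 (p s).2 := fun s => Fintype.card_pos_iff.mpr ⟨⟨s, rfl⟩⟩
  have hinj : ∀ s ∈ T, ∀ t ∈ T, p s = p t → s = t := by
    intro s hs t ht hst
    by_contra hne
    have h1 : r s = r t := congrArg (fun q => (q.1 : ℕ)) hst
    have h2 := hT s hs t ht hne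
    omega
  let x : DecMat n d :=
    { A := A
      Δ := T.image p
      anti := by
        intro q hq q' hq' hne
        obtain ⟨s, hs, rfl⟩ := Finset.mem_image.mp hq
        obtain ⟨t, ht, rfl⟩ := Finset.mem_image.mp hq'
        exact hT s hs t ht fun h => hne (by rw [h])
      pos := by
        intro q hq
        obtain ⟨s, hs, rfl⟩ := Finset.mem_image.mp hq
        exact hpos s
      total := by
        rw [← Fintype.sum_prod_type' (f := fun i j => A i j)]
        have := Fintype.card_congr (Equiv.sigmaFiberEquiv p)
        rw [Fintype.card_sigma, Fintype.card_fin] at this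
        exact this }
  -- The orbit condition uses the basis vector number 0 of each cell in Δ. So every fibre is
  -- numbered with its element of T first; by `hinj` there is at most one.
  have hequiv : ∀ q : Fin n × Fin n, ∃ ε : {s // p s = q} ≃ Fin (A q.1 q.2),
      ∀ (s : {s // p s = q}), s.1 ∈ T → (ε s : ℕ) = 0 := by
    intro q
    have ε₀ : {s // p s = q} ≃ Fin (A q.1 q.2) := Fintype.equivFin _
    by_cases h : ∃ s, p s = q ∧ s ∈ T
    · obtain ⟨s, rfl, hs⟩ := h
      refine ⟨ε₀.trans (Equiv.swap (ε₀ ⟨s, rfl⟩) ⟨0, hpos s⟩), fun t ht => ?_⟩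
      obtain rfl : t = ⟨s, rfl⟩ := Subtype.ext (hinj _ ht _ hs t.2)
      simp
    · exact ⟨ε₀, fun s hs => absurd ⟨s.1, s.2, hs⟩ h⟩
  choose ε hε using hequiv
  let E : Fin d ≃ x.Idx := (Equiv.sigmaFiberEquiv p).symm.trans (Equiv.sigmaCongrRight ε)
  have himg : ∀ P : Set x.Idx, (b.reindex E) '' P = b '' (E ⁻¹' P) := fun P => by
    rw [Module.Basis.coe_reindex, Set.image_comp, Equiv.image_symm_eq_preimage]
  refine ⟨x, inOrbit_iff_adapted.mpr ⟨b.reindex E, fun k => ?_, fun k => ?_, ?_⟩⟩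
  · rw [hr, himg]; rfl
  · rw [hc, himg]; rfl
  · have h1 : ∑ q : {q // q ∈ x.Δ}, b.reindex E ⟨q.1, ⟨0, x.pos q.1 q.2⟩⟩ =
        ∑ q : {q // q ∈ x.Δ}, (fun q => ∑ s ∈ T with p s = q, b s) q.1 := by
      refine Finset.sum_congr rfl fun q _ => ?_
      obtain ⟨q, hq⟩ := q
      obtain ⟨s, hs, rfl⟩ := Finset.mem_image.mp hq
      have h2 : (T.filter fun t => p t = p s) = {s} := by
        ext t
        simp only [Finset.mem_filter, Finset.mem_singleton]
        exact ⟨fun h => hinj _ h.1 _ hs h.2, by rintro rfl; exact ⟨hs, rfl⟩⟩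
      dsimp only
      rw [h2, Finset.sum_singleton, Module.Basis.reindex_apply]
      congr 1
      rw [Equiv.symm_apply_eq]
      exact congrArg (Sigma.mk (p s)) (Fin.ext (hε _ ⟨s, rfl⟩ hs).symm)
    rw [hw, h1, Finset.sum_coe_sort x.Δ fun q => ∑ s ∈ T with p s = q, b s,
      Finset.sum_fiberwise_of_maps_to fun s hs => Finset.mem_image_of_mem p hs]

/-- Some orbit contains the triple, and its decorated matrix is determined by the invariants; so
equal invariants force the same orbit. -/
theorem inOrbit_iff {x : DecMat n d} {f f' : Flag F n d} {w : Fin d → F} :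
    InOrbit x f f' w ↔ inv f f' w = x.inv := by
  have key : ∀ {y : DecMat n d}, InOrbit y f f' w → inv f f' w = y.inv := fun h => by
    obtain ⟨b, hb⟩ := inOrbit_iff_adapted.mp h
    exact hb.inv_eq
  refine ⟨key, fun h => ?_⟩
  obtain ⟨y, hy⟩ := exists_inOrbit f f' w
  rwa [DecMat.inv_injective (h.symm.trans (key hy))]

/-- Every orbit is nonempty, over every field. -/
theorem DecMat.exists_inv_eq (F : Type) [Field F] (x : DecMat n d) :
    ∃ (f f' : Flag F n d) (w : Fin d → F), Mirabolic.inv f f' w = x.inv := by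
  let E : Fin d ≃ x.Idx := Fintype.equivOfCardEq (by rw [x.card_idx, Fintype.card_fin])
  let b : Module.Basis x.Idx F (Fin d → F) := (Pi.basisFun F (Fin d)).reindex E
  have hmono : ∀ r : x.Idx → Fin n,
      Monotone fun k : ℕ => Submodule.span F (b '' {s | (r s : ℕ) < k}) := fun r k l h =>
    Submodule.span_mono (Set.image_mono fun s hs => lt_of_lt_of_le hs h)
  have h0 : ∀ r : x.Idx → Fin n, Submodule.span F (b '' {s | (r s : ℕ) < 0}) = ⊥ := fun r => by
    simp
  have hn : ∀ r : x.Idx → Fin n, Submodule.span F (b '' {s | (r s : ℕ) < n}) = ⊤ := fun r => by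
    simp [b.span_eq]
  refine ⟨Flag.ofSub _ (hmono fun s => s.1.1) (h0 _) (hn _),
    Flag.ofSub _ (hmono fun s => s.1.2) (h0 _) (hn _), _, Adapted.inv_eq (b := b) ⟨?_, ?_, rfl⟩⟩ <;>
  exact Flag.sub_ofSub _ _ _ _

end

/-! ### Divisibility of polynomials from divisibility of values -/

open Polynomial in
-- The remainder T of P modulo D has smaller degree, so |T(p)| < |D(p)| for all large p. Since D(p)
-- divides T(p), it follows that T(p) = 0 at infinitely many primes.
theorem dvd_of_forall_prime_eval_dvd {P D : ℤ[X]} (hD : D.Monic)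
    (h : ∀ p : ℕ, p.Prime → D.eval (p : ℤ) ∣ P.eval (p : ℤ)) : D ∣ P := by
  rw [← modByMonic_eq_zero_iff_dvd hD]
  set T := P %ₘ D with hT
  have h1 : ∀ p : ℕ, p.Prime → D.eval (p : ℤ) ∣ T.eval (p : ℤ) := fun p hp => by
    have := modByMonic_add_div P D
    rw [← hT] at this
    have h2 : T.eval (p : ℤ) = P.eval (p : ℤ) - D.eval (p : ℤ) * (P /ₘ D).eval (p : ℤ) := by
      conv_rhs => enter [1]; rw [← this]
      simp
    rw [h2]
    exact dvd_sub (h p hp) (Dvd.intro _ rfl)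
  have hdeg : (T.map (Int.castRingHom ℝ)).degree < (D.map (Int.castRingHom ℝ)).degree := by
    rw [degree_map_eq_of_injective (RingHom.injective_int _),
      degree_map_eq_of_injective (RingHom.injective_int _)]
    exact degree_modByMonic_lt P hD
  have hlim := div_tendsto_atTop_zero_of_degree_lt _ _ hdeg
  have hev := (hlim.eventually (Metric.ball_mem_nhds (0 : ℝ) one_pos)).and
    (Filter.eventually_ge_atTop 0)
  obtain ⟨N, hN⟩ := Filter.eventually_atTop.mp hev
  obtain ⟨M, hM⟩ := exists_nat_ge N
  by_contra hne
  have hfin : (T.roots.toFinset : Set ℤ).Finite := Finset.finite_toSet _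
  refine (Nat.infinite_setOfPred_prime.sdiff (Set.finite_lt_nat M)) ?_
  refine Set.Finite.of_finite_image (f := ((↑) : ℕ → ℤ)) (hfin.subset ?_)
    (Nat.cast_injective.injOn)
  rintro _ ⟨p, ⟨hp, hpM⟩, rfl⟩
  have hpM : M ≤ p := by simpa using hpM
  rw [Finset.mem_coe, Multiset.mem_toFinset, mem_roots hne, IsRoot.def]
  have h3 := (hN p (hM.trans (by exact_mod_cast hpM))).1
  rw [dist_zero_right, norm_div, Real.norm_eq_abs, Real.norm_eq_abs] at h3
  have hcast : ∀ S : ℤ[X], (S.map (Int.castRingHom ℝ)).eval (p : ℝ) = ((S.eval (p : ℤ) : ℤ) : ℝ) :=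
    fun S => by rw [eval_map, eval₂_at_natCast]; simp
  rw [hcast, hcast] at h3
  by_contra h0
  have h4 := Int.le_of_dvd (abs_pos.mpr h0) ((abs_dvd_abs _ _).mpr (h1 p hp))
  have h5 : D.eval (p : ℤ) ≠ 0 := fun h => h0 (zero_dvd_iff.mp (h ▸ h1 p hp))
  have h6 : (0 : ℝ) < |((D.eval (p : ℤ) : ℤ) : ℝ)| := abs_pos.mpr (by exact_mod_cast h5)
  rw [div_lt_one h6] at h3
  exact absurd h3 (not_lt.mpr (by exact_mod_cast h4))

/-! ### Functions with polynomial values -/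

theorem PrimePower.one_lt_q (Q : PrimePower) : 1 < Q.q :=
  Nat.one_lt_pow Q.k_pos.ne' Q.prime.out.one_lt

theorem PrimePower.natCard_Fq (Q : PrimePower) : Nat.card Q.Fq = Q.q :=
  GaloisField.card Q.p Q.k Q.k_pos.ne'

theorem PrimePower.natCard_submodule (Q : PrimePower) {V : Type} [AddCommGroup V] [Module Q.Fq V]
    [Module.Finite Q.Fq V] (W : Submodule Q.Fq V) :
    Nat.card W = Q.q ^ Module.finrank Q.Fq W := by
  rw [Module.natCard_eq_pow_finrank (K := Q.Fq), Q.natCard_Fq]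

section

variable {n d : ℕ}

/-- Functions on all triples over all finite fields. -/
abbrev TripleFun (n d : ℕ) (α : Type) : Type :=
  ∀ Q : PrimePower, Flag Q.Fq n d → Flag Q.Fq n d → (Fin d → Q.Fq) → α

/-- The value on each orbit is given by a polynomial in `q` with integral coefficients. -/
def Poly (N : TripleFun n d ℤ) : Prop :=
  ∃ P : Inv → Polynomial ℤ, ∀ Q f f' w, N Q f f' w = (P (inv f f' w)).eval (Q.q : ℤ)

namespace Poly

variable {M N : TripleFun n d ℤ}

theorem of_inv (P : Inv → Polynomial ℤ) :
    Poly (n := n) (d := d) fun Q f f' w => (P (inv f f' w)).eval (Q.q : ℤ) :=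
  ⟨P, fun _ _ _ _ => rfl⟩

theorem congr (h : Poly M) (hMN : ∀ Q f f' w, M Q f f' w = N Q f f' w) : Poly N := by
  obtain ⟨P, hP⟩ := h
  exact ⟨P, fun Q f f' w => by rw [← hMN, hP]⟩

theorem sub (hM : Poly M) (hN : Poly N) :
    Poly fun Q f f' w => M Q f f' w - N Q f f' w := by
  obtain ⟨P, hP⟩ := hM
  obtain ⟨R, hR⟩ := hN
  exact ⟨P - R, fun Q f f' w => by simp [hP, hR]⟩

theorem mul (hM : Poly M) (hN : Poly N) :
    Poly fun Q f f' w => M Q f f' w * N Q f f' w := by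
  obtain ⟨P, hP⟩ := hM
  obtain ⟨R, hR⟩ := hN
  exact ⟨P * R, fun Q f f' w => by simp [hP, hR]⟩

theorem sum {ι : Type*} (s : Finset ι) {M : ι → TripleFun n d ℤ} (hM : ∀ i ∈ s, Poly (M i)) :
    Poly fun Q f f' w => ∑ i ∈ s, M i Q f f' w := by
  choose! P hP using hM
  exact ⟨fun ι => ∑ i ∈ s, P i ι, fun Q f f' w => by
    rw [Polynomial.eval_finsetSum]
    exact Finset.sum_congr rfl fun i hi => hP i hi Q f f' w⟩

theorem q_pow (e : Inv → ℕ) :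
    Poly (n := n) (d := d) fun Q f f' w => (Q.q : ℤ) ^ e (inv f f' w) :=
  (of_inv fun ι => Polynomial.X ^ e ι).congr fun Q f f' w => by simp

open Polynomial in
/-- Exact division by a monic polynomial. -/
theorem of_mul (D : Inv → ℤ[X]) (hD : ∀ ι, (D ι).Monic)
    (hD0 : ∀ ι (Q : PrimePower), (D ι).eval (Q.q : ℤ) ≠ 0)
    (h : Poly fun Q f f' w => (D (inv f f' w)).eval (Q.q : ℤ) * N Q f f' w) : Poly N := by
  obtain ⟨P, hP⟩ := h
  refine ⟨fun ι => P ι /ₘ D ι, fun Q f f' w => ?_⟩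
  obtain ⟨x, hx⟩ := exists_inOrbit f f' w
  rw [inOrbit_iff] at hx
  -- The orbit of x is nonempty over every prime field, so the hypothesis yields an integral
  -- quotient at every prime p.
  have hdvd : D x.inv ∣ P x.inv := dvd_of_forall_prime_eval_dvd (hD _) fun p hp => by
    let Q' : PrimePower := ⟨p, 1, ⟨hp⟩, one_pos⟩
    have hq : Q'.q = p := pow_one p
    obtain ⟨g, g', u, hg⟩ := x.exists_inv_eq Q'.Fq
    have := hP Q' g g' u
    dsimp only at this
    rw [hg, hq] at this
    exact Dvd.intro _ this
  have h1 := hP Q f f' w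
  dsimp only at h1 ⊢
  rw [hx] at h1 ⊢
  refine mul_left_cancel₀ (hD0 x.inv Q) ?_
  rw [h1, ← eval_mul]
  congr 1
  have h2 := modByMonic_add_div (P x.inv) (D x.inv)
  rw [(modByMonic_eq_zero_iff_dvd (hD _)).mpr hdvd, zero_add] at h2
  exact h2.symm

open Classical in
/-- A sum over a set on which two increasing chains of conditions are given, of a function that
depends only on the places where the conditions begin to hold. -/
theorem sum_of_chains {Y : PrimePower → Type} [∀ Q, Fintype (Y Q)] (m : ℕ)
    (B : ∀ Q, Flag Q.Fq n d → Flag Q.Fq n d → (Fin d → Q.Fq) → Y Q → Prop)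
    (S T : ∀ Q, Flag Q.Fq n d → Flag Q.Fq n d → (Fin d → Q.Fq) → ℕ → Y Q → Prop)
    (hS : ∀ Q f f' w y, Monotone fun a => S Q f f' w a y)
    (hT : ∀ Q f f' w y, Monotone fun a => T Q f f' w a y)
    (hSm : ∀ Q f f' w y, B Q f f' w y → S Q f f' w m y)
    (hTm : ∀ Q f f' w y, B Q f f' w y → T Q f f' w m y)
    (hcard : ∀ a ≤ m, ∀ b ≤ m, Poly fun Q f f' w =>
      ((Finset.univ.filter fun y => B Q f f' w y ∧ S Q f f' w a y ∧ T Q f f' w b y).card : ℤ))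
    (G : Inv → (ℕ → Prop) → (ℕ → Prop) → Polynomial ℤ) :
    Poly fun Q f f' w => ∑ y with B Q f f' w y,
      (G (inv f f' w) (fun a => S Q f f' w a y) (fun b => T Q f f' w b y)).eval (Q.q : ℤ) := by
  -- The elements whose two chains begin exactly at a and b are counted by taking differences of
  -- `hcard` in each index.
  have hpre : ∀ a ≤ m, ∀ b ≤ m, Poly fun Q f f' w =>
      ((Finset.univ.filter fun y => B Q f f' w y ∧ (S Q f f' w a y ∧ ¬ ∃ a' < a, S Q f f' w a' y) ∧
        (T Q f f' w b y ∧ ¬ ∃ b' < b, T Q f f' w b' y)).card : ℤ) := by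
    have step : ∀ (U : ∀ Q, Flag Q.Fq n d → Flag Q.Fq n d → (Fin d → Q.Fq) → Y Q → Prop)
        (S : ∀ Q, Flag Q.Fq n d → Flag Q.Fq n d → (Fin d → Q.Fq) → ℕ → Y Q → Prop)
        (_ : ∀ Q f f' w y, Monotone fun a => S Q f f' w a y),
        (∀ a ≤ m, Poly fun Q f f' w =>
          ((Finset.univ.filter fun y => U Q f f' w y ∧ S Q f f' w a y).card : ℤ)) →
        ∀ a ≤ m, Poly fun Q f f' w => ((Finset.univ.filter fun y => U Q f f' w y ∧
          (S Q f f' w a y ∧ ¬ ∃ a' < a, S Q f f' w a' y)).card : ℤ) := by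
      intro U S hS h a ha
      rcases a with _ | a
      · simpa using h 0 ha
      · refine ((h (a + 1) ha).sub (h a (by omega))).congr fun Q f f' w => ?_
        have hex : ∀ y, (∃ a' < a + 1, S Q f f' w a' y) ↔ S Q f f' w a y := fun y =>
          ⟨fun ⟨a', h1, h2⟩ => hS Q f f' w y (Nat.lt_succ_iff.mp h1) h2, fun h => ⟨a, by simp, h⟩⟩
        have hsub : ∀ y, S Q f f' w a y → S Q f f' w (a + 1) y := fun y =>
          hS Q f f' w y (Nat.le_succ a)
        rw [sub_eq_iff_eq_add]
        norm_cast
        rw [← Finset.card_union_of_disjoint]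
        · congr 1
          ext y
          have := hsub y
          simp only [Finset.mem_filter, Finset.mem_univ, true_and, Finset.mem_union, hex]
          tauto
        · rw [Finset.disjoint_filter]
          intro y _ h1 h2
          exact h1.2.2 ((hex y).mpr h2.2)
    intro a ha b hb
    refine (step (fun Q f f' w y => B Q f f' w y ∧ T Q f f' w b y ∧ ¬ ∃ b' < b, T Q f f' w b' y)
      S hS (fun a ha => ?_) a ha).congr fun Q f f' w => ?_
    · refine (step (fun Q f f' w y => B Q f f' w y ∧ S Q f f' w a y) T hT (fun b hb => ?_) b
        hb).congr fun Q f f' w => ?_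
      · exact (hcard a ha b hb).congr fun Q f f' w => by simp only [and_assoc]
      · congr 2; ext y; simp only [Finset.mem_filter]; tauto
    · congr 2; ext y; simp only [Finset.mem_filter]; tauto
  -- A monotone chain is determined by its starting place, so on each class G may be evaluated at
  -- the threshold predicates `a ≤ k` and `b ≤ k`.
  refine (Poly.sum (Finset.range (m + 1)) fun a ha => Poly.sum (Finset.range (m + 1)) fun b hb =>
    (of_inv fun ι => G ι (fun k => a ≤ k) (fun k => b ≤ k)).mul
      (hpre a (by simpa [Nat.lt_succ_iff] using ha) b
        (by simpa [Nat.lt_succ_iff] using hb))).congr fun Q f f' w => ?_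
  have hfind : ∀ (S : ℕ → Prop), Monotone S → S m → ∀ a,
      (S a ∧ ¬ ∃ a' < a, S a') → a < m + 1 ∧ S = fun k => a ≤ k := by
    intro S hS hSm a ha
    have hle : ∀ k, S k → a ≤ k := fun k hk => not_lt.mp fun h => ha.2 ⟨k, h, hk⟩
    exact ⟨Nat.lt_succ_of_le (hle m hSm), funext fun k => propext ⟨hle k, fun h => hS h ha.1⟩⟩
  have hex : ∀ (S : ℕ → Prop), S m → ∃ a, S a ∧ ¬ ∃ a' < a, S a' := fun S hSm =>
    ⟨Nat.find ⟨m, hSm⟩, Nat.find_spec ⟨m, hSm⟩, fun ⟨a', h1, h2⟩ => Nat.find_min ⟨m, hSm⟩ h1 h2⟩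
  rw [← Finset.sum_product']
  symm
  choose! α hα using fun y (hy : B Q f f' w y) => hex (fun a => S Q f f' w a y) (hSm _ _ _ _ _ hy)
  choose! β hβ using fun y (hy : B Q f f' w y) => hex (fun a => T Q f f' w a y) (hTm _ _ _ _ _ hy)
  have huniq : ∀ (S : ℕ → Prop) a b, (S a ∧ ¬ ∃ a' < a, S a') → (S b ∧ ¬ ∃ a' < b, S a') →
      a = b := fun S a b ha hb =>
    le_antisymm (not_lt.mp fun h => ha.2 ⟨b, h, hb.1⟩) (not_lt.mp fun h => hb.2 ⟨a, h, ha.1⟩)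
  rw [← Finset.sum_fiberwise_of_maps_to (g := fun y => (α y, β y))
    (t := Finset.range (m + 1) ×ˢ Finset.range (m + 1))]
  · refine Finset.sum_congr rfl fun ab _ => ?_
    obtain ⟨a, b⟩ := ab
    rw [Finset.filter_filter, mul_comm, ← nsmul_eq_mul, ← Finset.sum_const]
    refine Finset.sum_congr ?_ fun y hy => ?_
    · ext y
      simp only [Finset.mem_filter, Finset.mem_univ, true_and, Prod.mk.injEq]
      constructor
      · rintro ⟨hB, rfl, rfl⟩
        exact ⟨hB, hα y hB, hβ y hB⟩
      · rintro ⟨hB, h1, h2⟩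
        exact ⟨hB, huniq (fun a => S Q f f' w a y) _ _ (hα y hB) h1,
          huniq (fun a => T Q f f' w a y) _ _ (hβ y hB) h2⟩
    · rw [Finset.mem_filter] at hy
      dsimp only
      rw [(hfind _ (hS Q f f' w y) (hSm _ _ _ _ _ hy.2.1) _ hy.2.2.1).2,
        (hfind _ (hT Q f f' w y) (hTm _ _ _ _ _ hy.2.1) _ hy.2.2.2).2]
  · intro y hy
    have hB := (Finset.mem_filter.mp hy).2
    rw [Finset.mem_product, Finset.mem_range, Finset.mem_range]
    exact ⟨(hfind _ (hS Q f f' w y) (hSm _ _ _ _ _ hB) _ (hα y hB)).1,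
      (hfind _ (hT Q f f' w y) (hTm _ _ _ _ _ hB) _ (hβ y hB)).1⟩

end Poly

/-- Double counting: a sum over flags becomes a sum over vectors or linear forms, when each flag
comes from c of them and each of them defines one flag. -/
theorem mul_sum_eq_sum_of_existsUnique {X Y : Type} [Fintype X] [Fintype Y] (R : X → Y → Prop)
    (A : X → Prop) (B : Y → Prop) [DecidablePred A] [DecidablePred B]
    [∀ x, DecidablePred (R x)] (c : ℤ) (G : X → ℤ) (H : Y → ℤ)
    (h1 : ∀ x, A x → ((Finset.univ.filter fun y => B y ∧ R x y).card : ℤ) = c)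
    (h2 : ∀ y, B y → ∃! x, A x ∧ R x y) (h3 : ∀ x y, A x → B y → R x y → G x = H y) :
    c * ∑ x with A x, G x = ∑ y with B y, H y := by
  have e1 : c * ∑ x with A x, G x = ∑ x with A x, ∑ y with B y, if R x y then H y else 0 := by
    rw [Finset.mul_sum]
    refine Finset.sum_congr rfl fun x hx => ?_
    have hx := (Finset.mem_filter.mp hx).2
    rw [← h1 x hx, ← Finset.sum_filter, Finset.filter_filter, ← nsmul_eq_mul, ← Finset.sum_const]
    exact Finset.sum_congr rfl fun y hy => by
      have := (Finset.mem_filter.mp hy).2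
      exact h3 x y hx this.1 this.2
  rw [e1, Finset.sum_comm]
  refine Finset.sum_congr rfl fun y hy => ?_
  obtain ⟨x, hx, hux⟩ := h2 y (Finset.mem_filter.mp hy).2
  rw [Finset.sum_eq_single x, if_pos hx.2]
  · intro x' hx' hne
    exact if_neg fun h => hne (hux x' ⟨(Finset.mem_filter.mp hx').2, h⟩)
  · intro h
    exact absurd (Finset.mem_filter.mpr ⟨Finset.mem_univ _, hx.1⟩) h

end

/-! ### Adjoining a line and cutting with a hyperplane -/

section

open Submodule Module

variable {F V : Type} [Field F] [AddCommGroup V] [Module F V]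

theorem mem_sup_span_singleton_iff {P : Submodule F V} {x y : V} :
    x ∈ P ⊔ span F {y} ↔ ∃ c : F, x - c • y ∈ P := by
  rw [mem_sup]
  constructor
  · rintro ⟨p, hp, z, hz, rfl⟩
    obtain ⟨c, rfl⟩ := mem_span_singleton.mp hz
    exact ⟨c, by simpa using hp⟩
  · rintro ⟨c, hc⟩
    exact ⟨_, hc, c • y, mem_span_singleton.mpr ⟨c, rfl⟩, by simp⟩

/-- The exchange property of linear dependence. It turns the condition that w lies in an enlarged
sum into conditions on the adjoined vector y. -/
theorem mem_sup_span_singleton_exchange {P : Submodule F V} {x y : V} :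
    x ∈ P ⊔ span F {y} ↔ x ∈ P ∨ (y ∉ P ∧ y ∈ P ⊔ span F {x}) := by
  rw [mem_sup_span_singleton_iff, mem_sup_span_singleton_iff]
  constructor
  · rintro ⟨c, hc⟩
    by_cases hx : x ∈ P
    · exact Or.inl hx
    · have hc0 : c ≠ 0 := by rintro rfl; simp at hc; exact hx hc
      refine Or.inr ⟨fun hy => hx ?_, c⁻¹, ?_⟩
      · have := add_mem hc (smul_mem P c hy)
        simpa using this
      · have := smul_mem P (-c⁻¹) hc
        rwa [smul_sub, smul_smul, neg_mul, inv_mul_cancel₀ hc0, neg_smul, neg_smul, one_smul,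
          sub_neg_eq_add, add_comm, ← sub_eq_add_neg] at this
  · rintro (hx | ⟨hy, c, hc⟩)
    · exact ⟨0, by simpa using hx⟩
    · have hc0 : c ≠ 0 := by rintro rfl; simp at hc; exact hy hc
      refine ⟨c⁻¹, ?_⟩
      have := smul_mem P (-c⁻¹) hc
      rwa [smul_sub, smul_smul, neg_mul, inv_mul_cancel₀ hc0, neg_smul, neg_smul, one_smul,
        sub_neg_eq_add, add_comm, ← sub_eq_add_neg] at this

-- If y = u + p with u in U and p in P, then y may be replaced by u, and the modular law applies. If
-- y is not in U + P, the exchange property shows that nothing new enters U.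
open Classical in
theorem finrank_inf_sup_span_singleton [FiniteDimensional F V] (U P : Submodule F V) (y : V) :
    finrank F ↥(U ⊓ (P ⊔ span F {y})) =
      finrank F ↥(U ⊓ P) + if y ∈ U ⊔ P ∧ y ∉ P then 1 else 0 := by
  split_ifs with h
  · obtain ⟨h1, h2⟩ := h
    obtain ⟨u, hu, p, hp, rfl⟩ := mem_sup.mp h1
    have e1 : P ⊔ span F {u + p} = P ⊔ span F {u} := by
      apply le_antisymm <;> refine sup_le le_sup_left ?_ <;>
        rw [span_singleton_le_iff_mem, mem_sup_span_singleton_iff]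
      · exact ⟨1, by simpa using hp⟩
      · exact ⟨1, by simpa using neg_mem hp⟩
    have hu' : u ∉ P := fun h => h2 (add_mem h hp)
    rw [e1, ← inf_sup_assoc_of_le _ (by rwa [span_singleton_le_iff_mem]),
      finrank_sup_span_singleton fun h => hu' (mem_inf.mp h).2]
  · rw [add_zero]
    suffices h' : U ⊓ (P ⊔ span F {y}) = U ⊓ P by rw [h']
    refine le_antisymm (fun x hx => ?_) (inf_le_inf_left U le_sup_left)
    obtain ⟨hxU, hx⟩ := mem_inf.mp hx
    refine mem_inf.mpr ⟨hxU, ?_⟩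
    rw [mem_sup_span_singleton_exchange] at hx
    rcases hx with hx | ⟨hy, hx⟩
    · exact hx
    · refine absurd ⟨?_, hy⟩ h
      rw [sup_comm]
      exact (sup_le_sup_left (by rwa [span_singleton_le_iff_mem]) P) hx

open Classical in
theorem finrank_inf_ker [FiniteDimensional F V] (Z : Submodule F V) (ξ : Dual F V) :
    finrank F Z = finrank F ↥(Z ⊓ LinearMap.ker ξ) + if Z ≤ LinearMap.ker ξ then 0 else 1 := by
  split_ifs with h
  · rw [inf_eq_left.mpr h, add_zero]
  · obtain ⟨z, hz, hzξ⟩ := SetLike.not_le_iff_exists.mp h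
    have h1 : Z = (Z ⊓ LinearMap.ker ξ) ⊔ span F {z} := by
      apply le_antisymm
      · intro x hx
        rw [mem_sup_span_singleton_iff]
        refine ⟨ξ x / ξ z, sub_mem hx (smul_mem _ _ hz), ?_⟩
        have : ξ z ≠ 0 := hzξ
        simp [this]
      · exact sup_le inf_le_left (by rwa [span_singleton_le_iff_mem])
    conv_lhs => rw [h1]
    exact finrank_sup_span_singleton fun h => hzξ (mem_inf.mp h).2

end

open Classical in
theorem PrimePower.card_filter_mem (Q : PrimePower) {V : Type} [AddCommGroup V] [Module Q.Fq V]
    [Module.Finite Q.Fq V] [Fintype V] (W : Submodule Q.Fq V) :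
    (((Finset.univ.filter fun y : V => y ∈ W).card : ℕ) : ℤ) =
      (Q.q : ℤ) ^ Module.finrank Q.Fq W := by
  rw [← Fintype.card_subtype, ← Nat.card_eq_fintype_card]
  exact_mod_cast Q.natCard_submodule W

/-! ### Flags that differ in one step -/

section

variable {F : Type} [Field F] {n d : ℕ}

/-- `g` arises from `f` by enlarging the step `i` by `R` dimensions. -/
def Below (i R : ℕ) (f g : Flag F n d) : Prop :=
  (∀ k, k ≠ i → f.sub k = g.sub k) ∧ f.sub i ≤ g.sub i ∧
    Module.finrank F (g.sub i) = Module.finrank F (f.sub i) + R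

theorem Below.sub_le {i R : ℕ} {f g : Flag F n d} (h : Below i R f g) (k : ℕ) :
    f.sub k ≤ g.sub k := by
  by_cases hk : k = i
  · rw [hk]; exact h.2.1
  · exact (h.1 k hk).le

/-- The lines in the quotient of two consecutive steps. -/
theorem Below.existsUnique_of_mem {i : ℕ} (hi : 0 < i) (hin : i < n) (f : Flag F n d)
    {y : Fin d → F} (hy : y ∈ f.sub (i + 1)) (hy' : y ∉ f.sub i) :
    ∃! g, Below i 1 f g ∧ y ∈ g.sub i := by
  have hle : f.sub i ⊔ Submodule.span F {y} ≤ f.sub (i + 1) :=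
    sup_le (f.sub_mono (Nat.le_add_right i 1)) (by rwa [Submodule.span_singleton_le_iff_mem])
  have hfr := Submodule.finrank_sup_span_singleton hy'
  obtain ⟨g, hg, hg'⟩ := f.exists_update hi hin
    ((f.sub_mono (Nat.sub_le i 1)).trans le_sup_left) hle
  refine ⟨g, ⟨⟨fun k hk => (hg' k hk).symm, ?_, ?_⟩, ?_⟩, ?_⟩
  · rw [hg]; exact le_sup_left
  · rw [hg, hfr]
  · rw [hg]; exact Submodule.mem_sup_right (Submodule.mem_span_singleton_self y)
  · rintro g₂ ⟨⟨h1, h2, h3⟩, h4⟩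
    refine Flag.ext_sub fun k => ?_
    by_cases hk : k = i
    · subst hk
      rw [hg]
      symm
      refine Submodule.eq_of_le_of_finrank_eq (sup_le h2 ?_) (by rw [hfr, h3])
      rwa [Submodule.span_singleton_le_iff_mem]
    · rw [hg' k hk, h1 k hk]

/-- The hyperplanes in the quotient of two consecutive steps. -/
theorem Below.existsUnique_of_ker {i : ℕ} (hi : 0 < i) (hin : i < n) (f : Flag F n d)
    {ξ : Module.Dual F (Fin d → F)} (hξ : f.sub (i - 1) ≤ LinearMap.ker ξ)
    (hξ' : ¬ f.sub i ≤ LinearMap.ker ξ) :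
    ∃! g, Below i 1 g f ∧ g.sub i ≤ LinearMap.ker ξ := by
  classical
  have hfr := finrank_inf_ker (f.sub i) ξ
  rw [if_neg hξ'] at hfr
  obtain ⟨g, hg, hg'⟩ := f.exists_update hi hin
    (le_inf (f.sub_mono (Nat.sub_le i 1)) hξ) (inf_le_left.trans (f.sub_mono (Nat.le_add_right i 1)))
  refine ⟨g, ⟨⟨hg', ?_, ?_⟩, ?_⟩, ?_⟩
  · rw [hg]; exact inf_le_left
  · rw [hg, hfr]
  · rw [hg]; exact inf_le_right
  · rintro g₂ ⟨⟨h1, h2, h3⟩, h4⟩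
    refine Flag.ext_sub fun k => ?_
    by_cases hk : k = i
    · subst hk
      rw [hg]
      refine Submodule.eq_of_le_of_finrank_eq (le_inf h2 h4) (by omega)
    · rw [hg' k hk, h1 k hk]

end

section

variable {n d : ℕ}

-- A larger step g_i = V_i + ⟨y⟩ is defined by the y in g_i outside V_i. Their number is the factor
-- by which the sum over vectors exceeds the sum over flags.
open Classical in
theorem card_filter_mem_and_notMem (Q : PrimePower) {i : ℕ} (f g : Flag Q.Fq n d)
    (hfg : Below i 1 f g) :
    (((Finset.univ.filter fun y => (y ∈ f.sub (i + 1) ∧ y ∉ f.sub i) ∧ y ∈ g.sub i).card : ℕ) : ℤ) =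
      (Q.q : ℤ) ^ Module.finrank Q.Fq (f.sub i) * (Q.q - 1) := by
  have h1 : (Finset.univ.filter fun y => (y ∈ f.sub (i + 1) ∧ y ∉ f.sub i) ∧ y ∈ g.sub i) =
      (Finset.univ.filter fun y => y ∈ g.sub i) \ (Finset.univ.filter fun y => y ∈ f.sub i) := by
    ext y
    have h2 : y ∈ g.sub i → y ∈ f.sub (i + 1) := fun h => by
      rw [hfg.1 (i + 1) (by omega)]; exact g.sub_mono (Nat.le_add_right i 1) h
    simp only [Finset.mem_filter, Finset.mem_univ, true_and, Finset.mem_sdiff]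
    tauto
  rw [h1, Finset.card_sdiff_of_subset, Nat.cast_sub, Q.card_filter_mem, Q.card_filter_mem,
    hfg.2.2]
  · ring
  · exact Finset.card_le_card fun y hy => by
      simp only [Finset.mem_filter, Finset.mem_univ, true_and] at hy ⊢; exact hfg.2.1 hy
  · exact fun y hy => by
      simp only [Finset.mem_filter, Finset.mem_univ, true_and] at hy ⊢; exact hfg.2.1 hy

instance (Q : PrimePower) : Fintype (Module.Dual Q.Fq (Fin d → Q.Fq)) :=
  have : Finite (Module.Dual Q.Fq (Fin d → Q.Fq)) := Module.finite_of_finite Q.Fq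
  Fintype.ofFinite _

open Classical in
theorem card_filter_le_ker (Q : PrimePower) (W : Submodule Q.Fq (Fin d → Q.Fq)) :
    (((Finset.univ.filter fun ξ : Module.Dual Q.Fq (Fin d → Q.Fq) =>
      W ≤ LinearMap.ker ξ).card : ℕ) : ℤ) = (Q.q : ℤ) ^ (d - Module.finrank Q.Fq W) := by
  have h1 := Subspace.finrank_add_finrank_dualAnnihilator_eq W
  have h2 : d - Module.finrank Q.Fq W = Module.finrank Q.Fq W.dualAnnihilator := by
    rw [Module.finrank_fin_fun] at h1
    omega
  rw [h2, ← Q.card_filter_mem W.dualAnnihilator]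
  congr 3
  ext ξ
  rw [Submodule.mem_dualAnnihilator]
  rfl

-- The dual count: g_i is the hyperplane V_i ∩ ker ξ of V_i exactly for the forms that kill g_i but
-- not V_i.
open Classical in
theorem card_filter_le_ker_and_not (Q : PrimePower) {i : ℕ} (f g : Flag Q.Fq n d) (hi : 0 < i)
    (hfg : Below i 1 g f) :
    (((Finset.univ.filter fun ξ : Module.Dual Q.Fq (Fin d → Q.Fq) =>
      (f.sub (i - 1) ≤ LinearMap.ker ξ ∧ ¬ f.sub i ≤ LinearMap.ker ξ) ∧
        g.sub i ≤ LinearMap.ker ξ).card : ℕ) : ℤ) =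
      (Q.q : ℤ) ^ (d - Module.finrank Q.Fq (f.sub i)) * (Q.q - 1) := by
  have h1 : (Finset.univ.filter fun ξ : Module.Dual Q.Fq (Fin d → Q.Fq) =>
      (f.sub (i - 1) ≤ LinearMap.ker ξ ∧ ¬ f.sub i ≤ LinearMap.ker ξ) ∧
        g.sub i ≤ LinearMap.ker ξ) =
      (Finset.univ.filter fun ξ => g.sub i ≤ LinearMap.ker ξ) \
        (Finset.univ.filter fun ξ => f.sub i ≤ LinearMap.ker ξ) := by
    ext ξ
    have h2 : g.sub i ≤ LinearMap.ker ξ → f.sub (i - 1) ≤ LinearMap.ker ξ := fun h => by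
      rw [← hfg.1 (i - 1) (by omega)]; exact (g.sub_mono (Nat.sub_le i 1)).trans h
    simp only [Finset.mem_filter, Finset.mem_univ, true_and, Finset.mem_sdiff]
    tauto
  have h3 : Module.finrank Q.Fq (f.sub i) ≤ d := by
    simpa using Submodule.finrank_le (f.sub i)
  have h4 := hfg.2.2
  rw [h1, Finset.card_sdiff_of_subset, Nat.cast_sub, card_filter_le_ker, card_filter_le_ker,
    show d - Module.finrank Q.Fq (g.sub i) = d - Module.finrank Q.Fq (f.sub i) + 1 by omega]
  · ring
  · exact Finset.card_le_card fun y hy => by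
      simp only [Finset.mem_filter, Finset.mem_univ, true_and] at hy ⊢; exact hfg.2.1.trans hy
  · exact fun y hy => by
      simp only [Finset.mem_filter, Finset.mem_univ, true_and] at hy ⊢; exact hfg.2.1.trans hy

open Polynomial in
theorem monic_X_pow_mul (e : ℕ) : (X ^ e * (X - 1) : ℤ[X]).Monic :=
  (monic_X_pow e).mul (by simpa using monic_X_sub_C (1 : ℤ))

open Polynomial in
theorem eval_X_pow_mul_ne_zero (e : ℕ) (Q : PrimePower) :
    (X ^ e * (X - 1) : ℤ[X]).eval (Q.q : ℤ) ≠ 0 := by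
  have := Q.one_lt_q
  simp only [eval_mul, eval_pow, eval_X, eval_sub, eval_one]
  refine mul_ne_zero (pow_ne_zero _ (by omega)) (by omega)

/-! ### Sums over flags with a larger step -/

theorem inv_fst_top {F : Type} [Field F] (f f' : Flag F n d) (w : Fin d → F) (k : ℕ) :
    (inv f f' w).1 k n = Module.finrank F (f.sub k) := by
  change Module.finrank F ↥(f.sub k ⊓ f'.sub n) = _
  rw [f'.sub_of_le le_rfl, inf_top_eq]

-- This is the exponent of q in the number of y that satisfy both chain conditions. For b < a the
-- two subspaces are nested if w ∈ V_i + V'_a; otherwise they meet only in V_i + V'_b.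
open Classical in
theorem finrank_inf_chains {F : Type} [Field F] (f f' : Flag F n d) (w : Fin d → F) (i a b : ℕ) :
    Module.finrank F ↥(f.sub (i + 1) ⊓ ((f.sub i ⊔ f'.sub a) ⊓
      ((f.sub i ⊔ f'.sub b) ⊔ Submodule.span F {w}))) =
    if a ≤ b then (inv f f' w).1 i n + (inv f f' w).1 (i + 1) a - (inv f f' w).1 i a
    else if (inv f f' w).2 i a then
      (inv f f' w).1 i n + (inv f f' w).1 (i + 1) b - (inv f f' w).1 i b +
        (if (inv f f' w).2 (i + 1) b ∧ ¬ (inv f f' w).2 i b then 1 else 0)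
    else (inv f f' w).1 i n + (inv f f' w).1 (i + 1) b - (inv f f' w).1 i b := by
  have hdim : ∀ c, Module.finrank F ↥(f.sub (i + 1) ⊓ (f.sub i ⊔ f'.sub c)) =
      (inv f f' w).1 i n + (inv f f' w).1 (i + 1) c - (inv f f' w).1 i c := fun c => by
    have hle := f.sub_mono (Nat.le_add_right i 1)
    have h2 := Submodule.finrank_sup_add_finrank_inf_eq (f.sub i) (f'.sub c ⊓ f.sub (i + 1))
    have e1 : f.sub i ⊓ (f'.sub c ⊓ f.sub (i + 1)) = f.sub i ⊓ f'.sub c := by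
      rw [inf_comm (f'.sub c), ← inf_assoc, inf_eq_left.mpr hle]
    have e2 : f.sub i ⊔ (f'.sub c ⊓ f.sub (i + 1)) = f.sub (i + 1) ⊓ (f.sub i ⊔ f'.sub c) := by
      rw [← sup_inf_assoc_of_le _ hle, inf_comm]
    rw [e1, e2, inf_comm (f'.sub c)] at h2
    rw [inv_fst_top]
    simp only [inv]
    omega
  have hmono : ∀ {a b}, a ≤ b → f.sub i ⊔ f'.sub a ≤ f.sub i ⊔ f'.sub b := fun h =>
    sup_le_sup_left (f'.sub_mono h) _
  split_ifs with hab hJ hJ'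
  · rw [inf_eq_left.mpr ((hmono hab).trans le_sup_left), hdim]
  · rw [inf_eq_right.mpr (sup_le (hmono (by omega))
      (by rw [Submodule.span_singleton_le_iff_mem]; exact hJ)), finrank_inf_sup_span_singleton,
      hdim, ← sup_assoc, sup_eq_left.mpr (f.sub_mono (Nat.le_add_right i 1)), 
      if_pos (show w ∈ f.sub (i + 1) ⊔ f'.sub b ∧ w ∉ f.sub i ⊔ f'.sub b from hJ')]
  · rw [inf_eq_right.mpr (sup_le (hmono (by omega))
      (by rw [Submodule.span_singleton_le_iff_mem]; exact hJ)), finrank_inf_sup_span_singleton,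
      hdim, ← sup_assoc, sup_eq_left.mpr (f.sub_mono (Nat.le_add_right i 1)), 
      if_neg (show ¬(w ∈ f.sub (i + 1) ⊔ f'.sub b ∧ w ∉ f.sub i ⊔ f'.sub b) from hJ')]
  · have h2 : (f.sub i ⊔ f'.sub a) ⊓ ((f.sub i ⊔ f'.sub b) ⊔ Submodule.span F {w}) =
        f.sub i ⊔ f'.sub b := by
      symm
      refine Submodule.eq_of_le_of_finrank_eq (le_inf (hmono (by omega)) le_sup_left) ?_
      rw [finrank_inf_sup_span_singleton, if_neg, inf_eq_right.mpr (hmono (by omega)), add_zero]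
      rw [sup_eq_left.mpr (hmono (by omega))]
      exact fun h => hJ h.1
    rw [h2, hdim]

open Classical Polynomial in
/-- Summation over the flags in which the step `i` is one dimension larger. -/
theorem Poly.sum_below {i : ℕ} (hi : 0 < i) (hin : i < n) {N : TripleFun n d ℤ} (hN : Poly N) :
    Poly fun Q f f' w => ∑ g with Below i 1 f g, N Q g f' w := by
  obtain ⟨P, hP⟩ := hN
  refine of_mul (fun ι => X ^ ι.1 i n * (X - 1)) (fun ι => monic_X_pow_mul _)
    (fun ι => eval_X_pow_mul_ne_zero _) ?_
  -- The invariants after V_i is replaced by V_i + ⟨y⟩, where p and r record y ∈ V_i + V'_l and y ∈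
  -- V_i + V'_l + ⟨w⟩. Only row i changes; its second entry is the exchange property.
  let Φ : Inv → (ℕ → Prop) → (ℕ → Prop) → Inv := fun ι p r =>
    (fun k l => if k = i then ι.1 i l + (if p l then 1 else 0) else ι.1 k l,
      fun k l => if k = i then ι.2 i l ∨ (¬ p l ∧ r l) else ι.2 k l)
  have key := sum_of_chains (n := n) (d := d) (Y := fun Q => Fin d → Q.Fq) n
    (fun Q f f' w y => y ∈ f.sub (i + 1))
    (fun Q f f' w a y => y ∈ f.sub i ⊔ f'.sub a)
    (fun Q f f' w a y => y ∈ (f.sub i ⊔ f'.sub a) ⊔ Submodule.span Q.Fq {w})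
    (fun Q f f' w y a b h hy => sup_le_sup_left (f'.sub_mono h) _ hy)
    (fun Q f f' w y a b h hy => sup_le_sup_right (sup_le_sup_left (f'.sub_mono h) _) _ hy)
    (fun Q f f' w y _ => by simp [Flag.sub_of_le])
    (fun Q f f' w y _ => by simp [Flag.sub_of_le])
    (fun a _ b _ => (q_pow fun ι =>
      if a ≤ b then ι.1 i n + ι.1 (i + 1) a - ι.1 i a
      else if ι.2 i a then ι.1 i n + ι.1 (i + 1) b - ι.1 i b +
        (if ι.2 (i + 1) b ∧ ¬ ι.2 i b then 1 else 0)
      else ι.1 i n + ι.1 (i + 1) b - ι.1 i b).congr fun Q f f' w => ?_)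
    -- Since V'_0 = 0, the condition `p 0` says y ∈ V_i; such a y defines no larger step.
    (fun ι p r => if p 0 then 0 else P (Φ ι p r))
  · refine key.congr fun Q f f' w => ?_
    symm
    rw [inv_fst_top]
    simp only [eval_mul, eval_pow, eval_X, eval_sub, eval_one]
    rw [mul_sum_eq_sum_of_existsUnique (R := fun g y => y ∈ g.sub i)
      (B := fun y => y ∈ f.sub (i + 1) ∧ y ∉ f.sub i)
      (H := fun y => (P (Φ (inv f f' w) (fun a => y ∈ f.sub i ⊔ f'.sub a)
        (fun a => y ∈ (f.sub i ⊔ f'.sub a) ⊔ Submodule.span Q.Fq {w}))).eval (Q.q : ℤ))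
      (h1 := fun g hg => card_filter_mem_and_notMem Q f g hg)
      (h2 := fun y hy => Below.existsUnique_of_mem hi hin f hy.1 hy.2)]
    · rw [Finset.sum_filter, Finset.sum_filter]
      refine Finset.sum_congr rfl fun y _ => ?_
      simp only [Flag.sub_zero, sup_bot_eq]
      by_cases h2 : y ∈ f.sub i
      · simp only [h2, not_true_eq_false, and_false, if_false, if_true, eval_zero, ite_self]
      · simp only [h2, not_false_eq_true, and_true, if_false]
    · intro g y hg hy hgy
      rw [hP]
      congr 2
      have hgi : g.sub i = f.sub i ⊔ Submodule.span Q.Fq {y} := by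
        symm
        refine Submodule.eq_of_le_of_finrank_eq (sup_le hg.2.1 ?_) ?_
        · rwa [Submodule.span_singleton_le_iff_mem]
        · rw [Submodule.finrank_sup_span_singleton hy.2, hg.2.2]
      refine Prod.ext (funext₂ fun k l => ?_) (funext₂ fun k l => ?_)
      · by_cases hk : k = i
        · subst hk
          simp only [inv, Φ, if_true]
          rw [hgi, inf_comm, finrank_inf_sup_span_singleton, inf_comm, sup_comm]
          simp [hy.2]
        · simp only [inv, Φ, if_neg hk]
          rw [hg.1 k hk]
      · by_cases hk : k = i
        · subst hk
          simp only [inv, Φ, if_true]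
          rw [hgi, sup_right_comm, eq_iff_iff]
          exact mem_sup_span_singleton_exchange
        · simp [inv, Φ, hk, hg.1 k hk]
  · have h1 : (Finset.univ.filter fun y => y ∈ f.sub (i + 1) ∧ y ∈ f.sub i ⊔ f'.sub a ∧
        y ∈ (f.sub i ⊔ f'.sub b) ⊔ Submodule.span Q.Fq {w}) = Finset.univ.filter fun y => y ∈
          f.sub (i + 1) ⊓ ((f.sub i ⊔ f'.sub a) ⊓ ((f.sub i ⊔ f'.sub b) ⊔ Submodule.span Q.Fq {w})) := by
      ext y; simp only [Finset.mem_filter, Submodule.mem_inf]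
    rw [h1, Q.card_filter_mem, finrank_inf_chains]

end

/-! ### Sums over flags with a smaller step -/

section

open Submodule

/-- Write w = u + p. If ξ is nonzero on U ∩ P, then u can be corrected by an element of U ∩ P to lie
in ker ξ. If ξ vanishes there, the value of ξ at u is independent of the decomposition, and the
second alternative says that it is 0. -/
theorem mem_inf_ker_sup_iff {F V : Type} [Field F] [AddCommGroup V] [Module F V]
    (U P : Submodule F V) (ξ : Module.Dual F V) (w : V) :
    w ∈ (U ⊓ LinearMap.ker ξ) ⊔ P ↔ w ∈ U ⊔ P ∧
      (¬ U ⊓ P ≤ LinearMap.ker ξ ∨ U ⊓ (P ⊔ span F {w}) ≤ LinearMap.ker ξ) := by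
  constructor
  · intro h
    refine ⟨sup_le_sup_right inf_le_left P h, or_iff_not_imp_left.mpr fun hk => ?_⟩
    rw [not_not] at hk
    obtain ⟨u, hu, p, hp, rfl⟩ := mem_sup.mp h
    rintro x ⟨hxU, hx⟩
    obtain ⟨c, hc⟩ := mem_sup_span_singleton_iff.mp hx
    have h1 : x - c • u ∈ U ⊓ P := by
      refine ⟨sub_mem hxU (smul_mem _ _ hu.1), ?_⟩
      have := add_mem hc (smul_mem P c hp)
      rwa [smul_add, ← sub_sub, sub_add_cancel] at this
    have h2 : ξ (x - c • u) = 0 := hk h1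
    have h3 : ξ u = 0 := hu.2
    rwa [map_sub, map_smul, h3, smul_zero, sub_zero] at h2
  · rintro ⟨h, hk⟩
    obtain ⟨u, hu, p, hp, rfl⟩ := mem_sup.mp h
    rcases hk with hk | hk
    · obtain ⟨z, hz, hzξ⟩ := SetLike.not_le_iff_exists.mp hk
      have hzξ : ξ z ≠ 0 := hzξ
      refine mem_sup.mpr ⟨u - (ξ u / ξ z) • z, ⟨sub_mem hu (smul_mem _ _ hz.1), ?_⟩,
        p + (ξ u / ξ z) • z, add_mem hp (smul_mem _ _ hz.2), by abel⟩
      simp [hzξ]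
    · refine mem_sup.mpr ⟨u, ⟨hu, hk ⟨hu, ?_⟩⟩, p, hp, rfl⟩
      exact mem_sup_span_singleton_iff.mpr ⟨1, by simpa using neg_mem hp⟩

-- The linear forms satisfying both chain conditions are those that kill this sum, so its
-- codimension is the exponent of q in their number. The modular law combines the two terms when w ∈
-- V_i + V'_b.
open Classical in
theorem finrank_sup_chains {F : Type} [Field F] {n d : ℕ} (f f' : Flag F n d) (w : Fin d → F)
    (i a b : ℕ) : Module.finrank F ↥(f.sub (i - 1) ⊔
      ((f.sub i ⊓ f'.sub a) ⊔ (f.sub i ⊓ (f'.sub b ⊔ span F {w})))) =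
    let ι := inv f f' w
    let E := fun c => ι.1 (i - 1) n + (ι.1 i c + if ι.2 i c ∧ ¬ ι.2 0 c then 1 else 0) -
      (ι.1 (i - 1) c + if ι.2 (i - 1) c ∧ ¬ ι.2 0 c then 1 else 0)
    if a ≤ b then E b else if ι.2 i b then E a else ι.1 (i - 1) n + ι.1 i a - ι.1 (i - 1) a := by
  have hle := f.sub_mono (Nat.sub_le i 1)
  have h0 : ∀ X, Module.finrank F ↥(f.sub (i - 1) ⊔ (f.sub i ⊓ X)) =
      Module.finrank F (f.sub (i - 1)) + Module.finrank F ↥(f.sub i ⊓ X) -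
        Module.finrank F ↥(f.sub (i - 1) ⊓ X) := fun X => by
    have := finrank_sup_add_finrank_inf_eq (f.sub (i - 1)) (f.sub i ⊓ X)
    rw [← inf_assoc, inf_eq_left.mpr hle] at this
    omega
  have h1 : ∀ c, (inv f f' w).2 0 c ↔ w ∈ f'.sub c := fun c => by
    change w ∈ f.sub 0 ⊔ f'.sub c ↔ _
    rw [f.sub_zero, bot_sup_eq]
  have h2 : ∀ k c, Module.finrank F ↥(f.sub k ⊓ (f'.sub c ⊔ span F {w})) =
      (inv f f' w).1 k c + if (inv f f' w).2 k c ∧ ¬ (inv f f' w).2 0 c then 1 else 0 := by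
    intro k c
    rw [finrank_inf_sup_span_singleton, h1]
    rfl
  dsimp only
  by_cases hab : a ≤ b
  · rw [if_pos hab, sup_eq_right.mpr (inf_le_inf_left _ ((f'.sub_mono hab).trans le_sup_left)), h0, h2, h2,
      inv_fst_top]
  rw [if_neg hab]
  by_cases hJ : (inv f f' w).2 i b
  · have h3 : (f.sub i ⊓ f'.sub a) ⊔ (f.sub i ⊓ (f'.sub b ⊔ span F {w})) =
        f.sub i ⊓ (f'.sub a ⊔ span F {w}) := by
      refine le_antisymm (sup_le (inf_le_inf_left _ le_sup_left)
        (inf_le_inf_left _ (sup_le_sup_right (f'.sub_mono (by omega)) _))) ?_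
      rintro x ⟨hx, hx'⟩
      obtain ⟨u, hu, p, hp, hup⟩ := mem_sup.mp hJ
      obtain ⟨c, hc⟩ := mem_sup_span_singleton_iff.mp hx'
      refine mem_sup.mpr ⟨x - c • u, ⟨sub_mem hx (smul_mem _ _ hu), ?_⟩, c • u,
        smul_mem _ _ ⟨hu, ?_⟩, by abel⟩
      · have := add_mem hc (smul_mem _ c (f'.sub_mono (by omega : b ≤ a) hp))
        rwa [← hup, smul_add, ← sub_sub, sub_add_cancel] at this
      · refine mem_sup_span_singleton_iff.mpr ⟨1, ?_⟩
        rw [← hup]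
        simpa using neg_mem hp
    rw [if_pos hJ, h3, h0, h2, h2, inv_fst_top]
  · have h3 : f.sub i ⊓ (f'.sub b ⊔ span F {w}) = f.sub i ⊓ f'.sub b := by
      symm
      refine eq_of_le_of_finrank_eq (inf_le_inf_left _ le_sup_left) ?_
      rw [h2, if_neg fun h => hJ h.1, add_zero]
      rfl
    rw [if_neg hJ, h3, sup_eq_left.mpr (inf_le_inf_left _ (f'.sub_mono (by omega))), h0, inv_fst_top]
    rfl

end

section

variable {n d : ℕ}

open Classical Polynomial in
/-- Summation over the flags in which the step `i` is one dimension smaller. -/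
theorem Poly.sum_above {i : ℕ} (hi : 0 < i) (hin : i < n) {N : TripleFun n d ℤ} (hN : Poly N) :
    Poly fun Q f f' w => ∑ g with Below i 1 g f, N Q g f' w := by
  obtain ⟨P, hP⟩ := hN
  refine of_mul (fun ι => X ^ (d - ι.1 i n) * (X - 1)) (fun ι => monic_X_pow_mul _)
    (fun ι => eval_X_pow_mul_ne_zero _) ?_
  -- The invariants after V_i is replaced by V_i ∩ ker ξ. Vanishing of ξ on V_i ∩ V'_l gets weaker
  -- as l decreases, so the chains are indexed by n - l to be increasing.
  let Φ : Inv → (ℕ → Prop) → (ℕ → Prop) → Inv := fun ι p r =>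
    (fun k l => if k = i then ι.1 i l - (if p (n - l) then 0 else 1) else ι.1 k l,
      fun k l => if k = i then ι.2 i l ∧ (¬ p (n - l) ∨ r (n - l)) else ι.2 k l)
  have hsub : ∀ {F : Type} [Field F] (g : Flag F n d) l, g.sub (n - (n - l)) = g.sub l := by
    intro F _ g l
    rcases le_total l n with h | h
    · rw [Nat.sub_sub_self h]
    · rw [g.sub_of_le h, g.sub_of_le (by omega)]
  have key := sum_of_chains (n := n) (d := d) (Y := fun Q => Module.Dual Q.Fq (Fin d → Q.Fq))
    (n + 1) (fun Q f f' w ξ => f.sub (i - 1) ≤ LinearMap.ker ξ)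
    (fun Q f f' w a ξ => f.sub i ⊓ f'.sub (n - a) ≤ LinearMap.ker ξ)
    -- The form ξ need not vanish on V_i ∩ ⟨w⟩, which is the condition at a = n. The chain is
    -- therefore forced to hold at n + 1, and the bound is n + 1 instead of n.
    (fun Q f f' w a ξ => n < a ∨
      f.sub i ⊓ (f'.sub (n - a) ⊔ Submodule.span Q.Fq {w}) ≤ LinearMap.ker ξ)
    (fun Q f f' w ξ a b h hξ => (inf_le_inf_left _ (f'.sub_mono (by omega))).trans hξ)
    (fun Q f f' w ξ a b h hξ => hξ.imp (fun h' => h'.trans_le h) fun h' =>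
      (inf_le_inf_left _ (sup_le_sup_right (f'.sub_mono (by omega)) _)).trans h')
    (fun Q f f' w ξ _ => by
      rw [show n - (n + 1) = 0 by omega, f'.sub_zero, inf_bot_eq]; exact bot_le)
    (fun Q f f' w ξ _ => Or.inl (Nat.lt_succ_self n))
    (fun a _ b _ => (q_pow fun ι => d -
      let E := fun c => ι.1 (i - 1) n + (ι.1 i c + if ι.2 i c ∧ ¬ ι.2 0 c then 1 else 0) -
        (ι.1 (i - 1) c + if ι.2 (i - 1) c ∧ ¬ ι.2 0 c then 1 else 0)
      if n < b then ι.1 (i - 1) n + ι.1 i (n - a) - ι.1 (i - 1) (n - a) else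
      if n - a ≤ n - b then E (n - b) else if ι.2 i (n - b) then E (n - a) else
        ι.1 (i - 1) n + ι.1 i (n - a) - ι.1 (i - 1) (n - a)).congr fun Q f f' w => ?_)
    -- Here `p 0` says that ξ vanishes on V_i ∩ V'_n = V_i; such a form cuts out no smaller step.
    (fun ι p r => if p 0 then 0 else P (Φ ι p r))
  · refine key.congr fun Q f f' w => ?_
    symm
    rw [inv_fst_top]
    simp only [eval_mul, eval_pow, eval_X, eval_sub, eval_one]
    rw [mul_sum_eq_sum_of_existsUnique (R := fun g ξ => g.sub i ≤ LinearMap.ker ξ)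
      (B := fun ξ : Module.Dual Q.Fq (Fin d → Q.Fq) =>
        f.sub (i - 1) ≤ LinearMap.ker ξ ∧ ¬ f.sub i ≤ LinearMap.ker ξ)
      (H := fun ξ => (P (Φ (inv f f' w) (fun a => f.sub i ⊓ f'.sub (n - a) ≤ LinearMap.ker ξ)
        (fun a => n < a ∨ f.sub i ⊓ (f'.sub (n - a) ⊔ Submodule.span Q.Fq {w}) ≤
          LinearMap.ker ξ))).eval (Q.q : ℤ))
      (h1 := fun g hg => card_filter_le_ker_and_not Q f g hi hg)
      (h2 := fun y hy => Below.existsUnique_of_ker hi hin f hy.1 hy.2)]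
    · rw [Finset.sum_filter, Finset.sum_filter]
      refine Finset.sum_congr rfl fun ξ _ => ?_
      have h3 : (f.sub i ⊓ f'.sub (n - 0) ≤ LinearMap.ker ξ) = (f.sub i ≤ LinearMap.ker ξ) := by
        rw [f'.sub_of_le (by omega), inf_top_eq]
      by_cases h2 : f.sub i ≤ LinearMap.ker ξ
      · simp only [h3, h2, not_true_eq_false, and_false, if_false, if_true, eval_zero, ite_self]
      · simp only [h3, h2, not_false_eq_true, and_true, if_false]
    · intro g ξ hg hξ hgξ
      rw [hP]
      congr 2
      have hfr := finrank_inf_ker (f.sub i) ξ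
      rw [if_neg hξ.2] at hfr
      have hgi : g.sub i = f.sub i ⊓ LinearMap.ker ξ :=
        Submodule.eq_of_le_of_finrank_eq (le_inf hg.2.1 hgξ) (by have := hg.2.2; omega)
      refine Prod.ext (funext₂ fun k l => ?_) (funext₂ fun k l => ?_)
      · by_cases hk : k = i
        · subst hk
          simp only [inv, Φ, if_true]
          have h4 : (f.sub k ⊓ f'.sub (n - (n - l)) ≤ LinearMap.ker ξ) =
              (f.sub k ⊓ f'.sub l ≤ LinearMap.ker ξ) := by rw [hsub]
          have h5 := finrank_inf_ker (f.sub k ⊓ f'.sub l) ξ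
          rw [hgi, inf_right_comm]
          simp only [h4]
          split_ifs at h5 ⊢ <;> omega
        · simp only [inv, Φ, if_neg hk]
          rw [hg.1 k hk]
      · by_cases hk : k = i
        · subst hk
          simp only [inv, Φ, if_true]
          rw [hgi, hsub, eq_iff_iff, mem_inf_ker_sup_iff]
          have : ¬ n < n - l := by omega
          simp only [this, false_or]
        · simp only [inv, Φ, if_neg hk]
          rw [hg.1 k hk]
  · dsimp only
    by_cases hb : n < b
    · have h0 := Submodule.finrank_sup_add_finrank_inf_eq (f.sub (i - 1))
        (f.sub i ⊓ f'.sub (n - a))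
      rw [← inf_assoc, inf_eq_left.mpr (f.sub_mono (Nat.sub_le i 1))] at h0
      have h1 : (inv f f' w).1 (i - 1) n + (inv f f' w).1 i (n - a) -
          (inv f f' w).1 (i - 1) (n - a) = Module.finrank Q.Fq
            ↥(f.sub (i - 1) ⊔ f.sub i ⊓ f'.sub (n - a)) := by
        rw [inv_fst_top]; simp only [inv]; omega
      rw [if_pos hb, h1, ← card_filter_le_ker]
      congr 3
      ext ξ
      simp only [sup_le_iff, hb, true_or, and_true]
    · have h1 := finrank_sup_chains f f' w i (n - a) (n - b)
      dsimp only at h1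
      rw [if_neg hb, ← h1, ← card_filter_le_ker]
      congr 3
      ext ξ
      simp only [sup_le_iff, hb, false_or]

open Classical Polynomial in
/-- Summation over the translates of the vector by the first step. -/
theorem Poly.sum_translates {N : TripleFun n d ℤ} (hN : Poly N) :
    Poly fun Q f f' w => ∑ m with m ∈ f.sub 1, N Q f f' (w - m) := by
  obtain ⟨P, hP⟩ := hN
  -- Translation by m ∈ V_1 affects the condition w ∈ V_k + V'_l only for k = 0. One chain is enough
  -- here, and the second one is trivial.
  let Φ : Inv → (ℕ → Prop) → Inv := fun ι p =>
    (ι.1, fun k l => if k = 0 then p l else ι.2 k l)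
  have key := sum_of_chains (n := n) (d := d) (Y := fun Q => Fin d → Q.Fq) n
    (fun Q f f' w m => m ∈ f.sub 1)
    (fun Q f f' w a m => w - m ∈ f'.sub a)
    (fun Q f f' w a m => True)
    (fun Q f f' w y a b h hy => f'.sub_mono h hy)
    (fun Q f f' w y a b h hy => trivial)
    (fun Q f f' w y _ => by simp [Flag.sub_of_le])
    (fun Q f f' w y _ => trivial)
    (fun a _ b _ => (of_inv fun ι => if ι.2 1 a then X ^ ι.1 1 a else 0).congr fun Q f f' w => ?_)
    (fun ι p r => P (Φ ι p))
  · refine key.congr fun Q f f' w => Finset.sum_congr rfl fun m hm => ?_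
    have hm := (Finset.mem_filter.mp hm).2
    rw [hP]
    congr 2
    refine Prod.ext rfl (funext₂ fun k l => ?_)
    by_cases hk : k = 0
    · subst hk
      simp only [inv, Φ, if_true]
      rw [f.sub_zero, bot_sup_eq]
    · simp only [inv, Φ, if_neg hk, eq_iff_iff]
      exact (Submodule.sub_mem_iff_left _
        (Submodule.mem_sup_left (f.sub_mono (by omega : 1 ≤ k) hm))).symm
  · simp only [and_true]
    by_cases h : (inv f f' w).2 1 a
    · obtain ⟨u, hu, p, hp, hup⟩ := Submodule.mem_sup.mp h
      rw [if_pos h, eval_pow, eval_X]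
      change (Q.q : ℤ) ^ Module.finrank Q.Fq ↥(f.sub 1 ⊓ f'.sub a) = _
      rw [← Q.card_filter_mem]
      norm_cast
      refine Finset.card_equiv (Equiv.subLeft u) fun m => ?_
      simp only [Finset.mem_filter, Finset.mem_univ, true_and, Submodule.mem_inf,
        Equiv.subLeft_apply]
      rw [Submodule.sub_mem_iff_right _ hu, ← hup, show u + p - (u - m) = m + p by abel, add_mem_cancel_right hp]
    · rw [if_neg h, eval_zero, eq_comm, Nat.cast_eq_zero, Finset.card_eq_zero,
        Finset.filter_eq_empty_iff]
      rintro m - ⟨h1, h2⟩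
      exact h (Submodule.mem_sup.mpr ⟨m, h1, w - m, h2, by abel⟩)

/-! ### Changing a step by several dimensions -/

theorem Below.zero_iff {F : Type} [Field F] {i : ℕ} {f g : Flag F n d} :
    Below i 0 f g ↔ f = g := by
  refine ⟨fun h => Flag.ext_sub fun k => ?_, ?_⟩
  · by_cases hk : k = i
    · subst hk
      exact Submodule.eq_of_le_of_finrank_eq h.2.1 (by rw [h.2.2, add_zero])
    · exact h.1 k hk
  · rintro rfl
    exact ⟨fun _ _ => rfl, le_rfl, rfl⟩

theorem Below.trans {F : Type} [Field F] {i R S : ℕ} {f g h : Flag F n d} (h1 : Below i R f g)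
    (h2 : Below i S g h) : Below i (R + S) f h :=
  ⟨fun k hk => (h1.1 k hk).trans (h2.1 k hk), h1.2.1.trans h2.2.1, by
    rw [h2.2.2, h1.2.2, add_assoc]⟩

open Classical in
theorem PrimePower.card_filter_mem_and_notMem_of_le (Q : PrimePower)
    {U W : Submodule Q.Fq (Fin d → Q.Fq)} (hW : U ≤ W) :
    ((Finset.univ.filter fun y => y ∈ W ∧ y ∉ U).card : ℤ) =
      (Q.q : ℤ) ^ Module.finrank Q.Fq W - (Q.q : ℤ) ^ Module.finrank Q.Fq U := by
  have h2 : (Finset.univ.filter fun y => y ∈ U) ⊆ Finset.univ.filter fun y => y ∈ W :=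
    fun y hy => by simp only [Finset.mem_filter, Finset.mem_univ, true_and] at hy ⊢; exact hW hy
  rw [Finset.filter_and_not, Finset.card_sdiff_of_subset h2,
    Nat.cast_sub (Finset.card_le_card h2), Q.card_filter_mem, Q.card_filter_mem]

open Classical in
/-- The number of flags in which the step `i` is one dimension larger. -/
theorem card_below (Q : PrimePower) {i : ℕ} (hi : 0 < i) (hin : i < n) (f : Flag Q.Fq n d) :
    (Q.q : ℤ) ^ Module.finrank Q.Fq (f.sub i) * (Q.q - 1) *
        (Finset.univ.filter fun g => Below i 1 f g).card =
      (Q.q : ℤ) ^ Module.finrank Q.Fq (f.sub (i + 1)) -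
        (Q.q : ℤ) ^ Module.finrank Q.Fq (f.sub i) := by
  have key := mul_sum_eq_sum_of_existsUnique (fun (g : Flag Q.Fq n d) y => y ∈ g.sub i)
    (fun g => Below i 1 f g) (fun y => y ∈ f.sub (i + 1) ∧ y ∉ f.sub i)
    ((Q.q : ℤ) ^ Module.finrank Q.Fq (f.sub i) * (Q.q - 1)) (fun _ => 1) (fun _ => 1)
    (fun g hg => card_filter_mem_and_notMem Q f g hg)
    (fun y hy => Below.existsUnique_of_mem hi hin f hy.1 hy.2) (fun _ _ _ _ _ => rfl)
  rw [← Q.card_filter_mem_and_notMem_of_le (f.sub_mono (Nat.le_add_right i 1))]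
  simpa using key

open Classical in
/-- The number of lines in a space of dimension `R + 1`. -/
theorem card_below_below (Q : PrimePower) {i R : ℕ} (hi : 0 < i) (hin : i < n)
    {f h : Flag Q.Fq n d} (hfh : Below i (R + 1) f h) :
    ((Finset.univ.filter fun g => Below i 1 f g ∧ Below i R g h).card : ℤ) =
      ∑ k ∈ Finset.range (R + 1), (Q.q : ℤ) ^ k := by
  have hle : h.sub i ≤ f.sub (i + 1) := by
    rw [hfh.1 (i + 1) (by omega)]; exact h.sub_mono (Nat.le_add_right i 1)
  have hdiff := fun W hW => Q.card_filter_mem_and_notMem_of_le (U := f.sub i) (W := W) hW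
  have key := mul_sum_eq_sum_of_existsUnique (fun (g : Flag Q.Fq n d) y => y ∈ g.sub i)
    (fun g => Below i 1 f g ∧ Below i R g h) (fun y => y ∈ h.sub i ∧ y ∉ f.sub i)
    ((Q.q : ℤ) ^ Module.finrank Q.Fq (f.sub i) * (Q.q - 1)) (fun _ => 1) (fun _ => 1)
    (fun g hg => ?_) (fun y hy => ?_) (fun _ _ _ _ _ => rfl)
  · rw [Finset.sum_const, Finset.sum_const, nsmul_one, nsmul_one, hdiff _ hfh.2.1, hfh.2.2] at key
    have hq := Q.one_lt_q
    have h1 : ((Q.q : ℤ) ^ Module.finrank Q.Fq (f.sub i) * (Q.q - 1)) ≠ 0 :=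
      mul_ne_zero (pow_ne_zero _ (by omega)) (by omega)
    refine mul_left_cancel₀ h1 (key.trans ?_)
    rw [mul_assoc, mul_comm ((Q.q : ℤ) - 1), geom_sum_mul]
    ring
  · have h1 : (Finset.univ.filter fun y => (y ∈ h.sub i ∧ y ∉ f.sub i) ∧ y ∈ g.sub i) =
        Finset.univ.filter fun y => y ∈ g.sub i ∧ y ∉ f.sub i := by
      ext y
      have := @hg.2.2.1 y
      simp only [Finset.mem_filter, Finset.mem_univ, true_and]
      tauto
    rw [h1, hdiff _ hg.1.2.1, hg.1.2.2]
    ring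
  · obtain ⟨g, ⟨hg, hyg⟩, huniq⟩ := Below.existsUnique_of_mem hi hin f (hle hy.1) hy.2
    refine ⟨g, ⟨⟨hg, fun k hk => (hg.1 k hk).symm.trans (hfh.1 k hk), ?_, ?_⟩, hyg⟩,
      fun g' hg' => huniq g' ⟨hg'.1.1, hg'.2⟩⟩
    · have : g.sub i = f.sub i ⊔ Submodule.span Q.Fq {y} := by
        symm
        refine Submodule.eq_of_le_of_finrank_eq (sup_le hg.2.1 ?_) ?_
        · rwa [Submodule.span_singleton_le_iff_mem]
        · rw [Submodule.finrank_sup_span_singleton hy.2, hg.2.2]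
      rw [this]
      exact sup_le hfh.2.1 (by rw [Submodule.span_singleton_le_iff_mem]; exact hy.1)
    · rw [hfh.2.2, hg.2.2]; ring

-- Each flag whose step i is R + 1 dimensions larger is reached through 1 + q + ... + q^R
-- intermediate flags, one for each line in the quotient of the two steps.
open Classical in
theorem sum_below_below (Q : PrimePower) {i R : ℕ} (hi : 0 < i) (hin : i < n)
    (f : Flag Q.Fq n d) (G : Flag Q.Fq n d → ℤ) :
    ∑ g with Below i 1 f g, ∑ h with Below i R g h, G h =
      (∑ k ∈ Finset.range (R + 1), (Q.q : ℤ) ^ k) * ∑ h with Below i (R + 1) f h, G h := by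
  rw [Finset.mul_sum, Finset.sum_comm' (t' := Finset.univ.filter fun h => Below i (R + 1) f h)
    (s' := fun h => Finset.univ.filter fun g => Below i 1 f g ∧ Below i R g h)]
  · refine Finset.sum_congr rfl fun h hh => ?_
    rw [Finset.sum_const, nsmul_eq_mul, card_below_below Q hi hin (Finset.mem_filter.mp hh).2]
  · intro g h
    simp only [Finset.mem_filter, Finset.mem_univ, true_and]
    exact ⟨fun h' => ⟨h', by rw [add_comm]; exact h'.1.trans h'.2⟩, fun h' => h'.1⟩

open Classical in
theorem sum_above_above (Q : PrimePower) {i R : ℕ} (hi : 0 < i) (hin : i < n)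
    (f : Flag Q.Fq n d) (G : Flag Q.Fq n d → ℤ) :
    ∑ g with Below i R g f, ∑ h with Below i 1 h g, G h =
      (∑ k ∈ Finset.range (R + 1), (Q.q : ℤ) ^ k) * ∑ h with Below i (R + 1) h f, G h := by
  rw [Finset.mul_sum, Finset.sum_comm' (t' := Finset.univ.filter fun h => Below i (R + 1) h f)
    (s' := fun h => Finset.univ.filter fun g => Below i 1 h g ∧ Below i R g f)]
  · refine Finset.sum_congr rfl fun h hh => ?_
    rw [Finset.sum_const, nsmul_eq_mul, card_below_below Q hi hin (Finset.mem_filter.mp hh).2]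
  · intro g h
    simp only [Finset.mem_filter, Finset.mem_univ, true_and]
    exact ⟨fun h' => ⟨⟨h'.2, h'.1⟩, by rw [add_comm]; exact h'.2.trans h'.1⟩, fun h' => h'.1.symm⟩

open Polynomial in
theorem Poly.of_mul_geom_sum (R : ℕ) {N : TripleFun n d ℤ}
    (h : Poly fun Q f f' w => (∑ k ∈ Finset.range (R + 1), (Q.q : ℤ) ^ k) * N Q f f' w) :
    Poly N := by
  refine of_mul (fun _ => ∑ k ∈ Finset.range (R + 1), X ^ k)
    (fun _ => monic_geom_sum_X (Nat.succ_ne_zero R)) (fun _ Q => ?_) (h.congr fun Q f f' w => ?_)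
  · rw [eval_finsetSum]
    have := Q.one_lt_q
    simp only [eval_pow, eval_X]
    have h1 : 0 < ∑ k ∈ Finset.range (R + 1), (Q.q : ℤ) ^ k :=
      Finset.sum_pos (fun k _ => by positivity) ⟨0, by simp⟩
    exact h1.ne'
  · simp [eval_finsetSum]

open Classical in
theorem Poly.sum_below_of_mult {i : ℕ} (hi : 0 < i) (hin : i < n) (R : ℕ) {N : TripleFun n d ℤ}
    (hN : Poly N) : Poly fun Q f f' w => ∑ g with Below i R f g, N Q g f' w := by
  induction R with
  | zero =>
    refine hN.congr fun Q f f' w => ?_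
    simp only [Below.zero_iff]
    rw [Finset.sum_eq_single_of_mem f (by simp)
      fun b hb hne => absurd (Finset.mem_filter.mp hb).2.symm hne]
  | succ R ih =>
    exact Poly.of_mul_geom_sum R ((Poly.sum_below hi hin ih).congr fun Q f f' w =>
      sum_below_below Q hi hin f _)

open Classical in
theorem Poly.sum_above_of_mult {i : ℕ} (hi : 0 < i) (hin : i < n) (R : ℕ) {N : TripleFun n d ℤ}
    (hN : Poly N) : Poly fun Q f f' w => ∑ g with Below i R g f, N Q g f' w := by
  induction R generalizing N with
  | zero =>
    refine hN.congr fun Q f f' w => ?_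
    simp only [Below.zero_iff]
    rw [Finset.sum_eq_single_of_mem f (by simp)
      fun b hb hne => absurd (Finset.mem_filter.mp hb).2 hne]
  | succ R ih =>
    exact Poly.of_mul_geom_sum R ((ih (Poly.sum_above hi hin hN)).congr fun Q f f' w =>
      sum_above_above Q hi hin f _)

end

section

variable {n d : ℕ}

/-! ### Some families of functions -/

@[ext] theorem fam_ext {g h : Families n d} (H : ∀ Q f f' w, g Q f f' w = h Q f f' w) : g = h :=
  funext fun Q => ConvAlg.ext (H Q)

theorem fam_mul_apply (g h : Families n d) (Q : PrimePower) (f f' : Flag Q.Fq n d)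
    (w : Fin d → Q.Fq) :
    (g * h) Q f f' w = ∑ f'', ∑ m, g Q f f'' m * h Q f'' f' (w - m) := rfl

theorem fam_add_apply (g h : Families n d) (Q : PrimePower) (f f' : Flag Q.Fq n d)
    (w : Fin d → Q.Fq) : (g + h) Q f f' w = g Q f f' w + h Q f f' w := rfl

theorem fam_sub_apply (g h : Families n d) (Q : PrimePower) (f f' : Flag Q.Fq n d)
    (w : Fin d → Q.Fq) : (g - h) Q f f' w = g Q f f' w - h Q f f' w := rfl

theorem fam_zero_apply (Q : PrimePower) (f f' : Flag Q.Fq n d)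
    (w : Fin d → Q.Fq) : (0 : Families n d) Q f f' w = 0 := rfl

theorem fam_smul_apply (a : 𝒜) (g : Families n d) (Q : PrimePower) (f f' : Flag Q.Fq n d)
    (w : Fin d → Q.Fq) : (a • g) Q f f' w = Q.spec a * g Q f f' w := rfl

theorem fam_sum_apply {ι : Type*} (s : Finset ι) (g : ι → Families n d) (Q : PrimePower)
    (f f' : Flag Q.Fq n d) (w : Fin d → Q.Fq) :
    (∑ i ∈ s, g i) Q f f' w = ∑ i ∈ s, g i Q f f' w := by
  classical
  induction s using Finset.induction_on with
  | empty => rfl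
  | insert a s ha ih => rw [Finset.sum_insert ha, Finset.sum_insert ha, fam_add_apply, ih]

open Classical in
theorem fam_one_apply (Q : PrimePower) (f f' : Flag Q.Fq n d) (w : Fin d → Q.Fq) :
    (1 : Families n d) Q f f' w = if f = f' ∧ w = 0 then 1 else 0 :=
  (ConvAlg.one_apply f f' w).trans (by congr)

open Classical in
theorem charFamily_apply (x : DecMat n d) (Q : PrimePower) (f f' : Flag Q.Fq n d)
    (w : Fin d → Q.Fq) : charFamily x Q f f' w = if inv f f' w = x.inv then 1 else 0 := by
  simp only [charFamily, inOrbit_iff]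

open Classical in
/-- The characteristic function of a relation between flags, with zero vector. -/
def relFam (r : ∀ Q : PrimePower, Flag Q.Fq n d → Flag Q.Fq n d → Prop) : Families n d :=
  fun Q f f' w => if r Q f f' ∧ w = 0 then 1 else 0

open Classical in
/-- The characteristic function of the triples `(f, f, w)` with `w ∈ V_m`. -/
def vecFam (n d m : ℕ) : Families n d :=
  fun _ f f' w => if f = f' ∧ w ∈ f.sub m then 1 else 0

/-- The step `i` decreases by `R` dimensions. -/
def upper (n d i R : ℕ) : Families n d := relFam fun _ f f' => Below i R f' f

/-- The step `i` increases by `R` dimensions. -/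
def lower (n d i R : ℕ) : Families n d := relFam fun _ f f' => Below i R f f'

/-- The dimensions of the steps of a flag. -/
def dims {F : Type} [Field F] (f : Flag F n d) (k : ℕ) : ℕ := Module.finrank F (f.sub k)

/-- The idempotent of the flags with given dimensions of the steps. -/
def dimFam (n d : ℕ) (ν : ℕ → ℕ) : Families n d := relFam fun _ f f' => f = f' ∧ dims f = ν

open Classical in
theorem relFam_mul_apply (r : ∀ Q : PrimePower, Flag Q.Fq n d → Flag Q.Fq n d → Prop)
    (g : Families n d) (Q : PrimePower) (f f' : Flag Q.Fq n d) (w : Fin d → Q.Fq) :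
    (relFam r * g) Q f f' w = ∑ f'' with r Q f f'', g Q f'' f' w := by
  rw [fam_mul_apply, Finset.sum_filter]
  refine Finset.sum_congr rfl fun f'' _ => ?_
  rw [Finset.sum_eq_single 0]
  · simp only [relFam, and_true, sub_zero, ite_mul, one_mul, zero_mul]
  · intro m _ hm
    simp [relFam, hm]
  · simp

open Classical in
theorem mul_relFam_apply (r : ∀ Q : PrimePower, Flag Q.Fq n d → Flag Q.Fq n d → Prop)
    (g : Families n d) (Q : PrimePower) (f f' : Flag Q.Fq n d) (w : Fin d → Q.Fq) :
    (g * relFam r) Q f f' w = ∑ f'' with r Q f'' f', g Q f f'' w := by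
  rw [fam_mul_apply, Finset.sum_filter]
  refine Finset.sum_congr rfl fun f'' _ => ?_
  rw [Finset.sum_eq_single w]
  · simp only [relFam, sub_self, and_true, mul_ite, mul_one, mul_zero]
  · intro m _ hm
    simp [relFam, sub_eq_zero, Ne.symm hm]
  · simp

open Classical in
theorem vecFam_mul_apply (m : ℕ) (g : Families n d) (Q : PrimePower) (f f' : Flag Q.Fq n d)
    (w : Fin d → Q.Fq) :
    (vecFam n d m * g) Q f f' w = ∑ u with u ∈ f.sub m, g Q f f' (w - u) := by
  rw [fam_mul_apply, Finset.sum_eq_single f]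
  · rw [Finset.sum_filter]
    refine Finset.sum_congr rfl fun u _ => ?_
    simp only [vecFam, true_and, ite_mul, one_mul, zero_mul]
  · intro f'' _ h
    simp [vecFam, Ne.symm h]
  · simp

open Classical in
theorem dimFam_mul_apply (ν : ℕ → ℕ) (g : Families n d) (Q : PrimePower) (f f' : Flag Q.Fq n d)
    (w : Fin d → Q.Fq) :
    (dimFam n d ν * g) Q f f' w = if dims f = ν then g Q f f' w else 0 := by
  rw [dimFam, relFam_mul_apply, Finset.sum_filter, Finset.sum_eq_single f]
  · simp
  · intro f'' _ h
    simp [Ne.symm h]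
  · simp

/-! ### The span of the characteristic functions of the orbits -/

/-- The `𝒜`-span of the characteristic functions of the orbits. -/
def spanFam (n d : ℕ) : Submodule 𝒜 (Families n d) :=
  Submodule.span 𝒜 (Set.range (charFamily (n := n) (d := d)))

theorem sum_smul_charFamily_apply (P : Inv → 𝒜) (Q : PrimePower) (f f' : Flag Q.Fq n d)
    (w : Fin d → Q.Fq) (s : Finset (DecMat n d)) [Decidable (∃ x ∈ s, inv f f' w = x.inv)] :
    (∑ x ∈ s, P x.inv • charFamily x) Q f f' w =
      if ∃ x ∈ s, inv f f' w = x.inv then Q.spec (P (inv f f' w)) else 0 := by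
  classical
  rw [fam_sum_apply]
  simp only [fam_smul_apply, charFamily_apply, mul_ite, mul_one, mul_zero]
  split_ifs with h
  · obtain ⟨x, hx, hxe⟩ := h
    rw [Finset.sum_eq_single_of_mem x hx, if_pos hxe, hxe]
    intro y _ hy
    exact if_neg fun h => hy (DecMat.inv_injective (h.symm.trans hxe))
  · exact Finset.sum_eq_zero fun x hx => if_neg fun h' => h ⟨x, hx, h'⟩

theorem exists_inv_eq (Q : PrimePower) (f f' : Flag Q.Fq n d) (w : Fin d → Q.Fq) :
    ∃ x : DecMat n d, inv f f' w = x.inv := by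
  obtain ⟨x, hx⟩ := exists_inOrbit f f' w
  exact ⟨x, inOrbit_iff.mp hx⟩

/-- The converse holds because there are finitely many orbits and each triple lies in exactly one:
the coefficients are the given Laurent polynomials. -/
theorem mem_spanFam_iff {g : Families n d} :
    g ∈ spanFam n d ↔ ∃ P : Inv → 𝒜, ∀ Q f f' w, g Q f f' w = Q.spec (P (inv f f' w)) := by
  classical
  constructor
  · intro hg
    refine Submodule.span_induction ?_ ?_ ?_ ?_ hg
    · rintro _ ⟨x, rfl⟩
      refine ⟨fun ι => if ι = x.inv then 1 else 0, fun Q f f' w => ?_⟩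
      rw [charFamily_apply]
      by_cases h : inv f f' w = x.inv <;> simp [h]
    · exact ⟨0, fun Q f f' w => by rw [fam_zero_apply]; exact (map_zero _).symm⟩
    · rintro g h - - ⟨P, hP⟩ ⟨R, hR⟩
      exact ⟨P + R, fun Q f f' w => by rw [fam_add_apply, hP, hR, Pi.add_apply, map_add]⟩
    · rintro a g - ⟨P, hP⟩
      exact ⟨fun ι => a * P ι, fun Q f f' w => by rw [fam_smul_apply, hP, map_mul]⟩
  · rintro ⟨P, hP⟩
    have : g = ∑ x : DecMat n d, P x.inv • charFamily x := by
      ext Q f f' w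
      obtain ⟨x, hx⟩ := exists_inv_eq Q f f' w
      rw [sum_smul_charFamily_apply, if_pos ⟨x, Finset.mem_univ x, hx⟩, hP]
    rw [this]
    exact sum_mem fun x _ => Submodule.smul_mem _ _ (Submodule.subset_span ⟨x, rfl⟩)

theorem spec_vpow (Q : PrimePower) (k : ℤ) : Q.spec (vpow k) = Real.sqrt Q.q ^ k := by
  rw [PrimePower.spec, LaurentPolynomial.eval₂_T, Units.val_zpow_eq_zpow_val, Units.val_mk0]

theorem spec_vpow_two_mul (Q : PrimePower) (k : ℤ) : Q.spec (vpow (2 * k)) = (Q.q : ℝ) ^ k := by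
  rw [spec_vpow, zpow_mul, zpow_ofNat, Real.sq_sqrt (Nat.cast_nonneg _)]

theorem spec_aeval (Q : PrimePower) (P : Polynomial ℤ) :
    Q.spec (Polynomial.aeval (vpow 2) P) = ((P.eval (Q.q : ℤ) : ℤ) : ℝ) := by
  have h : Q.spec (vpow 2) = ((Q.q : ℕ) : ℝ) := by simpa using spec_vpow_two_mul Q 1
  rw [Polynomial.aeval_def, Polynomial.hom_eval₂, h,
    RingHom.ext_int (Q.spec.comp (algebraMap ℤ 𝒜)) (Int.castRingHom ℝ),
    Polynomial.eval₂_at_natCast]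
  simp

theorem Poly.mem_spanFam {N : TripleFun n d ℤ} (hN : Poly N) {g : Families n d}
    (hg : ∀ Q f f' w, g Q f f' w = N Q f f' w) : g ∈ spanFam n d := by
  obtain ⟨P, hP⟩ := hN
  exact mem_spanFam_iff.mpr ⟨fun ι => Polynomial.aeval (vpow 2) (P ι), fun Q f f' w => by
    rw [spec_aeval, hg, hP]⟩

theorem Poly.ite (C : Inv → Prop) [DecidablePred C] {N : TripleFun n d ℤ} (hN : Poly N) :
    Poly fun Q f f' w => if C (inv f f' w) then N Q f f' w else 0 := by
  obtain ⟨P, hP⟩ := hN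
  exact (of_inv fun ι => if C ι then P ι else 0).congr fun Q f f' w => by
    split_ifs <;> simp [hP]

theorem Poly.orbit (x : DecMat n d) [DecidablePred fun ι : Inv => ι = x.inv] :
    Poly (n := n) (d := d) fun Q f f' w => if inv f f' w = x.inv then 1 else 0 :=
  Poly.ite (fun ι => ι = x.inv) (N := fun _ _ _ _ => 1) ((of_inv fun _ => 1).congr fun _ _ _ _ => by simp)

theorem charFamily_eq_cast (x : DecMat n d) (Q : PrimePower) (f f' : Flag Q.Fq n d)
    (w : Fin d → Q.Fq) [Decidable (inv f f' w = x.inv)] : charFamily x Q f f' w =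
      ((if inv f f' w = x.inv then 1 else 0 : ℤ) : ℝ) := by
  rw [charFamily_apply]
  split_ifs <;> simp

/-- Equality of flags is visible in the invariants; this places the unit in the span of the orbits.
-/
theorem flag_eq_iff {F : Type} [Field F] (f f' : Flag F n d) (w : Fin d → F) : f = f' ↔
    ∀ k, (inv f f' w).1 k k = (inv f f' w).1 k n ∧ (inv f f' w).1 k k = (inv f f' w).1 n k := by
  have h1 : ∀ k, (inv f f' w).1 k n = Module.finrank F (f.sub k) := inv_fst_top f f' w
  have h2 : ∀ k, (inv f f' w).1 n k = Module.finrank F (f'.sub k) := fun k => by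
    change Module.finrank F ↥(f.sub n ⊓ f'.sub k) = _
    rw [f.sub_of_le le_rfl, top_inf_eq]
  simp only [h1, h2]
  constructor
  · rintro rfl k
    change Module.finrank F ↥(f.sub k ⊓ f.sub k) = _ ∧ Module.finrank F ↥(f.sub k ⊓ f.sub k) = _
    rw [inf_idem]
    exact ⟨rfl, rfl⟩
  · intro h
    refine Flag.ext_sub fun k => ?_
    have h3 := Submodule.eq_of_le_of_finrank_eq (inf_le_left : f.sub k ⊓ f'.sub k ≤ _) (h k).1
    have h4 := Submodule.eq_of_le_of_finrank_eq (inf_le_right : f.sub k ⊓ f'.sub k ≤ _) (h k).2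
    exact h3.symm.trans h4

open Classical in
theorem one_mem_spanFam : (1 : Families n d) ∈ spanFam n d := by
  refine Poly.mem_spanFam (Poly.ite (fun ι => (∀ k, ι.1 k k = ι.1 k n ∧ ι.1 k k = ι.1 n k) ∧
    ι.2 0 0) (N := fun _ _ _ _ => 1) ((Poly.of_inv fun _ => 1).congr fun _ _ _ _ => by simp))
    fun Q f f' w => ?_
  rw [fam_one_apply]
  have : (inv f f' w).2 0 0 ↔ w = 0 := by simp [inv, Flag.sub_zero]
  simp only [← flag_eq_iff, this]
  split_ifs <;> simp

/-- The elements whose left multiplication preserves the span of the orbits. -/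
def stabFam (n d : ℕ) : Subalgebra 𝒜 (Families n d) where
  carrier := {g | ∀ h ∈ spanFam n d, g * h ∈ spanFam n d}
  mul_mem' := fun {a b} ha hb h hh => by rw [mul_assoc]; exact ha _ (hb _ hh)
  add_mem' := fun {a b} ha hb h hh => by rw [add_mul]; exact add_mem (ha _ hh) (hb _ hh)
  algebraMap_mem' := fun a h hh => by
    rw [← Algebra.smul_def]; exact Submodule.smul_mem _ _ hh

theorem mem_stabFam_of_charFamily {g : Families n d}
    (hg : ∀ x, g * charFamily x ∈ spanFam n d) : g ∈ stabFam n d := by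
  intro h hh
  refine Submodule.span_induction ?_ ?_ ?_ ?_ hh
  · rintro _ ⟨x, rfl⟩
    exact hg x
  · rw [mul_zero]; exact zero_mem _
  · intro a b _ _ ha hb
    rw [mul_add]; exact add_mem ha hb
  · intro a b _ hb
    rw [mul_smul_comm]; exact Submodule.smul_mem _ _ hb

/-- Apply an element of S to the unit, which lies in the span. So only left multiplication by
generators has to be controlled, not products of arbitrary orbits. -/
theorem le_spanFam_of_le_stabFam {S : Subalgebra 𝒜 (Families n d)} (hS : S ≤ stabFam n d) :
    ∀ g ∈ S, g ∈ spanFam n d := fun g hg => by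
  have := hS hg 1 one_mem_spanFam
  rwa [mul_one] at this

theorem upper_mem_stabFam {i : ℕ} (hi : 0 < i) (hin : i < n) (R : ℕ) :
    upper n d i R ∈ stabFam n d := by
  classical
  refine mem_stabFam_of_charFamily fun x => ?_
  refine (Poly.sum_above_of_mult hi hin R (Poly.orbit x)).mem_spanFam fun Q f f' w => ?_
  rw [upper, relFam_mul_apply, Int.cast_sum]
  exact Finset.sum_congr rfl fun g _ => charFamily_eq_cast x Q g f' w

theorem lower_mem_stabFam {i : ℕ} (hi : 0 < i) (hin : i < n) (R : ℕ) :
    lower n d i R ∈ stabFam n d := by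
  classical
  refine mem_stabFam_of_charFamily fun x => ?_
  refine (Poly.sum_below_of_mult hi hin R (Poly.orbit x)).mem_spanFam fun Q f f' w => ?_
  rw [lower, relFam_mul_apply, Int.cast_sum]
  exact Finset.sum_congr rfl fun g _ => charFamily_eq_cast x Q g f' w

theorem vecFam_one_mem_stabFam : vecFam n d 1 ∈ stabFam n d := by
  classical
  refine mem_stabFam_of_charFamily fun x => ?_
  refine (Poly.sum_translates (Poly.orbit x)).mem_spanFam fun Q f f' w => ?_
  rw [vecFam_mul_apply, Int.cast_sum]
  exact Finset.sum_congr rfl fun g _ => charFamily_eq_cast x Q f f' _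

theorem dims_eq_inv {F : Type} [Field F] (f f' : Flag F n d) (w : Fin d → F) :
    dims f = fun k => (inv f f' w).1 k n := funext fun k => (inv_fst_top f f' w k).symm

theorem dimFam_mem_stabFam (ν : ℕ → ℕ) : dimFam n d ν ∈ stabFam n d := by
  classical
  refine mem_stabFam_of_charFamily fun x => ?_
  refine (Poly.ite (fun ι => (fun k => ι.1 k n) = ν) (Poly.orbit x)).mem_spanFam
    fun Q f f' w => ?_
  rw [dimFam_mul_apply, charFamily_eq_cast, ← dims_eq_inv]
  split_ifs <;> simp

end

section

variable {n d : ℕ}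

/-! ### Subalgebras that contain the elementary families -/

/-- A subalgebra of the span of the orbits that contains the elementary families. -/
structure Good (S : Subalgebra 𝒜 (Families n d)) : Prop where
  dim_mem : ∀ ν, dimFam n d ν ∈ S
  upper_mem : ∀ {i : ℕ} (R : ℕ), 0 < i → i < n → upper n d i R ∈ S
  lower_mem : ∀ {i : ℕ} (R : ℕ), 0 < i → i < n → lower n d i R ∈ S
  vec_mem : vecFam n d 1 ∈ S
  mem_span : ∀ g ∈ S, g ∈ spanFam n d

open Classical in
/-- The family that multiplies by a scalar depending on the dimensions of the steps. -/
def weightFam (n d : ℕ) (c : (ℕ → ℕ) → 𝒜) : Families n d :=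
  fun Q f f' w => if f = f' ∧ w = 0 then Q.spec (c (dims f)) else 0

theorem weightFam_mul_apply (c : (ℕ → ℕ) → 𝒜) (g : Families n d) (Q : PrimePower)
    (f f' : Flag Q.Fq n d) (w : Fin d → Q.Fq) :
    (weightFam n d c * g) Q f f' w = Q.spec (c (dims f)) * g Q f f' w := by
  classical
  rw [fam_mul_apply, Finset.sum_eq_single f, Finset.sum_eq_single 0]
  · simp [weightFam]
  · intro m _ hm
    simp [weightFam, hm]
  · simp
  · intro f'' _ h
    simp [weightFam, Ne.symm h]
  · simp

theorem Good.weightFam_mem {S : Subalgebra 𝒜 (Families n d)} (hS : Good S)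
    (c : (ℕ → ℕ) → 𝒜) : weightFam n d c ∈ S := by
  classical
  have : weightFam n d c = ∑ ν ∈ Finset.univ.image (fun (x : DecMat n d) k => x.inv.1 k n),
      c ν • dimFam n d ν := by
    ext Q f f' w
    rw [fam_sum_apply, Finset.sum_eq_single_of_mem (dims f)]
    · rw [fam_smul_apply]
      by_cases h : f = f' ∧ w = 0 <;> simp [weightFam, dimFam, relFam, h]
    · obtain ⟨x, hx⟩ := exists_inv_eq Q f f' w
      refine Finset.mem_image.mpr ⟨x, Finset.mem_univ x, ?_⟩
      rw [dims_eq_inv f f' w, hx]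
    · intro ν _ hν
      rw [fam_smul_apply]
      simp [dimFam, relFam, Ne.symm hν]
  rw [this]
  exact sum_mem fun ν _ => S.smul_mem (hS.dim_mem ν) _

/-! ### Vectors in the higher steps -/

theorem vecFam_mul_relFam_apply (m : ℕ)
    (r : ∀ Q : PrimePower, Flag Q.Fq n d → Flag Q.Fq n d → Prop) (Q : PrimePower)
    (f f' : Flag Q.Fq n d) (w : Fin d → Q.Fq) [Decidable (r Q f f' ∧ w ∈ f.sub m)] :
    (vecFam n d m * relFam r) Q f f' w = if r Q f f' ∧ w ∈ f.sub m then 1 else 0 := by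
  classical
  rw [mul_relFam_apply, Finset.sum_filter, Finset.sum_eq_single f]
  · by_cases h : r Q f f' <;> simp [vecFam, h]
  · intro g _ hg
    simp [vecFam, Ne.symm hg]
  · simp

theorem relFam_mul_vecFam_apply (m : ℕ)
    (r : ∀ Q : PrimePower, Flag Q.Fq n d → Flag Q.Fq n d → Prop) (Q : PrimePower)
    (f f' : Flag Q.Fq n d) (w : Fin d → Q.Fq) [Decidable (r Q f f' ∧ w ∈ f'.sub m)] :
    (relFam r * vecFam n d m) Q f f' w = if r Q f f' ∧ w ∈ f'.sub m then 1 else 0 := by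
  classical
  rw [relFam_mul_apply, Finset.sum_filter, Finset.sum_eq_single f']
  · by_cases h : r Q f f' <;> simp [vecFam, h]
  · intro g _ hg
    simp [vecFam, hg]
  · simp

/-- The admissible u form a coset of U ∩ W, or there are none. -/
theorem PrimePower.sum_sub_mem (Q : PrimePower) (U W : Submodule Q.Fq (Fin d → Q.Fq))
    (w : Fin d → Q.Fq) [DecidablePred (· ∈ U)] [DecidablePred (· ∈ W)]
    [Decidable (w ∈ U ⊔ W)] :
    (∑ u with u ∈ U, if w - u ∈ W then (1 : ℝ) else 0) =
      if w ∈ U ⊔ W then (Q.q : ℝ) ^ Module.finrank Q.Fq ↥(U ⊓ W) else 0 := by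
  classical
  rw [← Finset.sum_filter, Finset.filter_filter, Finset.sum_const, nsmul_one]
  split_ifs with h
  · obtain ⟨u₀, hu₀, y, hy, rfl⟩ := Submodule.mem_sup.mp h
    have h1 := Q.card_filter_mem (U ⊓ W)
    have h2 : (Finset.univ.filter fun u => u ∈ U ∧ u₀ + y - u ∈ W).card =
        (Finset.univ.filter fun u => u ∈ U ⊓ W).card := by
      refine Finset.card_bij' (fun u _ => u - u₀) (fun u _ => u + u₀) ?_ ?_ ?_ ?_
      · intro u hu
        simp only [Finset.mem_filter, Finset.mem_univ, true_and, Submodule.mem_inf] at hu ⊢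
        refine ⟨U.sub_mem hu.1 hu₀, ?_⟩
        have := W.sub_mem hy hu.2
        convert this using 1
        abel
      · intro u hu
        simp only [Finset.mem_filter, Finset.mem_univ, true_and, Submodule.mem_inf] at hu ⊢
        refine ⟨U.add_mem hu.1 hu₀, ?_⟩
        have := W.sub_mem hy hu.2
        convert this using 1
        abel
      · intro u _
        simp
      · intro u _
        simp
    rw [h2]
    exact_mod_cast h1
  · rw [Finset.filter_eq_empty_iff.mpr, Finset.card_empty, Nat.cast_zero]
    rintro u - ⟨hu, hw⟩
    exact h (Submodule.mem_sup.mpr ⟨u, hu, w - u, hw, by abel⟩)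

theorem Below.sup_eq {F : Type} [Field F] {m : ℕ} {f f' g : Flag F n d} (hne : f ≠ f')
    (h : Below m 1 f g) (h' : Below m 1 f' g) : f.sub m ⊔ f'.sub m = g.sub m ∧
      Module.finrank F ↥(f.sub m ⊓ f'.sub m) + 1 = Module.finrank F (f.sub m) := by
  have h1 : f.sub m ≠ f'.sub m := fun e => hne <| Flag.ext_sub fun k => by
    by_cases hk : k = m
    · rw [hk, e]
    · rw [h.1 k hk, h'.1 k hk]
  have h2 : Module.finrank F (f.sub m) = Module.finrank F (f'.sub m) := by
    have := h.2.2
    have := h'.2.2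
    omega
  have h3 : f.sub m < f.sub m ⊔ f'.sub m := by
    refine lt_of_le_of_ne le_sup_left fun e => h1 ?_
    exact (Submodule.eq_of_le_of_finrank_eq (left_eq_sup.mp e) h2.symm).symm
  have h4 : f.sub m ⊔ f'.sub m ≤ g.sub m := sup_le h.2.1 h'.2.1
  have h5 := Submodule.finrank_lt_finrank_of_lt h3
  have h6 := Submodule.finrank_mono h4
  have h7 := h.2.2
  have h8 := Submodule.finrank_sup_add_finrank_inf_eq (f.sub m) (f'.sub m)
  exact ⟨Submodule.eq_of_le_of_finrank_eq h4 (by omega), by omega⟩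

/-- The first product sees the vectors in the enlargements of V_m by a line, which fill V_{m+1}, but
it also has terms with f ≠ f'. The second product has the same off-diagonal terms up to a power of
q, and the third corrects the diagonal. -/
theorem vecFam_succ {m : ℕ} (hm : 0 < m) (hmn : m < n) :
    vecFam n d (m + 1) = lower n d m 1 * (vecFam n d m * upper n d m 1) -
      weightFam n d (fun ν => vpow (2 * (1 - ν m))) *
        (vecFam n d m * (lower n d m 1 * (upper n d m 1 * vecFam n d m))) +
      weightFam n d (fun ν => vpow (2 * (ν (m + 1) - ν m))) * vecFam n d m := by
  classical
  ext Q f f' w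
  have hq : (Q.q : ℝ) ≠ 0 := Nat.cast_ne_zero.mpr (by have := Q.one_lt_q; omega)
  have e1 : (lower n d m 1 * (vecFam n d m * upper n d m 1)) Q f f' w =
      ∑ g with Below m 1 f g, if Below m 1 f' g ∧ w ∈ g.sub m then 1 else 0 := by
    rw [lower, relFam_mul_apply]
    exact Finset.sum_congr rfl fun g _ => vecFam_mul_relFam_apply ..
  have e2 : (vecFam n d m * (lower n d m 1 * (upper n d m 1 * vecFam n d m))) Q f f' w =
      ∑ g with Below m 1 f g, if Below m 1 f' g then if w ∈ f.sub m ⊔ f'.sub m then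
        (Q.q : ℝ) ^ Module.finrank Q.Fq ↥(f.sub m ⊓ f'.sub m) else 0 else 0 := by
    have : ∀ u, (lower n d m 1 * (upper n d m 1 * vecFam n d m)) Q f f' u =
        ∑ g with Below m 1 f g, if Below m 1 f' g ∧ u ∈ f'.sub m then 1 else 0 := fun u => by
      rw [lower, relFam_mul_apply]
      exact Finset.sum_congr rfl fun g _ => relFam_mul_vecFam_apply ..
    rw [vecFam_mul_apply]
    simp only [this]
    rw [Finset.sum_comm]
    refine Finset.sum_congr rfl fun g _ => ?_
    by_cases hg : Below m 1 f' g
    · simp only [hg, true_and, if_true]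
      exact Q.sum_sub_mem _ _ w
    · simp [hg]
  rw [fam_add_apply, fam_sub_apply, weightFam_mul_apply, weightFam_mul_apply, e1, e2,
    spec_vpow_two_mul, spec_vpow_two_mul]
  -- With N enlargements g of V_m and a = dim V_{m+1} - dim V_m, the diagonal value for w ∈ V_m is N
  -- - qN + q^a = 1. For w in V_{m+1} outside V_m it is 1, since exactly one g contains w. Off the
  -- diagonal, V_m + V'_m = g_m and the intersection has dimension dim V_m - 1, so the first two
  -- terms cancel.
  by_cases hff : f = f'
  · subst hff
    rw [← Finset.sum_filter, ← Finset.sum_filter, Finset.filter_filter, Finset.filter_filter]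
    simp only [sup_idem, and_self, Finset.sum_const, nsmul_eq_mul, mul_one,
      ← and_assoc, vecFam, true_and]
    have hc := card_below Q hm hmn f
    have hdim : Module.finrank Q.Fq (f.sub m) ≤ Module.finrank Q.Fq (f.sub (m + 1)) :=
      Submodule.finrank_mono (f.sub_mono (Nat.le_succ m))
    obtain ⟨a, ha⟩ := Nat.exists_eq_add_of_le hdim
    have ha' : ((dims f (m + 1) : ℕ) : ℤ) - (dims f m : ℕ) = (a : ℤ) := by
      simp only [dims, ha]; push_cast; ring
    rw [ha', zpow_natCast]
    by_cases hw : w ∈ f.sub m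
    · have hw' : ∀ g, (Below m 1 f g ∧ w ∈ g.sub m) = Below m 1 f g := fun g =>
        propext ⟨fun h => h.1, fun h => ⟨h, h.2.1 hw⟩⟩
      simp only [hw', hw, f.sub_mono (Nat.le_succ m) hw, if_true]
      set N := (Finset.univ.filter fun g => Below m 1 f g).card
      have hN : ((Q.q : ℝ) - 1) * N = (Q.q : ℝ) ^ a - 1 := by
        rw [ha, pow_add] at hc
        have hc' : (Q.q : ℝ) ^ Module.finrank Q.Fq (f.sub m) * (Q.q - 1) * N =
          (Q.q : ℝ) ^ Module.finrank Q.Fq (f.sub m) * (Q.q : ℝ) ^ a -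
            (Q.q : ℝ) ^ Module.finrank Q.Fq (f.sub m) := by exact_mod_cast hc
        refine mul_left_cancel₀ (pow_ne_zero (Module.finrank Q.Fq (f.sub m)) hq) ?_
        linear_combination hc'
      have hz : (Q.q : ℝ) ^ (1 - ((dims f m : ℕ) : ℤ)) *
          (Q.q : ℝ) ^ Module.finrank Q.Fq ↥(f.sub m ⊓ f.sub m) = Q.q := by
        rw [inf_idem, ← zpow_natCast, ← zpow_add₀ hq]
        simp [dims]
      linear_combination hN + (N : ℝ) * hz
    · simp only [hw, if_false, mul_zero, sub_zero, add_zero]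
      by_cases hw1 : w ∈ f.sub (m + 1)
      · obtain ⟨g, hg, hg'⟩ := Below.existsUnique_of_mem hm hmn f hw1 hw
        have : (Finset.univ.filter fun g => Below m 1 f g ∧ w ∈ g.sub m) = {g} := by
          ext k
          simp only [Finset.mem_filter, Finset.mem_univ, true_and, Finset.mem_singleton]
          exact ⟨fun h => hg' k h, fun h => h ▸ hg⟩
        rw [this, if_pos hw1]
        simp
      · rw [if_neg hw1, Finset.filter_eq_empty_iff.mpr, Finset.card_empty, Nat.cast_zero]
        rintro g - ⟨hg, hgw⟩
        have h3 : g.sub m ≤ f.sub (m + 1) := by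
          rw [hg.1 (m + 1) (by omega)]
          exact g.sub_mono (Nat.le_succ m)
        exact hw1 (h3 hgw)
  · simp only [vecFam, hff, false_and, if_false, mul_zero, add_zero]
    rw [Finset.mul_sum, ← Finset.sum_sub_distrib]
    refine (Finset.sum_eq_zero fun g hg => ?_).symm
    have hg1 := (Finset.mem_filter.mp hg).2
    by_cases hg2 : Below m 1 f' g
    · obtain ⟨h1, h2⟩ := Below.sup_eq hff hg1 hg2
      simp only [h1, hg2, true_and, if_true]
      split_ifs
      · rw [← zpow_natCast, ← zpow_add₀ hq]
        have : (1 - ((dims f m : ℕ) : ℤ)) +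
            (Module.finrank Q.Fq ↥(f.sub m ⊓ f'.sub m) : ℤ) = 0 := by
          simp only [dims]; omega
        rw [this, zpow_zero, sub_self]
      · simp
    · simp [hg2]

theorem vecFam_zero : vecFam n d 0 = 1 := by
  classical
  ext Q f f' w
  rw [fam_one_apply]
  simp only [vecFam, Flag.sub_zero, Submodule.mem_bot]

theorem Good.vecFam_mem {S : Subalgebra 𝒜 (Families n d)} (hS : Good S) (m : ℕ) :
    vecFam n d m ∈ S := by
  induction m with
  | zero => rw [vecFam_zero]; exact S.one_mem
  | succ m ih =>
    by_cases hm : m = 0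
    · rw [hm]; exact hS.vec_mem
    by_cases hmn : m < n
    · have hm := Nat.pos_of_ne_zero hm
      have hu := hS.upper_mem 1 hm hmn
      have hl := hS.lower_mem 1 hm hmn
      rw [vecFam_succ hm hmn]
      exact S.add_mem (S.sub_mem (S.mul_mem hl (S.mul_mem ih hu)) (S.mul_mem (hS.weightFam_mem _)
        (S.mul_mem ih (S.mul_mem hl (S.mul_mem hu ih))))) (S.mul_mem (hS.weightFam_mem _) ih)
    · have : vecFam n d (m + 1) = vecFam n d m := by
        classical
        ext Q f f' w
        simp only [vecFam, Flag.sub_of_le f (show n ≤ m + 1 by omega),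
          Flag.sub_of_le f (show n ≤ m by omega)]
      rw [this]
      exact ih

end

section

variable {n d : ℕ}

/-! ### Relative positions of two flags -/

/-- The dimensions of the intersections of the steps of two flags. -/
def rk {F : Type} [Field F] (f f' : Flag F n d) (k l : ℕ) : ℕ :=
  Module.finrank F ↥(f.sub k ⊓ f'.sub l)

section

variable {F : Type} [Field F] (f f' : Flag F n d)

theorem rk_swap (k l : ℕ) : rk f' f l k = rk f f' k l := by
  rw [rk, rk, inf_comm]

theorem rk_right {l : ℕ} (hl : n ≤ l) (k : ℕ) : rk f f' k l = Module.finrank F (f.sub k) := by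
  rw [rk, f'.sub_of_le hl, inf_top_eq]

theorem rk_left {k : ℕ} (hk : n ≤ k) (l : ℕ) : rk f f' k l = Module.finrank F (f'.sub l) := by
  rw [← rk_swap, rk_right f' f hk]

theorem rk_mono {k l k' l' : ℕ} (hk : k ≤ k') (hl : l ≤ l') : rk f f' k l ≤ rk f f' k' l' :=
  Submodule.finrank_mono (inf_le_inf (f.sub_mono hk) (f'.sub_mono hl))

theorem rk_le (k l : ℕ) : rk f f' k l ≤ d :=
  (Submodule.finrank_le _).trans (by simp)

theorem sub_clamp (g : Flag F n d) (k : ℕ) : g.sub k = g.sub (min k n) := by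
  rcases le_total k n with h | h
  · rw [min_eq_left h]
  · rw [min_eq_right h, g.sub_of_le h, g.sub_of_le le_rfl]

theorem rk_clamp (k l : ℕ) : rk f f' k l = rk f f' (min k n) (min l n) := by
  rw [rk, rk, ← sub_clamp, ← sub_clamp]

/-- Inclusions between steps are read off from the relative position, so they carry over to all
pairs of flags in that position, over any field. -/
theorem sub_le_sub_iff (k l : ℕ) : f.sub k ≤ f'.sub l ↔ rk f f' k l = rk f f' k n := by
  rw [rk_right f f' le_rfl, ← inf_eq_left]
  exact ⟨fun h => by rw [rk, h], Submodule.eq_of_le_of_finrank_eq inf_le_left⟩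

theorem eq_iff_rk : f = f' ↔ ∀ k, rk f f' k k = rk f f' k n ∧ rk f f' k k = rk f f' n k :=
  flag_eq_iff f f' 0

theorem Below.rk_le_add {m R : ℕ} {f' g : Flag F n d} (h : Below m R f' g) (k l : ℕ) :
    rk f g k l ≤ rk f f' k l + R := by
  by_cases hl : l = m
  · subst hl
    have h1 := Submodule.finrank_sup_add_finrank_inf_eq (f.sub k ⊓ g.sub l) (f'.sub l)
    have h2 : f.sub k ⊓ g.sub l ⊓ f'.sub l = f.sub k ⊓ f'.sub l := by
      rw [inf_assoc, inf_eq_right.mpr h.2.1]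
    have h3 : Module.finrank F ↥(f.sub k ⊓ g.sub l ⊔ f'.sub l) ≤ Module.finrank F (g.sub l) :=
      Submodule.finrank_mono (sup_le inf_le_right h.2.1)
    have h4 := h.2.2
    rw [h2] at h1
    simp only [rk]
    omega
  · rw [rk, rk, h.1 l hl]
    exact Nat.le_add_right _ _

theorem Below.rk_le_of_below {m R : ℕ} {f g : Flag F n d} (h : Below m R f g) (k l : ℕ) :
    rk f f' k l ≤ rk g f' k l :=
  Submodule.finrank_mono (inf_le_inf_right _ (h.sub_le k))

end

/-! ### The induction parameter -/

/-- The induction parameter of the triangularity argument. -/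
def psi (n : ℕ) (ρ : ℕ → ℕ → ℕ) : ℤ :=
  ∑ k ∈ Finset.range n, (2 * (n : ℤ) - 1 - 2 * k) * ((ρ k n : ℤ) + ρ n k) -
    2 * ∑ k ∈ Finset.range n, ∑ l ∈ Finset.range n, (ρ k l : ℤ)

theorem psi_swap (ρ : ℕ → ℕ → ℕ) : psi n (fun k l => ρ l k) = psi n ρ := by
  rw [psi, psi, Finset.sum_comm]
  simp only [add_comm]

theorem neg_le_psi {F : Type} [Field F] (f f' : Flag F n d) :
    -(2 * ((n : ℤ) * (n * d))) ≤ psi n (rk f f') := by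
  have h1 : 0 ≤ ∑ k ∈ Finset.range n, (2 * (n : ℤ) - 1 - 2 * k) *
      ((rk f f' k n : ℤ) + rk f f' n k) := by
    refine Finset.sum_nonneg fun k hk => mul_nonneg ?_ (by positivity)
    have := Finset.mem_range.mp hk
    omega
  have h2 : ∑ k ∈ Finset.range n, ∑ l ∈ Finset.range n, (rk f f' k l : ℤ) ≤ n * (n * d) := by
    have : ∑ k ∈ Finset.range n, ∑ l ∈ Finset.range n, (rk f f' k l : ℤ) ≤
        ∑ k ∈ Finset.range n, ∑ l ∈ Finset.range n, (d : ℤ) :=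
      Finset.sum_le_sum fun k _ => Finset.sum_le_sum fun l _ => by
        exact_mod_cast rk_le f f' k l
    simpa using this
  rw [psi]
  linarith

/-- With the dimensions of all steps fixed, only the double sum varies, and it enters with a
negative sign: larger intersections mean smaller `psi`. -/
theorem psi_lt {F K : Type} [Field F] [Field K] {f f' : Flag F n d} {g g' : Flag K n d}
    (h : ∀ k l, rk f f' k l ≤ rk g g' k l) (h1 : ∀ k, rk f f' k n = rk g g' k n)
    (h2 : ∀ k, rk f f' n k = rk g g' n k) (hne : rk g g' ≠ rk f f') :
    psi n (rk g g') < psi n (rk f f') := by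
  have : ∃ k < n, ∃ l < n, rk f f' k l < rk g g' k l := by
    by_contra! hc
    refine hne (funext fun k => funext fun l => ?_)
    rw [rk_clamp g, rk_clamp f]
    rcases (min_le_right k n).lt_or_eq with hk | hk
    · rcases (min_le_right l n).lt_or_eq with hl | hl
      · exact le_antisymm (hc _ hk _ hl) (h _ _)
      · rw [hl, h1]
    · rw [hk, h2]
  obtain ⟨k, hk, l, hl, hkl⟩ := this
  rw [psi, psi]
  simp only [h1, h2]
  have : ∑ k ∈ Finset.range n, ∑ l ∈ Finset.range n, (rk f f' k l : ℤ) <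
      ∑ k ∈ Finset.range n, ∑ l ∈ Finset.range n, (rk g g' k l : ℤ) := by
    refine Finset.sum_lt_sum (fun k _ => Finset.sum_le_sum fun l _ => by exact_mod_cast h k l)
      ⟨k, Finset.mem_range.mpr hk, Finset.sum_lt_sum (fun l _ => by exact_mod_cast h k l)
        ⟨l, Finset.mem_range.mpr hl, by exact_mod_cast hkl⟩⟩
  linarith

theorem sum_range_ite_le {i n : ℕ} (h : i ≤ n) (R : ℤ) :
    (∑ k ∈ Finset.range n, if i ≤ k then R else 0) = (n - i) * R := by
  induction n, h using Nat.le_induction with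
  | base =>
    rw [sub_self, zero_mul]
    exact Finset.sum_eq_zero fun k hk => if_neg (by have := Finset.mem_range.mp hk; omega)
  | succ n hn ih =>
    rw [Finset.sum_range_succ, ih, if_pos hn]
    push_cast
    ring

/-- The relative position after the step `m` of the second flag absorbs the step `i` of the
first one. -/
def raise (ρ : ℕ → ℕ → ℕ) (i m R : ℕ) (k l : ℕ) : ℕ := ρ k l + if l = m ∧ i ≤ k then R else 0

theorem psi_raise (ρ : ℕ → ℕ → ℕ) {i m R : ℕ} (him : i ≤ m) (hmn : m < n) (hR : 0 < R) :
    psi n (raise ρ i m R) < psi n ρ := by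
  have h1 : ∑ k ∈ Finset.range n, (2 * (n : ℤ) - 1 - 2 * k) *
      ((raise ρ i m R k n : ℤ) + raise ρ i m R n k) =
      ∑ k ∈ Finset.range n, (2 * (n : ℤ) - 1 - 2 * k) * ((ρ k n : ℤ) + ρ n k) +
        (2 * n - 1 - 2 * m) * R := by
    have : ∀ k ∈ Finset.range n, (2 * (n : ℤ) - 1 - 2 * k) *
        ((raise ρ i m R k n : ℤ) + raise ρ i m R n k) =
        (2 * (n : ℤ) - 1 - 2 * k) * ((ρ k n : ℤ) + ρ n k) +
          if k = m then (2 * n - 1 - 2 * m) * (R : ℤ) else 0 := fun k _ => by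
      have e1 : n ≠ m := by omega
      have e2 : i ≤ n := by omega
      simp only [raise, e1, e2, false_and, and_true, if_false, add_zero]
      split_ifs with h
      · subst h; push_cast; ring
      · simp
    rw [Finset.sum_congr rfl this, Finset.sum_add_distrib, Finset.sum_ite_eq',
      if_pos (Finset.mem_range.mpr hmn)]
  have h2 : ∑ k ∈ Finset.range n, ∑ l ∈ Finset.range n, (raise ρ i m R k l : ℤ) =
      ∑ k ∈ Finset.range n, ∑ l ∈ Finset.range n, (ρ k l : ℤ) + (n - i) * R := by
    rw [← sum_range_ite_le (by omega : i ≤ n), ← Finset.sum_add_distrib]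
    refine Finset.sum_congr rfl fun k _ => ?_
    have : (if i ≤ k then (R : ℤ) else 0) =
        ∑ l ∈ Finset.range n, if l = m then (if i ≤ k then (R : ℤ) else 0) else 0 := by
      rw [Finset.sum_ite_eq', if_pos (Finset.mem_range.mpr hmn)]
    rw [this, ← Finset.sum_add_distrib]
    refine Finset.sum_congr rfl fun l _ => ?_
    rw [raise, ite_and]
    push_cast
    rfl
  rw [psi, psi, h1, h2]
  -- The margin contributes (2n - 1 - 2m)R and the interior -2(n - i)R, in total (2(i - m) - 1)R.
  -- The odd weights make this negative even for i = m.
  have h3 : (i : ℤ) ≤ m := by exact_mod_cast him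
  have h4 : (1 : ℤ) ≤ R := by exact_mod_cast hR
  nlinarith

/-- The relative position after the step `i` of the first flag is intersected with the step `m`
of the second one. -/
def cut (ρ : ℕ → ℕ → ℕ) (i m : ℕ) (k l : ℕ) : ℕ := if k = i then ρ i (min l m) else ρ k l

theorem psi_cut (ρ : ℕ → ℕ → ℕ) {i m R : ℕ} (him : i ≤ m) (hmn : m < n) (hR : 0 < R)
    (h : ∀ l, m < l → ρ i l = ρ i m + R) :
    psi n (cut ρ i m) < psi n ρ := by
  have h1 : ∑ k ∈ Finset.range n, (2 * (n : ℤ) - 1 - 2 * k) *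
      ((cut ρ i m k n : ℤ) + cut ρ i m n k) =
      ∑ k ∈ Finset.range n, (2 * (n : ℤ) - 1 - 2 * k) * ((ρ k n : ℤ) + ρ n k) -
        (2 * n - 1 - 2 * i) * R := by
    have : ∀ k ∈ Finset.range n, (2 * (n : ℤ) - 1 - 2 * k) *
        ((cut ρ i m k n : ℤ) + cut ρ i m n k) =
        (2 * (n : ℤ) - 1 - 2 * k) * ((ρ k n : ℤ) + ρ n k) -
          if k = i then (2 * n - 1 - 2 * i) * (R : ℤ) else 0 := fun k _ => by
      have e1 : n ≠ i := by omega
      simp only [cut, e1, if_false, min_eq_right hmn.le]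
      split_ifs with hk
      · subst hk; rw [h n hmn]; push_cast; ring
      · simp
    rw [Finset.sum_congr rfl this, Finset.sum_sub_distrib, Finset.sum_ite_eq',
      if_pos (Finset.mem_range.mpr (by omega))]
  have h2 : ∑ k ∈ Finset.range n, ∑ l ∈ Finset.range n, (cut ρ i m k l : ℤ) =
      ∑ k ∈ Finset.range n, ∑ l ∈ Finset.range n, (ρ k l : ℤ) - (n - (m + 1 : ℕ)) * R := by
    have : ∑ k ∈ Finset.range n, (if k = i then (∑ l ∈ Finset.range n,
        if m + 1 ≤ l then (R : ℤ) else 0) else 0) = (n - (m + 1 : ℕ)) * R := by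
      rw [Finset.sum_ite_eq', if_pos (Finset.mem_range.mpr (by omega)), sum_range_ite_le hmn]
    rw [← this, ← Finset.sum_sub_distrib]
    refine Finset.sum_congr rfl fun k _ => ?_
    by_cases hk : k = i
    · subst hk
      rw [if_pos rfl, ← Finset.sum_sub_distrib]
      refine Finset.sum_congr rfl fun l _ => ?_
      simp only [cut, if_true]
      split_ifs with hl
      · rw [min_eq_right (by omega), h l hl]
        push_cast
        ring
      · rw [min_eq_left (by omega), sub_zero]
    · simp [cut, hk]
  rw [psi, psi, h1, h2]
  -- The margin contributes -(2n - 1 - 2i)R and the interior 2(n - m - 1)R, which again add up to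
  -- (2(i - m) - 1)R. The weights in `psi` thus serve both moves.
  have h3 : (i : ℤ) ≤ m := by exact_mod_cast him
  have h4 : (1 : ℤ) ≤ R := by exact_mod_cast hR
  push_cast
  nlinarith

/-! ### Families of given relative position -/

open Classical in
/-- The characteristic function of the triples with given relative position of the flags whose
vector lies in the sums of steps indexed by `s` but in none of those indexed by `t`. -/
def posFam (n d : ℕ) (ρ : ℕ → ℕ → ℕ) (s t : Set (ℕ × ℕ)) : Families n d :=
  fun _ f f' w => if rk f f' = ρ ∧ (∀ p ∈ s, w ∈ f.sub p.1 ⊔ f'.sub p.2) ∧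
    ∀ p ∈ t, w ∉ f.sub p.1 ⊔ f'.sub p.2 then 1 else 0

/-- The characteristic function of the triples with given relative position of the flags whose
vector lies in the sums of steps indexed by `s`. -/
abbrev sumFam (n d : ℕ) (ρ : ℕ → ℕ → ℕ) (s : Set (ℕ × ℕ)) : Families n d := posFam n d ρ s ∅

theorem posFam_apply (ρ : ℕ → ℕ → ℕ) (s t : Set (ℕ × ℕ)) (Q : PrimePower) (f f' : Flag Q.Fq n d)
    (w : Fin d → Q.Fq) [Decidable (rk f f' = ρ ∧ (∀ p ∈ s, w ∈ f.sub p.1 ⊔ f'.sub p.2) ∧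
      ∀ p ∈ t, w ∉ f.sub p.1 ⊔ f'.sub p.2)] : posFam n d ρ s t Q f f' w =
      if rk f f' = ρ ∧ (∀ p ∈ s, w ∈ f.sub p.1 ⊔ f'.sub p.2) ∧
        ∀ p ∈ t, w ∉ f.sub p.1 ⊔ f'.sub p.2 then 1 else 0 := by
  unfold posFam
  congr

theorem sumFam_apply (ρ : ℕ → ℕ → ℕ) (s : Set (ℕ × ℕ)) (Q : PrimePower) (f f' : Flag Q.Fq n d)
    (w : Fin d → Q.Fq) [Decidable (rk f f' = ρ ∧ ∀ p ∈ s, w ∈ f.sub p.1 ⊔ f'.sub p.2)] :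
    sumFam n d ρ s Q f f' w =
      if rk f f' = ρ ∧ ∀ p ∈ s, w ∈ f.sub p.1 ⊔ f'.sub p.2 then 1 else 0 := by
  classical
  exact (posFam_apply ..).trans (if_congr (by simp) rfl rfl)

theorem posFam_insert (ρ : ℕ → ℕ → ℕ) (s t : Set (ℕ × ℕ)) (p : ℕ × ℕ) :
    posFam n d ρ s (insert p t) = posFam n d ρ s t - posFam n d ρ (insert p s) t := by
  classical
  ext Q f f' w
  rw [fam_sub_apply]
  simp only [posFam, Set.forall_mem_insert]
  by_cases h4 : w ∈ f.sub p.1 ⊔ f'.sub p.2 <;> simp [h4]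

theorem posFam_mem {S : Subalgebra 𝒜 (Families n d)} {ρ : ℕ → ℕ → ℕ}
    (h : ∀ s, sumFam n d ρ s ∈ S) (t : Finset (ℕ × ℕ)) : ∀ s, posFam n d ρ s t ∈ S := by
  classical
  induction t using Finset.induction_on with
  | empty => simpa using h
  | insert p t _ ih =>
    intro s
    rw [Finset.coe_insert, posFam_insert]
    exact S.sub_mem (ih s) (ih _)

/-- Steps beyond n repeat the step n, so finitely many excluded sums suffice. Finiteness of t is
what the inclusion-exclusion in `posFam_mem` needs. -/
theorem charFamily_eq_posFam (x : DecMat n d) : ∃ (s : Set (ℕ × ℕ)) (t : Finset (ℕ × ℕ)),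
    charFamily x = posFam n d x.inv.1 s t := by
  classical
  refine ⟨{p | x.inv.2 p.1 p.2}, (Finset.range (n + 1) ×ˢ Finset.range (n + 1)).filter
    fun p => ¬ x.inv.2 p.1 p.2, ?_⟩
  ext Q f f' w
  rw [charFamily_apply, posFam_apply]
  refine if_congr ?_ rfl rfl
  constructor
  · intro h
    refine ⟨congrArg Prod.fst h, fun p hp => ?_, fun p hp hp' => ?_⟩
    · exact (congrFun (congrFun (congrArg Prod.snd h) p.1) p.2).mpr hp
    · exact (Finset.mem_filter.mp hp).2
        ((congrFun (congrFun (congrArg Prod.snd h) p.1) p.2).mp hp')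
  · rintro ⟨h1, h2, h3⟩
    obtain ⟨g, g', u, hg⟩ := DecMat.exists_inv_eq Q.Fq x
    refine Prod.ext h1 (funext fun k => funext fun l => propext ⟨fun h => ?_, h2 (k, l)⟩)
    by_contra hx
    have hx' : ¬ x.inv.2 (min k n) (min l n) := by
      rw [← hg] at hx ⊢
      change u ∉ g.sub (min k n) ⊔ g'.sub (min l n)
      rw [← sub_clamp, ← sub_clamp]
      exact hx
    refine h3 (min k n, min l n) (Finset.mem_coe.mpr (Finset.mem_filter.mpr ⟨?_, hx'⟩)) ?_
    · simp only [Finset.mem_product, Finset.mem_range]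
      omega
    · change w ∈ f.sub (min k n) ⊔ f'.sub (min l n)
      rw [← sub_clamp, ← sub_clamp]
      exact h

theorem charFamily_mem {S : Subalgebra 𝒜 (Families n d)} (x : DecMat n d)
    (h : ∀ s, sumFam n d x.inv.1 s ∈ S) : charFamily x ∈ S := by
  obtain ⟨s, t, hx⟩ := charFamily_eq_posFam x
  rw [hx]
  exact posFam_mem h t s

/-- Being in the span, g is a combination of orbits. The orbits of smaller `psi` lie in S by
induction; subtracting their contribution leaves only the leading part. -/
theorem Good.sumFam_mem_of_leading {S : Subalgebra 𝒜 (Families n d)} (hS : Good S)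
    {ρ : ℕ → ℕ → ℕ} {s : Set (ℕ × ℕ)}
    (IH : ∀ ρ' s', psi n ρ' < psi n ρ → sumFam n d ρ' s' ∈ S) {g : Families n d} (hg : g ∈ S)
    (h1 : ∀ Q f f' w, rk f f' = ρ → g Q f f' w = sumFam n d ρ s Q f f' w)
    (h2 : ∀ Q f f' w, rk f f' ≠ ρ → g Q f f' w ≠ 0 → psi n (rk f f') < psi n ρ) :
    sumFam n d ρ s ∈ S := by
  classical
  obtain ⟨P, hP⟩ := mem_spanFam_iff.mp (hS.mem_span g hg)
  have : sumFam n d ρ s = g - ∑ x : DecMat n d with psi n x.inv.1 < psi n ρ,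
      P x.inv • charFamily x := by
    ext Q f f' w
    rw [fam_sub_apply, sum_smul_charFamily_apply]
    obtain ⟨x, hx⟩ := exists_inv_eq Q f f' w
    have hx1 : rk f f' = x.inv.1 := congrArg Prod.fst hx
    have e : (∃ x ∈ Finset.univ.filter fun x : DecMat n d => psi n x.inv.1 < psi n ρ,
        inv f f' w = x.inv) ↔ psi n (rk f f') < psi n ρ := by
      constructor
      · rintro ⟨y, hy, hyx⟩
        rw [show rk f f' = y.inv.1 from congrArg Prod.fst hyx]
        exact (Finset.mem_filter.mp hy).2
      · intro h
        exact ⟨x, Finset.mem_filter.mpr ⟨Finset.mem_univ x, hx1 ▸ h⟩, hx⟩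
    rw [if_congr e rfl rfl]
    split_ifs with hlt
    · rw [← hP, sub_self, sumFam_apply, if_neg]
      rintro ⟨h, -⟩
      exact hlt.ne (congrArg _ h)
    · rw [sub_zero]
      by_cases hρ : rk f f' = ρ
      · exact (h1 Q f f' w hρ).symm
      · rw [sumFam_apply, if_neg (fun h => hρ h.1)]
        by_contra h0
        exact hlt (h2 Q f f' w hρ (Ne.symm h0))
  rw [this]
  refine S.sub_mem hg (sum_mem fun x hx => S.smul_mem (charFamily_mem x fun s' => ?_) _)
  exact IH _ _ (Finset.mem_filter.mp hx).2

end

section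

variable {n d : ℕ}

/-! ### Reduction of the relative position -/

theorem finrank_inf_sup_of_le {F V : Type} [Field F] [AddCommGroup V] [Module F V]
    [FiniteDimensional F V] {A B C : Submodule F V} (h : A ≤ B) :
    Module.finrank F ↥(B ⊓ (A ⊔ C)) + Module.finrank F ↥(A ⊓ C) =
      Module.finrank F A + Module.finrank F ↥(B ⊓ C) := by
  have h1 := Submodule.finrank_sup_add_finrank_inf_eq A (C ⊓ B)
  rw [← sup_inf_assoc_of_le C h, inf_comm C B, ← inf_assoc, inf_eq_left.mpr h, inf_comm _ B] at h1
  exact h1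

/-- In the raised position V_i is contained in g_m; hence g_m contains V_i + V'_m, and the
dimensions agree. This is why the leading coefficient is 1. -/
theorem raise_unique {F : Type} [Field F] {f f' : Flag F n d} {i m R : ℕ} (him : i ≤ m)
    (hm : 0 < m) (hmn : m < n) (hlt : ∀ k < i, rk f f' k k = rk f f' k n)
    (hle : rk f f' i (m + 1) = rk f f' i n) (hR : rk f f' i m + R = rk f f' i n) :
    ∃ g, (Below m R f' g ∧ g.sub m = f.sub i ⊔ f'.sub m) ∧
      rk f g = raise (rk f f') i m R ∧
      ∀ h, Below m R f' h → rk f h = raise (rk f f') i m R → h = g := by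
  have hi : f.sub i ≤ f'.sub (m + 1) := (sub_le_sub_iff ..).mpr hle
  obtain ⟨g, hg, hgk⟩ := f'.exists_update hm hmn (W := f.sub i ⊔ f'.sub m)
    (le_sup_of_le_right (f'.sub_mono (Nat.sub_le m 1))) (sup_le hi (f'.sub_mono (Nat.le_succ m)))
  have hsum := Submodule.finrank_sup_add_finrank_inf_eq (f.sub i) (f'.sub m)
  rw [rk_right f f' le_rfl] at hR
  have hR' : Module.finrank F ↥(f.sub i ⊓ f'.sub m) + R = Module.finrank F (f.sub i) := hR
  have hdim : Module.finrank F ↥(f.sub i ⊔ f'.sub m) = Module.finrank F (f'.sub m) + R := by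
    omega
  have hB : Below m R f' g :=
    ⟨fun k hk => (hgk k hk).symm, by rw [hg]; exact le_sup_right, by rw [hg]; exact hdim⟩
  refine ⟨g, ⟨hB, hg⟩, ?_, fun h hh hrk => ?_⟩
  · funext k l
    by_cases hl : l = m
    · subst hl
      by_cases hk : i ≤ k
      · have := finrank_inf_sup_of_le (C := f'.sub l) (f.sub_mono hk)
        rw [rk, raise, if_pos ⟨rfl, hk⟩, hg, rk]
        omega
      · have h1 : f.sub k ≤ f'.sub l := ((sub_le_sub_iff ..).mpr (hlt k (by omega))).trans
          (f'.sub_mono (by omega))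
        have h2 : f.sub k ≤ f.sub i ⊔ f'.sub l := le_sup_of_le_right h1
        rw [rk, raise, if_neg (fun h => hk h.2), hg, rk, inf_eq_left.mpr h1, inf_eq_left.mpr h2,
          add_zero]
    · rw [rk, raise, if_neg (fun h => hl h.1), hgk l hl, rk, add_zero]
  · refine Flag.ext_sub fun k => ?_
    by_cases hk : k = m
    · subst hk
      have h1 : f.sub i ≤ h.sub k := by
        rw [sub_le_sub_iff, hrk, raise, if_pos ⟨rfl, le_rfl⟩, raise, if_neg (by omega), add_zero,
          rk_right f f' le_rfl]
        exact hR
      refine (Submodule.eq_of_le_of_finrank_eq (hg.trans_le (sup_le h1 hh.2.1)) ?_).symm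
      rw [hh.2.2, hg, hdim]
    · rw [hgk k hk, hh.1 k hk]

/-- The hypothesis on s makes the conditions on w insensitive to the move: for i ≤ k, enlarging V'_m
by V_i does not change V_k + V'_m. -/
theorem Good.sumFam_mem_of_raise {S : Subalgebra 𝒜 (Families n d)} (hS : Good S)
    {F : Type} [Field F] (f₀ f₀' : Flag F n d) {s : Set (ℕ × ℕ)}
    (IH : ∀ ρ' s', psi n ρ' < psi n (rk f₀ f₀') → sumFam n d ρ' s' ∈ S) {i m R : ℕ} (him : i ≤ m)
    (hm : 0 < m) (hmn : m < n) (hR0 : 0 < R)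
    (hlt : ∀ k < i, rk f₀ f₀' k k = rk f₀ f₀' k n)
    (hle : rk f₀ f₀' i (m + 1) = rk f₀ f₀' i n) (hR : rk f₀ f₀' i m + R = rk f₀ f₀' i n)
    (hs : ∀ k, (k, m) ∈ s → i ≤ k) : sumFam n d (rk f₀ f₀') s ∈ S := by
  classical
  refine hS.sumFam_mem_of_leading IH (S.mul_mem (IH (raise (rk f₀ f₀') i m R) s
    (psi_raise _ him hmn hR0)) (hS.upper_mem R hm hmn)) ?_ ?_
  · intro Q f f' w hρ
    rw [← hρ] at hlt hle hR ⊢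
    obtain ⟨g, ⟨hg, hgm⟩, hg2, hg3⟩ := raise_unique him hm hmn hlt hle hR
    rw [upper, mul_relFam_apply, Finset.sum_eq_single_of_mem g (by simpa using hg)]
    · rw [sumFam_apply, sumFam_apply]
      refine if_congr (and_congr (iff_of_true hg2 rfl) (forall₂_congr fun p hp => ?_)) rfl rfl
      by_cases hpm : p.2 = m
      · rw [hpm, hgm, ← sup_assoc, sup_eq_left.mpr (f.sub_mono (hs p.1 (hpm ▸ hp)))]
      · rw [hg.1 p.2 hpm]
    · intro h hh hne
      rw [sumFam_apply, if_neg]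
      exact fun h' => hne (hg3 h (Finset.mem_filter.mp hh).2 h'.1)
  · intro Q f f' w hρ h0
    rw [upper, mul_relFam_apply] at h0
    obtain ⟨g, hg, hg0⟩ := Finset.exists_ne_zero_of_sum_ne_zero h0
    replace hg : Below m R f' g := (Finset.mem_filter.mp hg).2
    rw [sumFam_apply] at hg0
    have hrk : rk f g = raise (rk f₀ f₀') i m R := by
      by_contra h
      exact hg0 (if_neg fun h' => h h'.1)
    have hother : ∀ k l, l ≠ m → rk f f' k l = rk f₀ f₀' k l := fun k l hl => by
      have := congrFun (congrFun hrk k) l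
      rw [raise, if_neg (fun h => hl h.1), add_zero] at this
      rw [← this, rk, rk, hg.1 l hl]
    -- Column m drops by at most R from its raised value, so it is at least the original one. In the
    -- rows k < i the intersection is all of V_k, already maximal.
    refine psi_lt (fun k l => ?_) (fun k => (hother k n (by omega)).symm) (fun k => ?_) hρ
    · by_cases hl : l = m
      · subst hl
        by_cases hk : i ≤ k
        · have h1 := hg.rk_le_add f k l
          rw [hrk, raise, if_pos ⟨rfl, hk⟩] at h1
          omega
        · have h1 : f.sub k ≤ f'.sub k := by
            rw [sub_le_sub_iff, hother k k (by omega), hother k n (by omega)]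
            exact hlt k (by omega)
          have h2 := (sub_le_sub_iff ..).mp (h1.trans (f'.sub_mono (show k ≤ l by omega)))
          rw [h2, hother k n (by omega)]
          exact rk_mono _ _ le_rfl (by omega)
      · exact (hother k l hl).ge
    · by_cases hk : k = m
      · subst hk
        have h1 := congrFun (congrFun hrk n) k
        rw [raise, if_pos ⟨rfl, by omega⟩, rk_left f g le_rfl, hg.2.2, ← rk_left f f' le_rfl] at h1
        omega
      · exact (hother n k hk).symm

theorem cut_unique {F : Type} [Field F] {f f' : Flag F n d} {i m R : ℕ} (hi : 0 < i) (him : i ≤ m)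
    (hmn : m < n) (hprev : rk f f' (i - 1) m = rk f f' (i - 1) n)
    (hR : rk f f' i m + R = rk f f' i n) :
    ∃ g, (Below i R g f ∧ g.sub i = f.sub i ⊓ f'.sub m) ∧
      rk g f' = cut (rk f f') i m ∧
      ∀ h, Below i R h f → rk h f' = cut (rk f f') i m → h = g := by
  have hp : f.sub (i - 1) ≤ f'.sub m := (sub_le_sub_iff ..).mpr hprev
  obtain ⟨g, hg, hgk⟩ := f.exists_update hi (by omega : i < n) (W := f.sub i ⊓ f'.sub m)
    (le_inf (f.sub_mono (Nat.sub_le i 1)) hp) (inf_le_of_left_le (f.sub_mono (Nat.le_succ i)))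
  rw [rk_right f f' le_rfl] at hR
  have hR' : Module.finrank F ↥(f.sub i ⊓ f'.sub m) + R = Module.finrank F (f.sub i) := hR
  have hB : Below i R g f :=
    ⟨hgk, by rw [hg]; exact inf_le_left, by rw [hg]; exact hR'.symm⟩
  refine ⟨g, ⟨hB, hg⟩, ?_, fun h hh hrk => ?_⟩
  · funext k l
    by_cases hk : k = i
    · subst hk
      rw [cut, if_pos rfl, rk, rk, hg, inf_assoc]
      rcases le_total l m with hl | hl
      · rw [min_eq_left hl, inf_eq_right.mpr (f'.sub_mono hl)]
      · rw [min_eq_right hl, inf_eq_left.mpr (f'.sub_mono hl)]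
    · rw [cut, if_neg hk, rk, rk, hgk k hk]
  · refine Flag.ext_sub fun k => ?_
    by_cases hk : k = i
    · subst hk
      have h1 : h.sub k ≤ f'.sub m := by
        rw [sub_le_sub_iff, hrk, cut, if_pos rfl, cut, if_pos rfl, min_self, min_eq_right hmn.le]
      rw [hg]
      refine Submodule.eq_of_le_of_finrank_eq (le_inf hh.2.1 h1) ?_
      have := hh.2.2
      omega
    · rw [hgk k hk, hh.1 k hk]

/-- Here the conditions on w survive because they force w ∈ V'_m. For l ≥ m this settles the
condition at (i, l), and for l < m the modular law gives (V_i ∩ V'_m) + V'_l = (V_i + V'_l) ∩ V'_m.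
-/
theorem Good.sumFam_mem_of_cut {S : Subalgebra 𝒜 (Families n d)} (hS : Good S)
    {F : Type} [Field F] (f₀ f₀' : Flag F n d) {s : Set (ℕ × ℕ)}
    (IH : ∀ ρ' s', psi n ρ' < psi n (rk f₀ f₀') → sumFam n d ρ' s' ∈ S) {i m R : ℕ} (hi : 0 < i)
    (him : i ≤ m) (hmn : m < n) (hR0 : 0 < R)
    (hprev : rk f₀ f₀' (i - 1) m = rk f₀ f₀' (i - 1) n)
    (hnext : rk f₀ f₀' (i + 1) (m + 1) = rk f₀ f₀' (i + 1) n)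
    (hR : rk f₀ f₀' i m + R = rk f₀ f₀' i n)
    (hs : ∀ (Q : PrimePower) (f f' : Flag Q.Fq n d) (w : Fin d → Q.Fq), rk f f' = rk f₀ f₀' →
      (∀ p ∈ s, w ∈ f.sub p.1 ⊔ f'.sub p.2) → w ∈ f'.sub m) :
    sumFam n d (rk f₀ f₀') s ∈ S := by
  classical
  have hrow : ∀ l, m < l → rk f₀ f₀' i l = rk f₀ f₀' i n := fun l hl =>
    (sub_le_sub_iff ..).mp ((f₀.sub_mono (Nat.le_succ i)).trans
      (((sub_le_sub_iff ..).mpr hnext).trans (f₀'.sub_mono hl)))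
  refine hS.sumFam_mem_of_leading IH (S.mul_mem (hS.upper_mem R hi (by omega : i < n))
    (IH (cut (rk f₀ f₀') i m) s (psi_cut _ him hmn hR0 fun l hl => (hrow l hl).trans hR.symm)))
    ?_ ?_
  · intro Q f f' w hρ
    have hs' := hs Q f f' w hρ
    rw [← hρ] at hprev hnext hR ⊢
    obtain ⟨g, ⟨hg, hgm⟩, hg2, hg3⟩ := cut_unique hi him hmn hprev hR
    rw [upper, relFam_mul_apply, Finset.sum_eq_single_of_mem g (by simpa using hg)]
    · rw [sumFam_apply, sumFam_apply]
      refine if_congr (and_congr (iff_of_true hg2 rfl) ⟨fun h p hp => ?_, fun h p hp => ?_⟩)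
        rfl rfl
      · exact sup_le_sup_right (hg.sub_le p.1) _ (h p hp)
      · have hw := hs' h
        have hwp := h p hp
        by_cases hpi : p.1 = i
        · rw [hpi] at hwp ⊢
          rw [hgm]
          rcases le_total m p.2 with hl | hl
          · exact Submodule.mem_sup_right (f'.sub_mono hl hw)
          · rw [sup_comm, ← sup_inf_assoc_of_le _ (f'.sub_mono hl), sup_comm]
            exact ⟨hwp, hw⟩
        · rw [hg.1 p.1 hpi]
          exact hwp
    · intro h hh hne
      rw [sumFam_apply, if_neg]
      exact fun h' => hne (hg3 h (Finset.mem_filter.mp hh).2 h'.1)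
  · intro Q f f' w hρ h0
    rw [upper, relFam_mul_apply] at h0
    obtain ⟨g, hg, hg0⟩ := Finset.exists_ne_zero_of_sum_ne_zero h0
    replace hg : Below i R g f := (Finset.mem_filter.mp hg).2
    rw [sumFam_apply] at hg0
    have hrk : rk g f' = cut (rk f₀ f₀') i m := by
      by_contra h
      exact hg0 (if_neg fun h' => h h'.1)
    have hother : ∀ k l, k ≠ i → rk f f' k l = rk f₀ f₀' k l := fun k l hk => by
      have := congrFun (congrFun hrk k) l
      rw [cut, if_neg hk] at this
      rw [← this, rk, rk, hg.1 k hk]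
    have hin : rk f f' i n = rk f₀ f₀' i n := by
      have h1 := congrFun (congrFun hrk i) n
      rw [cut, if_pos rfl, min_eq_right hmn.le, rk_right g f' le_rfl] at h1
      rw [rk_right f f' le_rfl, hg.2.2, h1, hR]
    refine psi_lt (fun k l => ?_) (fun k => ?_) (fun k => (hother n k (by omega)).symm) hρ
    · by_cases hk : k = i
      · subst hk
        rcases le_or_gt l m with hl | hl
        · have h1 := Below.rk_le_of_below f' hg k l
          rwa [hrk, cut, if_pos rfl, min_eq_left hl] at h1
        · have h1 : f.sub (k + 1) ≤ f'.sub (m + 1) := by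
            rw [sub_le_sub_iff, hother _ _ (by omega), hother _ _ (by omega), hnext]
          have h2 := (sub_le_sub_iff ..).mp
            ((f.sub_mono (Nat.le_succ k)).trans (h1.trans (f'.sub_mono hl)))
          rw [h2, hin, hrow l hl]
      · exact (hother k l hk).ge
    · by_cases hk : k = i
      · rw [hk, hin]
      · exact (hother k n hk).symm

end

section

variable {n d : ℕ}

/-! ### The triangularity argument -/

/-- Let V_{i₀} be the first step not contained in its counterpart, and V'_{m+1} the first step of f'
that contains it. Then V'_m can absorb V_{i₀} unless s contains some (k₀, m) with k₀ < i₀. -/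
theorem Good.sumFam_mem_of_not_le {S : Subalgebra 𝒜 (Families n d)} (hS : Good S)
    {F : Type} [Field F] (f₀ f₀' : Flag F n d) {s : Set (ℕ × ℕ)}
    (IH : ∀ ρ' s', psi n ρ' < psi n (rk f₀ f₀') → sumFam n d ρ' s' ∈ S)
    (hne : ∃ k, ¬ f₀.sub k ≤ f₀'.sub k) : sumFam n d (rk f₀ f₀') s ∈ S := by
  classical
  have htop : ∀ l, n ≤ l → ∀ k, f₀.sub k ≤ f₀'.sub l := fun l hl k => by
    rw [f₀'.sub_of_le hl]; exact le_top
  obtain ⟨i₀, hi₀, hmin⟩ : ∃ i₀, ¬ f₀.sub i₀ ≤ f₀'.sub i₀ ∧ ∀ k < i₀, f₀.sub k ≤ f₀'.sub k :=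
    ⟨Nat.find hne, Nat.find_spec hne, fun k hk => not_not.mp (Nat.find_min hne hk)⟩
  have hpos : ∀ k l, ¬ f₀.sub k ≤ f₀'.sub l → 0 < k := fun k l h => by
    refine Nat.pos_of_ne_zero fun h0 => h ?_
    rw [h0, f₀.sub_zero]
    exact bot_le
  have hin : i₀ < n := by
    by_contra h
    exact hi₀ (htop _ (not_lt.mp h) _)
  have hex : ∃ l, f₀.sub i₀ ≤ f₀'.sub l := ⟨n, htop n le_rfl _⟩
  obtain ⟨m, hm, hm', hm''⟩ : ∃ m, f₀.sub i₀ ≤ f₀'.sub (m + 1) ∧ ¬ f₀.sub i₀ ≤ f₀'.sub m ∧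
      ∀ l, f₀.sub i₀ ≤ f₀'.sub l → m < l := by
    have h0 : 0 < Nat.find hex := by
      refine Nat.pos_of_ne_zero fun h0 => hi₀ ?_
      have := Nat.find_spec hex
      rw [h0] at this
      exact this.trans (f₀'.sub_mono (Nat.zero_le _))
    refine ⟨Nat.find hex - 1, ?_, Nat.find_min hex (by omega), fun l hl => ?_⟩
    · rw [Nat.sub_add_cancel h0]
      exact Nat.find_spec hex
    · have := Nat.find_min' hex hl
      omega
  have him : i₀ ≤ m := by
    by_contra h
    exact hi₀ (hm.trans (f₀'.sub_mono (by omega)))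
  have hlt_rk : ∀ k l, ¬ f₀.sub k ≤ f₀'.sub l → rk f₀ f₀' k l < rk f₀ f₀' k n := fun k l h => by
    rw [sub_le_sub_iff] at h
    refine lt_of_le_of_ne ?_ h
    rw [rk_right f₀ f₀' le_rfl]
    exact Submodule.finrank_mono inf_le_left
  by_cases hb : ∀ k, (k, m) ∈ s → i₀ ≤ k
  · have hR := hlt_rk _ _ hm'
    refine hS.sumFam_mem_of_raise f₀ f₀' IH him ((hpos _ _ hi₀).trans_le him)
      (hm'' n (htop n le_rfl _)) (Nat.sub_pos_of_lt hR) (fun k hk => ?_) ?_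
      (Nat.add_sub_of_le hR.le) hb
    · exact (sub_le_sub_iff ..).mp (hmin k hk)
    · exact (sub_le_sub_iff ..).mp hm
  · push Not at hb
    obtain ⟨k₀, hk₀, hk₀'⟩ := hb
    -- The obstruction helps: V_{k₀} ⊆ V'_{k₀}, so w ∈ V_{k₀} + V'_m lies in V'_j whenever k₀ and m
    -- are at most j. The index j ends the run of failing inclusions that begins at i₀.
    have hex' : ∃ j, i₀ ≤ j ∧ f₀.sub (j + 1) ≤ f₀'.sub (j + 1) :=
      ⟨n - 1, by omega, htop _ (by omega) _⟩
    obtain ⟨j, hj, hj', hjn⟩ : ∃ j, (i₀ ≤ j ∧ f₀.sub (j + 1) ≤ f₀'.sub (j + 1)) ∧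
        ¬ f₀.sub j ≤ f₀'.sub j ∧ j < n := by
      refine ⟨Nat.find hex', Nat.find_spec hex', fun h => ?_, ?_⟩
      · have h1 := (Nat.find_spec hex').1
        rcases h1.eq_or_lt with h2 | h2
        · rw [← h2] at h
          exact hi₀ h
        · refine Nat.find_min hex' (m := Nat.find hex' - 1) (by omega) ⟨by omega, ?_⟩
          rwa [Nat.sub_add_cancel (by omega)]
      · have := Nat.find_min' hex' (m := n - 1) ⟨by omega, htop _ (by omega) _⟩
        omega
    have hmj : m ≤ j := Nat.lt_succ_iff.mp
      (hm'' _ ((f₀.sub_mono (show i₀ ≤ j + 1 by omega)).trans hj.2))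
    -- The first step V_i that sticks out of V'_j is cut. Its predecessor lies in V'_j, and V_{i+1}
    -- ⊆ V_{j+1} ⊆ V'_{j+1}.
    have hex'' : ∃ i, ¬ f₀.sub i ≤ f₀'.sub j := ⟨j, hj'⟩
    obtain ⟨i, hi, hi', hij⟩ : ∃ i, ¬ f₀.sub i ≤ f₀'.sub j ∧ f₀.sub (i - 1) ≤ f₀'.sub j ∧
        i ≤ j := by
      refine ⟨Nat.find hex'', Nat.find_spec hex'', ?_, Nat.find_min' hex'' hj'⟩
      have := hpos _ _ (Nat.find_spec hex'')
      exact not_not.mp (Nat.find_min hex'' (m := Nat.find hex'' - 1) (by omega))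
    have hR := hlt_rk _ _ hi
    refine hS.sumFam_mem_of_cut f₀ f₀' IH (hpos _ _ hi) hij hjn (Nat.sub_pos_of_lt hR)
      ((sub_le_sub_iff ..).mp hi') ?_ (Nat.add_sub_of_le hR.le) fun Q f f' w hρ hw => ?_
    · exact (sub_le_sub_iff ..).mp ((f₀.sub_mono (by omega)).trans hj.2)
    · have h1 : f.sub k₀ ≤ f'.sub k₀ := by
        rw [sub_le_sub_iff, hρ, ← sub_le_sub_iff]
        exact hmin k₀ hk₀'
      have h2 : k₀ ≤ j := by omega
      have h3 : f.sub k₀ ⊔ f'.sub m ≤ f'.sub j :=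
        sup_le (h1.trans (f'.sub_mono h2)) (f'.sub_mono hmj)
      exact h3 (hw (k₀, m) hk₀)

theorem rk_self {F : Type} [Field F] (f : Flag F n d) (k l : ℕ) :
    rk f f k l = dims f (min k l) := by
  rw [rk, dims, f.sub_mono.map_inf]

theorem rk_eq_rk_self_iff {F K : Type} [Field F] [Field K] (f f' : Flag F n d) (g : Flag K n d) :
    rk f f' = rk g g ↔ f = f' ∧ dims f = dims g := by
  constructor
  · intro hrk
    constructor
    · rw [eq_iff_rk]
      intro k
      rw [hrk]
      exact (eq_iff_rk g g).mp rfl k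
    · funext k
      have := congrFun (congrFun hrk k) n
      rw [rk_right f f' le_rfl, rk_right g g le_rfl] at this
      exact this
  · rintro ⟨rfl, hd⟩
    funext k l
    rw [rk_self, rk_self, hd]

theorem exists_sub_iff (n d : ℕ) (s : Set (ℕ × ℕ)) : ∃ m, ∀ {F : Type} [Field F]
    (f : Flag F n d) (w : Fin d → F),
    (∀ p ∈ s, w ∈ f.sub p.1 ⊔ f.sub p.2) ↔ w ∈ f.sub m := by
  have h : ∀ {F : Type} [Field F] (f : Flag F n d) (p : ℕ × ℕ),
      f.sub p.1 ⊔ f.sub p.2 = f.sub (max p.1 p.2) := fun f p => (f.sub_mono.map_sup _ _).symm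
  rcases s.eq_empty_or_nonempty with rfl | hs
  · exact ⟨n, fun f w => by simp [f.sub_of_le le_rfl]⟩
  · refine ⟨sInf ((fun p : ℕ × ℕ => max p.1 p.2) '' s), fun f w => ?_⟩
    simp only [h]
    constructor
    · intro hw
      obtain ⟨p, hp, hp'⟩ := Nat.sInf_mem (hs.image fun p : ℕ × ℕ => max p.1 p.2)
      rw [← hp']
      exact hw p hp
    · exact fun hw p hp => f.sub_mono (Nat.sInf_le (Set.mem_image_of_mem _ hp)) hw

/-- For equal flags V_k + V_l is the larger of the two steps, so all conditions on w reduce to one,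
w ∈ V_m. -/
theorem Good.sumFam_self_mem {S : Subalgebra 𝒜 (Families n d)} (hS : Good S)
    {F : Type} [Field F] (f₀ : Flag F n d) (s : Set (ℕ × ℕ)) : sumFam n d (rk f₀ f₀) s ∈ S := by
  classical
  obtain ⟨m, hm⟩ := exists_sub_iff n d s
  have : sumFam n d (rk f₀ f₀) s = dimFam n d (dims f₀) * vecFam n d m := by
    ext Q f f' w
    rw [sumFam_apply, dimFam_mul_apply, vecFam, ← ite_and]
    refine if_congr ?_ rfl rfl
    rw [rk_eq_rk_self_iff, and_comm (a := f = f'), and_assoc]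
    refine and_congr_right fun _ => and_congr_right fun hff => ?_
    rw [← hff]
    exact hm f w
  rw [this]
  exact S.mul_mem (hS.dim_mem _) (hS.vecFam_mem m)

/-! ### Transposition -/

/-- Exchange of the two flags. -/
def flip (g : Families n d) : Families n d := fun Q f f' w => g Q f' f w

theorem flip_mul (g h : Families n d) : flip (g * h) = flip h * flip g := by
  ext Q f f' w
  change (g * h) Q f' f w = _
  rw [fam_mul_apply, fam_mul_apply]
  refine Finset.sum_congr rfl fun f'' _ => ?_
  rw [← Equiv.sum_comp (Equiv.subLeft w)]
  refine Finset.sum_congr rfl fun u _ => ?_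
  rw [Equiv.subLeft_apply, sub_sub_cancel, mul_comm]
  rfl

theorem flip_relFam (r : ∀ Q : PrimePower, Flag Q.Fq n d → Flag Q.Fq n d → Prop) :
    flip (relFam r) = relFam fun Q f f' => r Q f' f := rfl

theorem flip_dimFam (ν : ℕ → ℕ) : flip (dimFam n d ν) = dimFam n d ν := by
  rw [dimFam, flip_relFam]
  congr
  funext Q f f'
  refine propext ⟨?_, ?_⟩ <;> rintro ⟨rfl, h⟩ <;> exact ⟨rfl, h⟩

theorem flip_vecFam (m : ℕ) : flip (vecFam n d m) = vecFam n d m := by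
  classical
  ext Q f f' w
  change vecFam n d m Q f' f w = _
  unfold vecFam
  refine if_congr ⟨?_, ?_⟩ rfl rfl <;> rintro ⟨rfl, h⟩ <;> exact ⟨rfl, h⟩

theorem flip_one : flip (1 : Families n d) = 1 := by
  rw [← vecFam_zero, flip_vecFam]

theorem flip_sumFam (ρ : ℕ → ℕ → ℕ) (s : Set (ℕ × ℕ)) :
    flip (sumFam n d (fun k l => ρ l k) (Prod.swap '' s)) = sumFam n d ρ s := by
  classical
  ext Q f f' w
  change sumFam n d _ _ Q f' f w = _
  rw [sumFam_apply, sumFam_apply]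
  refine if_congr (and_congr ⟨fun h => ?_, fun h => ?_⟩ ?_) rfl rfl
  · funext k l
    rw [← rk_swap]
    exact congrFun (congrFun h l) k
  · funext k l
    rw [← h, rk_swap]
  · rw [Set.forall_mem_image]
    exact forall₂_congr fun p _ => by rw [sup_comm]; rfl

theorem flip_mem_spanFam {g : Families n d} (hg : g ∈ spanFam n d) : flip g ∈ spanFam n d := by
  obtain ⟨P, hP⟩ := mem_spanFam_iff.mp hg
  refine mem_spanFam_iff.mpr ⟨fun ι => P (fun k l => ι.1 l k, fun k l => ι.2 l k),
    fun Q f f' w => (hP Q f' f w).trans ?_⟩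
  have : inv f' f w = (fun k l => (inv f f' w).1 l k, fun k l => (inv f f' w).2 l k) := by
    refine Prod.ext (funext fun k => funext fun l => rk_swap f f' l k)
      (funext fun k => funext fun l => ?_)
    change (w ∈ f'.sub k ⊔ f.sub l) = (w ∈ f.sub l ⊔ f'.sub k)
    rw [sup_comm]
  rw [this]

/-- The image of a subalgebra under the exchange of the flags. -/
def flipSub (S : Subalgebra 𝒜 (Families n d)) : Subalgebra 𝒜 (Families n d) where
  carrier := {g | flip g ∈ S}
  mul_mem' := fun {a b} ha hb => by
    change flip (a * b) ∈ S
    rw [flip_mul]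
    exact S.mul_mem hb ha
  add_mem' := fun {a b} ha hb => S.add_mem ha hb
  algebraMap_mem' := fun a => by
    change flip (algebraMap 𝒜 (Families n d) a) ∈ S
    rw [Algebra.algebraMap_eq_smul_one]
    change a • flip 1 ∈ S
    rw [flip_one]
    exact S.smul_mem S.one_mem a

theorem Good.flipSub {S : Subalgebra 𝒜 (Families n d)} (hS : Good S) : Good (flipSub S) where
  dim_mem ν := by
    change flip _ ∈ S
    rw [flip_dimFam]
    exact hS.dim_mem ν
  upper_mem R hi hin := hS.lower_mem R hi hin
  lower_mem R hi hin := hS.upper_mem R hi hin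
  vec_mem := by
    change flip _ ∈ S
    rw [flip_vecFam]
    exact hS.vec_mem
  mem_span g hg := flip_mem_spanFam (hS.mem_span _ hg)

/-! ### The characteristic functions of the orbits lie in every good subalgebra -/

theorem sumFam_mem_of_psi_lt (N : ℕ) : ∀ {S : Subalgebra 𝒜 (Families n d)}, Good S →
    ∀ ρ s, psi n ρ + 2 * ((n : ℤ) * (n * d)) < N → sumFam n d ρ s ∈ S := by
  classical
  induction N with
  | zero =>
    intro S _ ρ s h
    have : sumFam n d ρ s = 0 := by
      ext Q f f' w
      rw [sumFam_apply, if_neg]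
      · rfl
      rintro ⟨rfl, -⟩
      have := neg_le_psi f f'
      push_cast at h
      linarith
    rw [this]
    exact S.zero_mem
  | succ N ih =>
    intro S hS ρ s h
    -- The induction hypothesis is needed for every good subalgebra: exchanging the flags reverses
    -- products and replaces S by `flipSub S`.
    have IH : ∀ {S : Subalgebra 𝒜 (Families n d)}, Good S → ∀ ρ' s', psi n ρ' < psi n ρ →
        sumFam n d ρ' s' ∈ S := fun hS ρ' s' h' => ih hS ρ' s' (by push_cast at h; omega)
    by_cases hρ : ∃ (Q : PrimePower) (f f' : Flag Q.Fq n d), rk f f' = ρ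
    · obtain ⟨Q, f, f', rfl⟩ := hρ
      by_cases h1 : ∃ k, ¬ f.sub k ≤ f'.sub k
      · exact hS.sumFam_mem_of_not_le f f' (IH hS) h1
      · by_cases h2 : ∃ k, ¬ f'.sub k ≤ f.sub k
        · have hswap : (fun k l => rk f f' l k) = rk f' f :=
            funext fun k => funext fun l => (rk_swap f f' l k).symm
          rw [← flip_sumFam, hswap]
          refine hS.flipSub.sumFam_mem_of_not_le f' f (fun ρ' s' h' => IH hS.flipSub ρ' s' ?_) h2
          have := psi_swap (n := n) (rk f f')
          rw [hswap] at this
          rwa [this] at h'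
        · push Not at h1 h2
          obtain rfl : f = f' := Flag.ext_sub fun k => le_antisymm (h1 k) (h2 k)
          exact hS.sumFam_self_mem f s
    · have : sumFam n d ρ s = 0 := by
        ext Q f f' w
        rw [sumFam_apply, if_neg]
        · rfl
        · exact fun h => hρ ⟨Q, f, f', h.1⟩
      rw [this]
      exact S.zero_mem

theorem Good.charFamily_mem {S : Subalgebra 𝒜 (Families n d)} (hS : Good S) (x : DecMat n d) :
    charFamily x ∈ S :=
  Mirabolic.charFamily_mem x fun s => sumFam_mem_of_psi_lt
    ((psi n x.inv.1 + 2 * ((n : ℤ) * (n * d))).toNat + 1) hS _ s (by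
      push_cast
      have := Int.self_le_toNat (psi n x.inv.1 + 2 * ((n : ℤ) * (n * d)))
      omega)

end

section

variable {n d : ℕ}

/-! ### Elementary matrices and elementary families -/

theorem DecMat.isElementary_iff {R : ℕ} {i j : Fin n} {x : DecMat n d} : x.IsElementary R i j ↔
    x.Δ = ∅ ∧ ∀ a b, a ≠ b → x.A a b = if i = a ∧ j = b then R else 0 := by
  refine and_congr_right fun _ => forall₂_congr fun a b => imp_congr_right fun _ => ?_
  change (x.A a b : ℤ) - Matrix.single i j (R : ℤ) a b = 0 ↔ _
  rw [Matrix.single_apply, sub_eq_zero]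
  split_ifs <;> norm_cast

section

variable {F : Type} [Field F]

theorem Below.rk_eq {j R : ℕ} {f f' : Flag F n d} (h : Below j R f' f) (k l : ℕ) :
    rk f f' k l = if l ≤ k then dims f' l else dims f k := by
  have h1 := h.sub_le
  rw [rk, dims, dims]
  split_ifs with hkl
  · rw [inf_eq_right.mpr ((h1 l).trans (f.sub_mono hkl))]
  · rw [inf_eq_left.mpr]
    by_cases hk : k = j
    · rw [h.1 l (by omega)]
      exact f.sub_mono (by omega)
    · rw [← h.1 k hk]
      exact f'.sub_mono (by omega)

theorem Below.dims_eq {j R : ℕ} {f f' : Flag F n d} (h : Below j R f' f) (k : ℕ) :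
    dims f k = dims f' k + if k = j then R else 0 := by
  split_ifs with hk
  · rw [hk]
    exact h.2.2
  · rw [dims, dims, h.1 k hk, add_zero]

/-- For nested flags that differ in one step, the second difference of the ranks vanishes off the
diagonal except at (i, i + 1), where it is R. This identifies the matrix. -/
theorem Below.rk_succ {i R : ℕ} {f f' : Flag F n d} (h : Below (i + 1) R f' f) (a b : ℕ)
    (hab : a ≠ b) : rk f f' (a + 1) (b + 1) + rk f f' a b =
      rk f f' a (b + 1) + rk f f' (a + 1) b + if i = a ∧ i + 1 = b then R else 0 := by
  simp only [h.rk_eq, h.dims_eq]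
  rcases lt_trichotomy b (a + 1) with hb | hb | hb
  · have e1 : b + 1 ≤ a + 1 := by omega
    have e2 : b ≤ a := by omega
    have e3 : b + 1 ≤ a := by omega
    have e4 : b ≤ a + 1 := by omega
    have e5 : ¬ (i = a ∧ i + 1 = b) := by omega
    simp only [e1, e2, e3, e4, e5, if_true, if_false, add_zero]
  · subst hb
    have e1 : ¬ (a + 1 + 1 ≤ a + 1) := by omega
    have e2 : ¬ (a + 1 ≤ a) := by omega
    have e3 : ¬ (a + 1 + 1 ≤ a) := by omega
    have e5 : (i = a ∧ i + 1 = a + 1) = (a + 1 = i + 1) := by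
      refine propext ?_
      omega
    simp only [e1, e2, e3, e5, le_refl, if_true, if_false]
    omega
  · have e1 : ¬ (b + 1 ≤ a + 1) := by omega
    have e2 : ¬ (b ≤ a) := by omega
    have e3 : ¬ (b + 1 ≤ a) := by omega
    have e4 : ¬ (b ≤ a + 1) := by omega
    have e5 : ¬ (i = a ∧ i + 1 = b) := by omega
    simp only [e1, e2, e3, e4, e5, if_false]
    omega

theorem inv_snd_of_zero (f f' : Flag F n d) : (inv f f' 0).2 = fun _ _ => True :=
  funext₂ fun k l => eq_true (Submodule.zero_mem (f.sub k ⊔ f'.sub l))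

variable {x : DecMat n d} {f f' : Flag F n d} {w : Fin d → F}

theorem DecMat.eq_zero_of_inv_eq (h : Mirabolic.inv f f' w = x.inv) (hΔ : x.Δ = ∅) : w = 0 := by
  have h1 : x.inv.2 0 0 := by
    intro p hp
    rw [hΔ] at hp
    exact absurd hp (Finset.notMem_empty p)
  rw [← h] at h1
  change w ∈ f.sub 0 ⊔ f'.sub 0 at h1
  simpa [Flag.sub_zero] using h1

theorem DecMat.Δ_eq_empty_of_inv_eq (h : Mirabolic.inv f f' 0 = x.inv) : x.Δ = ∅ := by
  refine Finset.eq_empty_of_forall_notMem fun p hp => ((x.mem_Δ_iff p).mp hp).1 ?_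
  rw [← h, inv_snd_of_zero]
  trivial

theorem DecMat.entry_eq (h : Mirabolic.inv f f' w = x.inv) (a b : Fin n) :
    rk f f' (a + 1) (b + 1) + rk f f' a b =
      rk f f' a (b + 1) + rk f f' (a + 1) b + x.A a b := by
  have := x.inv_fst_succ a b
  rwa [← h] at this

theorem below_of_span {ι : Type} (b : Module.Basis ι F (Fin d → F)) (r c : ι → ℕ) (i : ℕ)
    (hf : ∀ k, f.sub k = Submodule.span F (b '' {s | r s < k}))
    (hf' : ∀ k, f'.sub k = Submodule.span F (b '' {s | c s < k}))
    (h : ∀ s, r s = c s ∨ r s = i ∧ c s = i + 1) : ∃ R, Below (i + 1) R f' f := by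
  have hle : f'.sub (i + 1) ≤ f.sub (i + 1) := by
    rw [hf, hf', b.span_image_le_iff]
    intro s hs
    have := h s
    simp only [Set.mem_ofPred_eq] at hs ⊢
    omega
  refine ⟨_, fun k hk => ?_, hle, (Nat.add_sub_of_le (Submodule.finrank_mono hle)).symm⟩
  rw [hf, hf']
  congr 2
  ext s
  have := h s
  simp only [Set.mem_ofPred_eq]
  omega

theorem DecMat.isElementary_upper_iff (h : Mirabolic.inv f f' w = x.inv) {R : ℕ} {i j : Fin n}
    (hij : (i : ℕ) + 1 = j) : x.IsElementary R i j ↔ Below j R f' f ∧ w = 0 := by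
  rw [DecMat.isElementary_iff]
  constructor
  · rintro ⟨hΔ, hA⟩
    refine ⟨?_, DecMat.eq_zero_of_inv_eq h hΔ⟩
    obtain ⟨b, hb⟩ := inOrbit_iff_adapted.mp (inOrbit_iff.mpr h)
    obtain ⟨R', hR⟩ := below_of_span b (fun s => (s.1.1 : ℕ)) (fun s => (s.1.2 : ℕ)) i hb.1 hb.2.1
      fun s => by
        by_cases hs : s.1.1 = s.1.2
        · exact Or.inl (by rw [hs])
        · by_cases hs' : i = s.1.1 ∧ j = s.1.2
          · exact Or.inr ⟨by rw [hs'.1], by rw [hij, hs'.2]⟩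
          · have h1 := hA _ _ hs
            rw [if_neg hs'] at h1
            exact absurd s.2.2 (by omega)
    have h1 := DecMat.entry_eq h i j
    rw [hR.rk_succ i j (by omega), if_pos ⟨rfl, hij⟩, hA i j (by rintro rfl; omega),
      if_pos ⟨rfl, rfl⟩] at h1
    rw [← hij, ← Nat.add_left_cancel h1]
    exact hR
  · rintro ⟨hB, rfl⟩
    refine ⟨DecMat.Δ_eq_empty_of_inv_eq h, fun a b hab => ?_⟩
    have h1 := DecMat.entry_eq h a b
    rw [← hij] at hB
    rw [hB.rk_succ a b (fun h => hab (Fin.ext h))] at h1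
    rw [← Nat.add_left_cancel h1]
    refine if_congr ?_ rfl rfl
    rw [Fin.ext_iff, Fin.ext_iff, hij]

theorem DecMat.isElementary_lower_iff (h : Mirabolic.inv f f' w = x.inv) {R : ℕ} {i j : Fin n}
    (hij : (i : ℕ) + 1 = j) : x.IsElementary R j i ↔ Below j R f f' ∧ w = 0 := by
  rw [DecMat.isElementary_iff]
  have hsw : ∀ a b, rk f f' a b = rk f' f b a := fun a b => (rk_swap f f' a b).symm
  constructor
  · rintro ⟨hΔ, hA⟩
    refine ⟨?_, DecMat.eq_zero_of_inv_eq h hΔ⟩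
    obtain ⟨b, hb⟩ := inOrbit_iff_adapted.mp (inOrbit_iff.mpr h)
    obtain ⟨R', hR⟩ := below_of_span b (fun s => (s.1.2 : ℕ)) (fun s => (s.1.1 : ℕ)) i hb.2.1 hb.1
      fun s => by
        by_cases hs : s.1.1 = s.1.2
        · exact Or.inl (by rw [hs])
        · by_cases hs' : j = s.1.1 ∧ i = s.1.2
          · exact Or.inr ⟨by rw [hs'.2], by rw [hij, hs'.1]⟩
          · have h1 := hA _ _ hs
            rw [if_neg hs'] at h1
            exact absurd s.2.2 (by omega)
    have h1 := DecMat.entry_eq h j i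
    have h2 := hR.rk_succ i j (by omega)
    simp only [hsw] at h1
    rw [h2, if_pos ⟨rfl, hij⟩, hA j i (by rintro rfl; omega), if_pos ⟨rfl, rfl⟩] at h1
    rw [← hij, show R = R' by omega]
    exact hR
  · rintro ⟨hB, rfl⟩
    refine ⟨DecMat.Δ_eq_empty_of_inv_eq h, fun a b hab => ?_⟩
    have h1 := DecMat.entry_eq h a b
    rw [← hij] at hB
    have h2 := hB.rk_succ b a (fun h => hab (Fin.ext h.symm))
    simp only [hsw] at h1
    have h3 : (if (i : ℕ) = b ∧ (i : ℕ) + 1 = a then R else 0) = if j = a ∧ i = b then R else 0 := by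
      refine if_congr ?_ rfl rfl
      rw [Fin.ext_iff, Fin.ext_iff, hij, and_comm]
    omega

theorem DecMat.isDiag_iff (h : Mirabolic.inv f f' w = x.inv) : x.A.IsDiag ↔ f = f' := by
  constructor
  · intro hA
    obtain ⟨b, hb⟩ := inOrbit_iff_adapted.mp (inOrbit_iff.mpr h)
    refine Flag.ext_sub fun k => ?_
    rw [hb.1, hb.2.1]
    congr 2
    ext s
    have : s.1.1 = s.1.2 := by
      by_contra hs
      have h1 : x.A s.1.1 s.1.2 = 0 := hA hs
      exact absurd s.2.2 (by omega)
    simp only [Set.mem_ofPred_eq, this]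
  · rintro rfl a b hab
    have h1 := DecMat.entry_eq h a b
    have h2 : (a : ℕ) ≠ b := fun h => hab (Fin.ext h)
    simp only [rk_self] at h1
    rcases lt_or_gt_of_ne h2 with h3 | h3
    · rw [min_eq_left (by omega), min_eq_left (by omega), min_eq_left (by omega),
        min_eq_left (by omega)] at h1
      omega
    · rw [min_eq_right (by omega), min_eq_right (by omega), min_eq_right (by omega),
        min_eq_right (by omega)] at h1
      omega

theorem DecMat.isDiagEmpty_iff (h : Mirabolic.inv f f' w = x.inv) :
    x.IsDiagEmpty ↔ f = f' ∧ w = 0 := by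
  rw [DecMat.IsDiagEmpty, DecMat.isDiag_iff h, and_comm]
  refine and_congr_right fun _ => ⟨DecMat.eq_zero_of_inv_eq h, ?_⟩
  rintro rfl
  exact DecMat.Δ_eq_empty_of_inv_eq h

theorem DecMat.isDiagOne_iff [NeZero n] (h : Mirabolic.inv f f' w = x.inv) :
    x.IsDiagOne ↔ f = f' ∧ w ∈ f.sub 1 ∧ w ≠ 0 := by
  rw [DecMat.IsDiagOne, DecMat.isDiag_iff h, and_comm]
  refine and_congr_right fun hff => ?_
  subst hff
  have hmem : ∀ k l, x.inv.2 k l ↔ w ∈ f.sub (max k l) := fun k l => by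
    rw [← h, show f.sub (max k l) = f.sub k ⊔ f.sub l from f.sub_mono.map_sup k l]
    rfl
  have hΔ : ∀ p, p ∈ x.Δ ↔ w ∉ f.sub (max p.1 p.2) ∧ w ∈ f.sub (max (p.1 + 1) p.2) ∧
      w ∈ f.sub (max p.1 (p.2 + 1)) := fun p => by
    rw [DecMat.mem_Δ_iff, hmem, hmem, hmem]
  constructor
  · intro hΔ'
    have := (hΔ (0, 0)).mp (by rw [hΔ']; exact Finset.mem_singleton_self _)
    refine ⟨by simpa using this.2.1, ?_⟩
    rintro rfl
    exact this.1 (Submodule.zero_mem _)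
  · rintro ⟨h1, h0⟩
    ext p
    rw [hΔ, Finset.mem_singleton]
    constructor
    · rintro ⟨h2, -, -⟩
      have : max (p.1 : ℕ) p.2 < 1 := by
        by_contra hc
        exact h2 (f.sub_mono (not_lt.mp hc) h1)
      refine Prod.ext (Fin.ext ?_) (Fin.ext ?_)
      · change (p.1 : ℕ) = 0
        omega
      · change (p.2 : ℕ) = 0
        omega
    · rintro rfl
      simpa [Flag.sub_zero] using ⟨h0, h1⟩

end

/-! ### The elementary families as sums over orbits -/

theorem eq_sum_charFamily (g : Families n d) (p : DecMat n d → Prop) [DecidablePred p]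
    (h : ∀ Q f f' w x, inv f f' w = x.inv → g Q f f' w = if p x then 1 else 0) :
    g = ∑ x with p x, charFamily x := by
  classical
  ext Q f f' w
  obtain ⟨x, hx⟩ := exists_inv_eq Q f f' w
  rw [h Q f f' w x hx, fam_sum_apply, Finset.sum_filter, Finset.sum_eq_single x]
  · rw [charFamily_apply, if_pos hx]
  · intro y _ hy
    have h0 : charFamily y Q f f' w = 0 := by
      rw [charFamily_apply]
      exact if_neg fun h' => hy (DecMat.inv_injective (h'.symm.trans hx))
    rw [h0, ite_self]
  · simp

theorem relFam_apply (r : ∀ Q : PrimePower, Flag Q.Fq n d → Flag Q.Fq n d → Prop)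
    (Q : PrimePower) (f f' : Flag Q.Fq n d) (w : Fin d → Q.Fq) [Decidable (r Q f f' ∧ w = 0)] :
    relFam r Q f f' w = if r Q f f' ∧ w = 0 then 1 else 0 := by
  unfold relFam
  congr

open Classical in
theorem upper_eq_sum (R : ℕ) {i j : Fin n} (hij : (i : ℕ) + 1 = j) :
    upper n d j R = ∑ x with x.IsElementary R i j, charFamily x :=
  eq_sum_charFamily _ _ fun _ _ _ _ _ h =>
    if_congr (DecMat.isElementary_upper_iff h hij).symm rfl rfl

open Classical in
theorem lower_eq_sum (R : ℕ) {i j : Fin n} (hij : (i : ℕ) + 1 = j) :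
    lower n d j R = ∑ x with x.IsElementary R j i, charFamily x :=
  eq_sum_charFamily _ _ fun _ _ _ _ _ h =>
    if_congr (DecMat.isElementary_lower_iff h hij).symm rfl rfl

/-- The dimensions of the steps of the first flag. -/
def DecMat.rowDims (x : DecMat n d) (k : ℕ) : ℕ := x.inv.1 k n

theorem DecMat.dims_eq_rowDims {F : Type} [Field F] {x : DecMat n d} {f f' : Flag F n d}
    {w : Fin d → F} (h : Mirabolic.inv f f' w = x.inv) : dims f = x.rowDims := by
  rw [dims_eq_inv f f' w, h]
  rfl

open Classical in
theorem dimFam_eq_sum (ν : ℕ → ℕ) :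
    dimFam n d ν = ∑ x with x.IsDiagEmpty ∧ x.rowDims = ν, charFamily x :=
  eq_sum_charFamily _ _ fun Q f f' w x h => by
    rw [DecMat.isDiagEmpty_iff h, ← DecMat.dims_eq_rowDims h, dimFam, relFam_apply]
    by_cases h1 : f = f' <;> by_cases h2 : dims f = ν <;> by_cases h3 : w = 0 <;>
      simp only [h1, h2, h3, and_true, and_false, true_and, false_and]

open Classical in
theorem one_eq_sum : (1 : Families n d) = ∑ x with x.IsDiagEmpty, charFamily x :=
  eq_sum_charFamily _ _ fun Q f f' w x h => by
    rw [fam_one_apply]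
    exact if_congr (DecMat.isDiagEmpty_iff h).symm rfl rfl

open Classical in
theorem vecFam_one_sub_one_eq_sum [NeZero n] :
    vecFam n d 1 - 1 = ∑ x with x.IsDiagOne, charFamily x :=
  eq_sum_charFamily _ _ fun Q f f' w x h => by
    rw [fam_sub_apply, fam_one_apply, DecMat.isDiagOne_iff h]
    unfold vecFam
    by_cases h1 : f = f' <;> by_cases h2 : w = 0 <;> simp [h1, h2]

/-- On the support of g the dimensions of the steps of the first flag determine the orbit. The
idempotent therefore selects one orbit. -/
theorem charFamily_eq_dimFam_mul (x : DecMat n d) (g : Families n d)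
    (h0 : ∀ Q f f' w, g Q f f' w = 0 ∨ g Q f f' w = 1)
    (h1 : ∀ Q f f' w, inv f f' w = x.inv → g Q f f' w = 1)
    (h2 : ∀ (Q : PrimePower) (f f' e e' : Flag Q.Fq n d) (w u : Fin d → Q.Fq), g Q f f' w = 1 →
      g Q e e' u = 1 → dims f = dims e → inv f f' w = inv e e' u) :
    charFamily x = dimFam n d x.rowDims * g := by
  classical
  ext Q f f' w
  obtain ⟨e, e', u, he⟩ := DecMat.exists_inv_eq Q.Fq x
  rw [charFamily_apply, dimFam_mul_apply]
  by_cases h : inv f f' w = x.inv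
  · rw [if_pos h, if_pos (DecMat.dims_eq_rowDims h), h1 Q f f' w h]
  · rw [if_neg h]
    split_ifs with hd
    · rcases h0 Q f f' w with h3 | h3
      · exact h3.symm
      · refine absurd ((h2 Q f f' e e' w u h3 (h1 Q e e' u he) ?_).trans he) h
        rw [hd, DecMat.dims_eq_rowDims he]
    · rfl

theorem relFam_eq_one_iff {r : ∀ Q : PrimePower, Flag Q.Fq n d → Flag Q.Fq n d → Prop}
    {Q : PrimePower} {f f' : Flag Q.Fq n d} {w : Fin d → Q.Fq} :
    relFam r Q f f' w = 1 ↔ r Q f f' ∧ w = 0 := by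
  classical
  unfold relFam
  split_ifs with h <;> simp [h]

theorem relFam_eq_zero_or_one (r : ∀ Q : PrimePower, Flag Q.Fq n d → Flag Q.Fq n d → Prop)
    (Q : PrimePower) (f f' : Flag Q.Fq n d) (w : Fin d → Q.Fq) :
    relFam r Q f f' w = 0 ∨ relFam r Q f f' w = 1 := by
  classical
  unfold relFam
  split_ifs <;> simp

theorem Below.inv_eq {F : Type} [Field F] {j R : ℕ} {f f' e e' : Flag F n d}
    (h : Below j R f' f) (h' : Below j R e' e) (hd : dims f = dims e) :
    inv f f' 0 = inv e e' 0 := by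
  refine Prod.ext (funext₂ fun k l => ?_) (by rw [inv_snd_of_zero, inv_snd_of_zero])
  change rk f f' k l = rk e e' k l
  have h1 : dims f' l = dims e' l := by
    have := h.dims_eq l
    have := h'.dims_eq l
    have := congrFun hd l
    omega
  rw [h.rk_eq, h'.rk_eq, hd, h1]

theorem charFamily_eq_dimFam_mul_upper {x : DecMat n d} {R : ℕ} {i j : Fin n}
    (hij : (i : ℕ) + 1 = j) (hx : x.IsElementary R i j) :
    charFamily x = dimFam n d x.rowDims * upper n d j R := by
  refine charFamily_eq_dimFam_mul x _ (relFam_eq_zero_or_one _) (fun Q f f' w h => ?_) ?_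
  · exact relFam_eq_one_iff.mpr ((DecMat.isElementary_upper_iff h hij).mp hx)
  · intro Q f f' e e' w u h1 h2 hd
    obtain ⟨hf, rfl⟩ := relFam_eq_one_iff.mp h1
    obtain ⟨he, rfl⟩ := relFam_eq_one_iff.mp h2
    exact hf.inv_eq he hd

theorem charFamily_eq_dimFam_mul_lower {x : DecMat n d} {R : ℕ} {i j : Fin n}
    (hij : (i : ℕ) + 1 = j) (hx : x.IsElementary R j i) :
    charFamily x = dimFam n d x.rowDims * lower n d j R := by
  refine charFamily_eq_dimFam_mul x _ (relFam_eq_zero_or_one _) (fun Q f f' w h => ?_) ?_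
  · exact relFam_eq_one_iff.mpr ((DecMat.isElementary_lower_iff h hij).mp hx)
  · intro Q f f' e e' w u h1 h2 hd
    obtain ⟨hf, rfl⟩ := relFam_eq_one_iff.mp h1
    obtain ⟨he, rfl⟩ := relFam_eq_one_iff.mp h2
    have hd' : dims f' = dims e' := funext fun k => by
      rw [hf.dims_eq, he.dims_eq, hd]
    refine Prod.ext (funext₂ fun k l => ?_) (by rw [inv_snd_of_zero, inv_snd_of_zero])
    have := congrFun (congrFun (congrArg Prod.fst (hf.inv_eq he hd')) l) k
    change rk f' f l k = rk e' e l k at this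
    rw [rk_swap f f', rk_swap e e'] at this
    exact this

theorem charFamily_eq_dimFam {x : DecMat n d} (hx : x.IsDiagEmpty) :
    charFamily x = dimFam n d x.rowDims := by
  rw [← mul_one (dimFam n d x.rowDims)]
  have h : (1 : Families n d) = relFam fun _ f f' => f = f' := by
    ext Q f f' w
    rw [fam_one_apply]
    rfl
  rw [h]
  refine charFamily_eq_dimFam_mul x _ (relFam_eq_zero_or_one _) (fun Q f f' w h => ?_) ?_
  · exact relFam_eq_one_iff.mpr ((DecMat.isDiagEmpty_iff h).mp hx)
  · intro Q f f' e e' w u h1 h2 hd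
    obtain ⟨rfl, rfl⟩ := relFam_eq_one_iff.mp h1
    obtain ⟨rfl, rfl⟩ := relFam_eq_one_iff.mp h2
    refine Prod.ext (funext₂ fun k l => ?_) (by rw [inv_snd_of_zero, inv_snd_of_zero])
    change rk f f k l = rk e e k l
    rw [rk_self, rk_self, hd]

theorem charFamily_eq_dimFam_mul_vecFam [NeZero n] {x : DecMat n d} (hx : x.IsDiagOne) :
    charFamily x = dimFam n d x.rowDims * (vecFam n d 1 - 1) := by
  classical
  have h : ∀ (Q : PrimePower) (f f' : Flag Q.Fq n d) (w : Fin d → Q.Fq),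
      (vecFam n d 1 - 1) Q f f' w = if f = f' ∧ w ∈ f.sub 1 ∧ w ≠ 0 then 1 else 0 :=
    fun Q f f' w => by
      rw [fam_sub_apply, fam_one_apply]
      unfold vecFam
      by_cases h1 : f = f' <;> by_cases h2 : w = 0 <;> simp [h1, h2]
  refine charFamily_eq_dimFam_mul x _ (fun Q f f' w => ?_) (fun Q f f' w h' => ?_) ?_
  · rw [h]
    split_ifs <;> simp
  · rw [h, if_pos ((DecMat.isDiagOne_iff h').mp hx)]
  · intro Q f f' e e' w u h1 h2 hd
    rw [h] at h1 h2
    obtain ⟨rfl, hw, hw0⟩ := (ite_eq_left_iff.mp h1 |> fun h => by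
      by_contra hc
      exact zero_ne_one (h hc) : f = f' ∧ w ∈ f.sub 1 ∧ w ≠ 0)
    obtain ⟨rfl, hu, hu0⟩ := (ite_eq_left_iff.mp h2 |> fun h => by
      by_contra hc
      exact zero_ne_one (h hc) : e = e' ∧ u ∈ e.sub 1 ∧ u ≠ 0)
    have hmem : ∀ {g : Flag Q.Fq n d} {v : Fin d → Q.Fq}, v ∈ g.sub 1 → v ≠ 0 → ∀ k l,
        v ∈ g.sub k ⊔ g.sub l ↔ 1 ≤ max k l := fun {g v} hv hv0 k l => by
      rw [← show g.sub (max k l) = g.sub k ⊔ g.sub l from g.sub_mono.map_sup k l]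
      constructor
      · intro h
        by_contra hc
        rw [show max k l = 0 by omega, g.sub_zero] at h
        exact hv0 ((Submodule.mem_bot _).mp h)
      · exact fun h => g.sub_mono h hv
    refine Prod.ext (funext₂ fun k l => ?_) (funext₂ fun k l => propext ?_)
    · change rk f f k l = rk e e k l
      rw [rk_self, rk_self, hd]
    · exact (hmem hw hw0 k l).trans (hmem hu hu0 k l).symm

end

section

variable {n d : ℕ}

theorem exists_fin_pred {i : ℕ} (hi : 0 < i) (hin : i < n) :
    ∃ a b : Fin n, (a : ℕ) + 1 = b ∧ (b : ℕ) = i :=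
  ⟨⟨i - 1, by omega⟩, ⟨i, hin⟩, Nat.sub_add_cancel hi, rfl⟩

theorem vpow_smul_br (x : DecMat n d) :
    vpow ((x.orbitDim : ℤ) - x.imageDim) • br x = e x := by
  rw [br, smul_smul, ← LaurentPolynomial.T_add]
  simp

variable [NeZero n]

/-! ### Generators over `ℤ[v, v⁻¹]` -/

/-- The decorated matrices of the generators with multiplicities in `S`. -/
def DecMat.IsGen (S : Set ℕ) (x : DecMat n d) : Prop :=
  (∃ R ∈ S, ∃ i j : Fin n, (i : ℕ) + 1 = j ∧ (x.IsElementary R i j ∨ x.IsElementary R j i)) ∨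
    x.IsDiagEmpty ∨ x.IsDiagOne

/-- The subalgebra generated by the characteristic functions of the generators. -/
def genFam (n d : ℕ) [NeZero n] : Subalgebra 𝒜 (Families n d) :=
  Algebra.adjoin 𝒜 (charFamily '' {x | x.IsGen Set.univ})

theorem charFamily_mem_genFam {x : DecMat n d} (hx : x.IsGen Set.univ) :
    charFamily x ∈ genFam n d := Algebra.subset_adjoin ⟨x, hx, rfl⟩

theorem genFam_le_stabFam : genFam n d ≤ stabFam n d := by
  refine Algebra.adjoin_le ?_
  rintro _ ⟨x, ⟨R, -, i, j, hij, hx | hx⟩ | hx | hx, rfl⟩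
  · rw [charFamily_eq_dimFam_mul_upper hij hx]
    exact (stabFam n d).mul_mem (dimFam_mem_stabFam _) (upper_mem_stabFam (by omega) j.2 R)
  · rw [charFamily_eq_dimFam_mul_lower hij hx]
    exact (stabFam n d).mul_mem (dimFam_mem_stabFam _) (lower_mem_stabFam (by omega) j.2 R)
  · rw [charFamily_eq_dimFam hx]
    exact dimFam_mem_stabFam _
  · rw [charFamily_eq_dimFam_mul_vecFam hx]
    exact (stabFam n d).mul_mem (dimFam_mem_stabFam _)
      ((stabFam n d).sub_mem vecFam_one_mem_stabFam (stabFam n d).one_mem)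

theorem good_genFam : Good (genFam n d) where
  dim_mem ν := by
    classical
    rw [dimFam_eq_sum]
    exact sum_mem fun x hx =>
      charFamily_mem_genFam (Or.inr (Or.inl (Finset.mem_filter.mp hx).2.1))
  upper_mem R hi hin := by
    classical
    obtain ⟨a, b, hab, rfl⟩ := exists_fin_pred hi hin
    rw [upper_eq_sum R hab]
    exact sum_mem fun x hx => charFamily_mem_genFam
      (Or.inl ⟨R, trivial, a, b, hab, Or.inl (Finset.mem_filter.mp hx).2⟩)
  lower_mem R hi hin := by
    classical
    obtain ⟨a, b, hab, rfl⟩ := exists_fin_pred hi hin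
    rw [lower_eq_sum R hab]
    exact sum_mem fun x hx => charFamily_mem_genFam
      (Or.inl ⟨R, trivial, a, b, hab, Or.inr (Finset.mem_filter.mp hx).2⟩)
  vec_mem := by
    classical
    rw [← sub_add_cancel (vecFam n d 1) 1, vecFam_one_sub_one_eq_sum]
    exact (genFam n d).add_mem (sum_mem fun x hx =>
      charFamily_mem_genFam (Or.inr (Or.inr (Finset.mem_filter.mp hx).2))) (genFam n d).one_mem
  mem_span := le_spanFam_of_le_stabFam genFam_le_stabFam

theorem MS_le_genFam : MS n d ≤ genFam n d := by
  refine Algebra.adjoin_le ?_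
  rintro _ ⟨x, rfl⟩
  exact good_genFam.charFamily_mem x

/-- The algebra is contained in the subalgebra of the generators, and that one in the span of the
orbits. -/
theorem span_range_e_eq_top : Submodule.span 𝒜 (Set.range (e (n := n) (d := d))) = ⊤ := by
  refine Submodule.map_injective_of_injective (f := (MS n d).val.toLinearMap)
    Subtype.val_injective ?_
  rw [Submodule.map_span, ← Set.range_comp]
  refine le_antisymm ?_ ?_
  · rw [Set.range_comp, ← Submodule.map_span]
    exact Submodule.map_mono le_top
  · rintro _ ⟨y, -, rfl⟩
    exact good_genFam.mem_span _ (MS_le_genFam y.2)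

theorem mem_gens_iff {S : Set ℕ} {y : MS n d} :
    y ∈ gens n d S ↔ ∃ x : DecMat n d, br x = y ∧ x.IsGen S := Iff.rfl

theorem adjoin_gens_eq_top : Algebra.adjoin 𝒜 (gens n d Set.univ) = ⊤ := by
  refine Subalgebra.map_injective (f := (MS n d).val) Subtype.val_injective ?_
  rw [AlgHom.map_adjoin, Algebra.map_top, Subalgebra.range_val]
  refine le_antisymm (Algebra.adjoin_le ?_) (MS_le_genFam.trans (Algebra.adjoin_le ?_))
  · rintro _ ⟨y, -, rfl⟩
    exact y.2
  · rintro _ ⟨x, hx, rfl⟩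
    have h : charFamily x = vpow ((x.orbitDim : ℤ) - x.imageDim) • (MS n d).val (br x) := by
      rw [← map_smul, vpow_smul_br]
      rfl
    rw [h]
    exact Subalgebra.smul_mem _ (Algebra.subset_adjoin
      (Set.mem_image_of_mem _ (mem_gens_iff.mpr ⟨x, rfl, hx⟩))) _

end

section

variable {n d : ℕ}

/-! ### Extension of scalars -/

/-- The elements of the generic algebra that lie in a given subalgebra after extension of
scalars. -/
def contraction (T : Subalgebra Qv (MSQ n d)) : Subalgebra 𝒜 (MS n d) :=
  (T.restrictScalars 𝒜).comap (Algebra.TensorProduct.includeRight : MS n d →ₐ[𝒜] MSQ n d)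

theorem mem_contraction {T : Subalgebra Qv (MSQ n d)} {y : MS n d} :
    y ∈ contraction T ↔ toQ y ∈ T := Iff.rfl

theorem toQ_smul (a : 𝒜) (y : MS n d) : toQ (a • y) = algebraMap 𝒜 Qv a • toQ y := by
  rw [toQ, toQ, TensorProduct.tmul_smul, ← algebraMap_smul Qv a]

/-- Nonzero scalars of 𝒜 become invertible in ℚ(v). This is how quantum integers and powers of v are
divided out without leaving the integral form. -/
theorem mem_contraction_of_smul_mem {T : Subalgebra Qv (MSQ n d)} {a : 𝒜} (ha : a ≠ 0)
    {y : MS n d} (h : a • y ∈ contraction T) : y ∈ contraction T := by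
  rw [mem_contraction] at h ⊢
  have ha' : algebraMap 𝒜 Qv a ≠ 0 :=
    (map_ne_zero_iff _ (IsFractionRing.injective 𝒜 Qv)).mpr ha
  rw [toQ_smul] at h
  have := T.smul_mem h (algebraMap 𝒜 Qv a)⁻¹
  rwa [smul_smul, inv_mul_cancel₀ ha', one_smul] at this

theorem eq_top_of_contraction {T : Subalgebra Qv (MSQ n d)} (h : contraction T = ⊤) : T = ⊤ := by
  refine eq_top_iff.mpr fun z _ => ?_
  induction z using TensorProduct.induction_on with
  | zero => exact T.zero_mem
  | tmul c y =>
    have h1 : toQ y ∈ T := mem_contraction.mp (h ▸ Algebra.mem_top)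
    have := T.smul_mem h1 c
    rwa [toQ, TensorProduct.smul_tmul', smul_eq_mul, mul_one] at this
  | add a b ha hb => exact T.add_mem (ha Algebra.mem_top) (hb Algebra.mem_top)

theorem vpow_ne_zero (k : ℤ) : vpow k ≠ 0 := fun h => by
  have h1 : vpow k * vpow (-k) = 1 := by rw [← LaurentPolynomial.T_add]; simp
  rw [h, zero_mul] at h1
  exact zero_ne_one h1

theorem e_mem_of_br_mem {U : Subalgebra 𝒜 (MS n d)} {x : DecMat n d} (h : br x ∈ U) : e x ∈ U := by
  rw [← vpow_smul_br]
  exact U.smul_mem h _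

/-! ### Elementary elements of the generic algebra -/

open Classical in
/-- The idempotent of the flags with given dimensions of the steps. -/
def dimElt (n d : ℕ) (ν : ℕ → ℕ) : MS n d :=
  ∑ x with x.IsDiagEmpty ∧ x.rowDims = ν, e x

open Classical in
/-- The sum of the `e_{A,∅}` with `A - R E_{ij}` diagonal. -/
def elemElt (n d R : ℕ) (i j : Fin n) : MS n d := ∑ x with x.IsElementary R i j, e x

theorem coe_dimElt (ν : ℕ → ℕ) : (dimElt n d ν : Families n d) = dimFam n d ν := by
  classical
  rw [dimFam_eq_sum, dimElt, AddSubmonoidClass.coe_finsetSum]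
  rfl

theorem coe_elemElt_upper (R : ℕ) {i j : Fin n} (hij : (i : ℕ) + 1 = j) :
    (elemElt n d R i j : Families n d) = upper n d j R := by
  classical
  rw [upper_eq_sum R hij, elemElt, AddSubmonoidClass.coe_finsetSum]
  rfl

theorem coe_elemElt_lower (R : ℕ) {i j : Fin n} (hij : (i : ℕ) + 1 = j) :
    (elemElt n d R j i : Families n d) = lower n d j R := by
  classical
  rw [lower_eq_sum R hij, elemElt, AddSubmonoidClass.coe_finsetSum]
  rfl

theorem dimElt_mem {U : Subalgebra 𝒜 (MS n d)} (h : ∀ x : DecMat n d, x.IsDiagEmpty → e x ∈ U)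
    (ν : ℕ → ℕ) : dimElt n d ν ∈ U := by
  classical
  exact sum_mem fun x hx => h x (Finset.mem_filter.mp hx).2.1

theorem charFamily_injective : Function.Injective (charFamily (n := n) (d := d)) := by
  classical
  intro x y hxy
  let Q : PrimePower := ⟨2, 1, ⟨Nat.prime_two⟩, one_pos⟩
  obtain ⟨f, f', w, h⟩ := DecMat.exists_inv_eq Q.Fq x
  have h1 : charFamily x Q f f' w = 1 := by rw [charFamily_apply, if_pos h]
  rw [hxy, charFamily_apply] at h1
  refine DecMat.inv_injective (h.symm.trans ?_)
  by_contra hc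
  rw [if_neg hc] at h1
  exact zero_ne_one h1

theorem dimFam_mul_dimFam (ν ν' : ℕ → ℕ) [Decidable (ν' = ν)] :
    dimFam n d ν * dimFam n d ν' = if ν' = ν then dimFam n d ν else 0 := by
  classical
  ext Q f f' w
  rw [dimFam_mul_apply]
  have h : ∀ μ, dimFam n d μ Q f f' w = if (f = f' ∧ dims f = μ) ∧ w = 0 then 1 else 0 :=
    fun μ => relFam_apply ..
  split_ifs with h1 h2 h2
  · rw [h2]
  · rw [h, if_neg, fam_zero_apply]
    exact fun h3 => h2 (h3.1.2.symm.trans h1)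
  · rw [h, if_neg]
    exact fun h3 => h1 h3.1.2
  · rfl

open Classical in
/-- The idempotents select one matrix from a family of elementary matrices. -/
theorem dimElt_mul_sum {p : DecMat n d → Prop} {g : Families n d}
    (hg : ∀ x, p x → charFamily x = dimFam n d x.rowDims * g) (c : DecMat n d → 𝒜)
    {x : DecMat n d} (hx : p x) : dimElt n d x.rowDims * ∑ y with p y, c y • e y = c x • e x := by
  rw [Finset.mul_sum, Finset.sum_eq_single_of_mem x (Finset.mem_filter.mpr ⟨Finset.mem_univ x, hx⟩)]
  · rw [mul_smul_comm]
    congr 1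
    refine Subtype.ext ?_
    change (dimElt n d _ : Families n d) * charFamily x = charFamily x
    rw [coe_dimElt, hg x hx, ← mul_assoc, dimFam_mul_dimFam, if_pos rfl]
  · intro y hy hyx
    have hy := (Finset.mem_filter.mp hy).2
    rw [mul_smul_comm]
    convert smul_zero _
    refine Subtype.ext ?_
    change (dimElt n d _ : Families n d) * charFamily y = 0
    rw [coe_dimElt, hg y hy, ← mul_assoc, dimFam_mul_dimFam, if_neg, zero_mul]
    intro h
    exact hyx (charFamily_injective (by rw [hg x hx, hg y hy, h]))

/-! ### Multiplicity one suffices over the field of fractions -/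

/-- The quantum integer `1 + v² + ⋯ + v^{2R}`. -/
def quantumInt (R : ℕ) : 𝒜 := ∑ k ∈ Finset.range (R + 1), vpow (2 * (k : ℤ))

theorem spec_quantumInt (Q : PrimePower) (R : ℕ) :
    Q.spec (quantumInt R) = ((∑ k ∈ Finset.range (R + 1), (Q.q : ℤ) ^ k : ℤ) : ℝ) := by
  rw [quantumInt, map_sum]
  push_cast
  exact Finset.sum_congr rfl fun k _ => by rw [spec_vpow_two_mul, zpow_natCast]

theorem quantumInt_ne_zero (R : ℕ) : quantumInt R ≠ 0 := fun h => by
  let Q : PrimePower := ⟨2, 1, ⟨Nat.prime_two⟩, one_pos⟩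
  have h1 := spec_quantumInt Q R
  have h2 : (0 : ℤ) < ∑ k ∈ Finset.range (R + 1), (Q.q : ℤ) ^ k :=
    Finset.sum_pos (fun k _ => pow_pos (by exact_mod_cast (zero_lt_one.trans Q.one_lt_q)) _) (by simp)
  rw [h, map_zero] at h1
  have h3 : (∑ k ∈ Finset.range (R + 1), (Q.q : ℤ) ^ k) = 0 := by exact_mod_cast h1.symm
  omega

theorem upper_zero (i : ℕ) : upper n d i 0 = 1 := by
  classical
  ext Q f f' w
  rw [fam_one_apply, upper, relFam_apply]
  refine if_congr ?_ rfl rfl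
  rw [Below.zero_iff, eq_comm]

theorem lower_zero (i : ℕ) : lower n d i 0 = 1 := by
  classical
  ext Q f f' w
  rw [fam_one_apply, lower, relFam_apply]
  exact if_congr (by rw [Below.zero_iff]) rfl rfl

theorem upper_mul_upper_one {i : ℕ} (hi : 0 < i) (hin : i < n) (R : ℕ) :
    upper n d i R * upper n d i 1 = quantumInt R • upper n d i (R + 1) := by
  classical
  ext Q f f' w
  have h : ∀ (S : ℕ) (f : Flag Q.Fq n d), upper n d i S Q f f' w =
      ((∑ g with Below i S g f, if g = f' ∧ w = 0 then 1 else 0 : ℤ) : ℝ) := fun S f => by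
    rw [upper, relFam_apply, Finset.sum_filter, Finset.sum_eq_single f']
    · by_cases h1 : Below i S f' f <;> by_cases h2 : w = 0 <;> simp [h1, h2]
    · intro g _ hg
      simp [hg]
    · simp
  rw [fam_smul_apply, h, spec_quantumInt, ← Int.cast_mul, ← sum_above_above Q hi hin, upper,
    relFam_mul_apply, Int.cast_sum]
  exact Finset.sum_congr rfl fun g _ => h 1 g

theorem lower_one_mul_lower {i : ℕ} (hi : 0 < i) (hin : i < n) (R : ℕ) :
    lower n d i 1 * lower n d i R = quantumInt R • lower n d i (R + 1) := by
  classical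
  ext Q f f' w
  have h : ∀ (S : ℕ) (f : Flag Q.Fq n d), lower n d i S Q f f' w =
      ((∑ g with Below i S f g, if g = f' ∧ w = 0 then 1 else 0 : ℤ) : ℝ) := fun S f => by
    rw [lower, relFam_apply, Finset.sum_filter, Finset.sum_eq_single f']
    · by_cases h1 : Below i S f f' <;> by_cases h2 : w = 0 <;> simp [h1, h2]
    · intro g _ hg
      simp [hg]
    · simp
  rw [fam_smul_apply, h, spec_quantumInt, ← Int.cast_mul, ← sum_below_below Q hi hin, lower,
    relFam_mul_apply, Int.cast_sum]
  exact Finset.sum_congr rfl fun g _ => h R g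

theorem elemElt_mem {T : Subalgebra Qv (MSQ n d)} {i j : Fin n} (hij : (i : ℕ) + 1 = j)
    (h1 : elemElt n d 1 i j ∈ contraction T) (h2 : elemElt n d 1 j i ∈ contraction T) (R : ℕ) :
    elemElt n d R i j ∈ contraction T ∧ elemElt n d R j i ∈ contraction T := by
  induction R with
  | zero =>
    have e1 : elemElt n d 0 i j = 1 := Subtype.ext ((coe_elemElt_upper 0 hij).trans (upper_zero _))
    have e2 : elemElt n d 0 j i = 1 := Subtype.ext ((coe_elemElt_lower 0 hij).trans (lower_zero _))
    rw [e1, e2]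
    exact ⟨Subalgebra.one_mem _, Subalgebra.one_mem _⟩
  | succ R ih =>
    have e1 : elemElt n d R i j * elemElt n d 1 i j = quantumInt R • elemElt n d (R + 1) i j := by
      refine Subtype.ext ?_
      change (elemElt n d R i j : Families n d) * (elemElt n d 1 i j : Families n d) =
        quantumInt R • (elemElt n d (R + 1) i j : Families n d)
      simp only [coe_elemElt_upper _ hij]
      exact upper_mul_upper_one (by omega) j.2 R
    have e2 : elemElt n d 1 j i * elemElt n d R j i = quantumInt R • elemElt n d (R + 1) j i := by
      refine Subtype.ext ?_
      change (elemElt n d 1 j i : Families n d) * (elemElt n d R j i : Families n d) =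
        quantumInt R • (elemElt n d (R + 1) j i : Families n d)
      simp only [coe_elemElt_lower _ hij]
      exact lower_one_mul_lower (by omega) j.2 R
    exact ⟨mem_contraction_of_smul_mem (quantumInt_ne_zero R) (e1 ▸ Subalgebra.mul_mem _ ih.1 h1),
      mem_contraction_of_smul_mem (quantumInt_ne_zero R) (e2 ▸ Subalgebra.mul_mem _ h2 ih.2)⟩

/-- Sums of the single-step generators give, by `elemElt_mem`, the sums for every R; the diagonal
idempotents then isolate the individual matrices, which generate over 𝒜. -/
theorem eq_top_of_gens [NeZero n] {T : Subalgebra Qv (MSQ n d)}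
    (h : ∀ x : DecMat n d, x.IsGen {1} → e x ∈ contraction T) : T = ⊤ := by
  classical
  refine eq_top_of_contraction (eq_top_iff.mpr ?_)
  rw [← adjoin_gens_eq_top]
  refine Algebra.adjoin_le ?_
  rintro _ ⟨x, rfl, hx⟩
  have hdim := dimElt_mem (U := contraction T) fun x hx => h x (Or.inr (Or.inl hx))
  refine Subalgebra.smul_mem _ ?_ _
  rcases hx with ⟨R, -, i, j, hij, hx⟩ | hx
  · have h1 : elemElt n d 1 i j ∈ contraction T := sum_mem fun y hy =>
      h y (Or.inl ⟨1, rfl, i, j, hij, Or.inl (Finset.mem_filter.mp hy).2⟩)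
    have h2 : elemElt n d 1 j i ∈ contraction T := sum_mem fun y hy =>
      h y (Or.inl ⟨1, rfl, i, j, hij, Or.inr (Finset.mem_filter.mp hy).2⟩)
    obtain ⟨h3, h4⟩ := elemElt_mem hij h1 h2 R
    rcases hx with hx | hx
    · have : e x = dimElt n d x.rowDims * elemElt n d R i j := by
        refine Subtype.ext ?_
        change charFamily x = (dimElt n d _ : Families n d) * (elemElt n d R i j : Families n d)
        rw [coe_dimElt, coe_elemElt_upper R hij, ← charFamily_eq_dimFam_mul_upper hij hx]
      rw [this]
      exact Subalgebra.mul_mem _ (hdim _) h3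
    · have : e x = dimElt n d x.rowDims * elemElt n d R j i := by
        refine Subtype.ext ?_
        change charFamily x = (dimElt n d _ : Families n d) * (elemElt n d R j i : Families n d)
        rw [coe_dimElt, coe_elemElt_lower R hij, ← charFamily_eq_dimFam_mul_lower hij hx]
      rw [this]
      exact Subalgebra.mul_mem _ (hdim _) h4
  · exact h x (Or.inr hx)

theorem adjoin_gens_one_eq_top [NeZero n] :
    Algebra.adjoin Qv (toQ '' gens n d {1}) = ⊤ :=
  eq_top_of_gens fun x hx => e_mem_of_br_mem
    (Algebra.subset_adjoin (Set.mem_image_of_mem _ (mem_gens_iff.mpr ⟨x, rfl, hx⟩)))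

/-! ### The quantum generators -/

/-- For a diagonal matrix only i = j and k = l contribute, so both dimensions are the same sum and
no power of v appears. -/
theorem DecMat.IsDiagEmpty.br_eq {x : DecMat n d} (hx : x.IsDiagEmpty) : br x = e x := by
  have h : x.orbitDim = x.imageDim := by
    classical
    rw [orbitDim, imageDim]
    have h0 : (∑ i, ∑ j, if ∃ p ∈ x.Δ, i ≤ p.1 ∧ j ≤ p.2 then x.A i j else 0) = 0 := by
      rw [hx.1]
      simp
    refine (congrArg₂ (· + ·) ?_ h0).trans (add_zero _)
    refine Finset.sum_congr rfl fun i _ => Finset.sum_congr rfl fun j _ =>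
      Finset.sum_congr rfl fun k _ => Finset.sum_congr rfl fun l _ => ?_
    by_cases hij : i = j
    · by_cases hkl : k = l
      · subst hij hkl
        simp
      · have : x.A k l = 0 := hx.2 hkl
        simp [this]
    · have : x.A i j = 0 := hx.2 hij
      simp [this]
  rw [br, h, neg_add_cancel, show vpow 0 = 1 from LaurentPolynomial.T_zero, one_smul]

theorem toQ_mul (y z : MS n d) : toQ (y * z) = toQ y * toQ z :=
  map_mul (Algebra.TensorProduct.includeRight : MS n d →ₐ[𝒜] MSQ n d) y z

theorem toQ_sum {ι : Type*} (s : Finset ι) (y : ι → MS n d) :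
    toQ (∑ i ∈ s, y i) = ∑ i ∈ s, toQ (y i) :=
  map_sum (Algebra.TensorProduct.includeRight : MS n d →ₐ[𝒜] MSQ n d) y s

open Classical in
/-- The diagonal elements, as functions on the diagonal matrices. -/
def diagHom (n d : ℕ) : (DecMat n d → Qv) →ₐ[Qv] MSQ n d :=
  AlgHom.ofLinearMap
    { toFun := fun φ => ∑ x with x.IsDiagEmpty, φ x • toQ (e x)
      map_add' := fun φ ψ => by simp only [Pi.add_apply, add_smul, Finset.sum_add_distrib]
      map_smul' := fun c φ => by
        simp only [Pi.smul_apply, smul_eq_mul, mul_smul, Finset.smul_sum, RingHom.id_apply] }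
    (by
      change ∑ x with x.IsDiagEmpty, (1 : Qv) • toQ (e x) = 1
      simp only [one_smul]
      rw [← toQ_sum]
      have : (∑ x : DecMat n d with x.IsDiagEmpty, e x) = 1 := by
        refine Subtype.ext ?_
        rw [AddSubmonoidClass.coe_finsetSum]
        exact one_eq_sum.symm
      rw [this]
      rfl)
    (by
      intro φ ψ
      change ∑ x with x.IsDiagEmpty, (φ x * ψ x) • toQ (e x) =
        (∑ x with x.IsDiagEmpty, φ x • toQ (e x)) * ∑ x with x.IsDiagEmpty, ψ x • toQ (e x)
      rw [Finset.sum_mul_sum]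
      refine Finset.sum_congr rfl fun x hx => ?_
      have hx' := (Finset.mem_filter.mp hx).2
      have he : ∀ y ∈ Finset.univ.filter (fun y : DecMat n d => y.IsDiagEmpty),
          e x * e y = if y = x then e x else 0 := fun y hy => by
        have hy' := (Finset.mem_filter.mp hy).2
        refine Subtype.ext ?_
        change charFamily x * charFamily y = _
        rw [charFamily_eq_dimFam hx', charFamily_eq_dimFam hy', dimFam_mul_dimFam]
        have : y.rowDims = x.rowDims ↔ y = x := ⟨fun h => charFamily_injective (by
          rw [charFamily_eq_dimFam hx', charFamily_eq_dimFam hy', h]), fun h => by rw [h]⟩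
        rw [if_congr this rfl rfl]
        split_ifs
        · exact (charFamily_eq_dimFam hx').symm
        · rfl
      rw [Finset.sum_eq_single_of_mem x hx]
      · rw [smul_mul_smul_comm, ← toQ_mul, he x hx, if_pos rfl]
      · intro y hy hyx
        rw [smul_mul_smul_comm, ← toQ_mul, he y hy, if_neg hyx]
        have : toQ (0 : MS n d) = 0 := TensorProduct.tmul_zero _ _
        rw [this, smul_zero])

open Classical in
theorem diagHom_apply (φ : DecMat n d → Qv) :
    diagHom n d φ = ∑ x with x.IsDiagEmpty, φ x • toQ (e x) := rfl

theorem DecMat.IsDiagEmpty.ext {x y : DecMat n d} (hx : x.IsDiagEmpty) (hy : y.IsDiagEmpty)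
    (h : ∀ a, x.A a a = y.A a a) : x = y := by
  refine DecMat.ext ?_ (hx.1.trans hy.1.symm)
  funext i j
  by_cases hij : i = j
  · rw [hij, h]
  · rw [show x.A i j = 0 from hx.2 hij, show y.A i j = 0 from hy.2 hij]

/-- The function on the diagonal matrices that gives the Cartan element. -/
def cartanFun (n d : ℕ) (a : Fin n) (x : DecMat n d) : Qv :=
  algebraMap 𝒜 Qv (vpow (-((1 : ℤˣ) : ℤ) * x.A a a))

theorem diagHom_cartanFun (a : Fin n) : diagHom n d (cartanFun n d a) = toQ (cartan n d 1 a) := by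
  classical
  rw [diagHom_apply, cartan, toQ_sum]
  refine Finset.sum_congr rfl fun x hx => ?_
  rw [toQ_smul, (Finset.mem_filter.mp hx).2.br_eq, cartanFun]

theorem cartanFun_inj {a : Fin n} {x y : DecMat n d} (h : cartanFun n d a x = cartanFun n d a y) :
    x.A a a = y.A a a := by
  let Q : PrimePower := ⟨2, 1, ⟨Nat.prime_two⟩, one_pos⟩
  have h1 := congrArg Q.spec (IsFractionRing.injective 𝒜 Qv h)
  rw [spec_vpow, spec_vpow] at h1
  have hq : (1 : ℝ) < Real.sqrt Q.q := by
    rw [Real.lt_sqrt zero_le_one, one_pow]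
    exact_mod_cast Q.one_lt_q
  have h2 := zpow_right_injective₀ (zero_lt_one.trans hq) hq.ne' h1
  simpa using h2

/-- Lagrange interpolation: for each other diagonal matrix y some H_a takes different values at x
and y. Subtracting its value at y and multiplying over all y leaves a nonzero multiple of the
idempotent of x. -/
theorem toQ_e_mem_of_cartan {T : Subalgebra Qv (MSQ n d)} (hT : ∀ a, toQ (cartan n d 1 a) ∈ T)
    {x : DecMat n d} (hx : x.IsDiagEmpty) : toQ (e x) ∈ T := by
  classical
  have hsep : ∀ y : DecMat n d, ∃ φ : DecMat n d → Qv, φ ∈ T.comap (diagHom n d) ∧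
      φ x ≠ 0 ∧ (y.IsDiagEmpty → y ≠ x → φ y = 0) := fun y => by
    by_cases hy : y.IsDiagEmpty ∧ y ≠ x
    · obtain ⟨a, ha⟩ : ∃ a, x.A a a ≠ y.A a a := by
        by_contra! hc
        exact hy.2 (hx.ext hy.1 hc).symm
      refine ⟨cartanFun n d a - algebraMap Qv _ (cartanFun n d a y), ?_, ?_, fun _ _ => ?_⟩
      · refine Subalgebra.sub_mem _ ?_ (Subalgebra.algebraMap_mem _ _)
        rw [Subalgebra.mem_comap, diagHom_cartanFun]
        exact hT a
      · exact fun h => ha (cartanFun_inj (sub_eq_zero.mp h))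
      · exact sub_self _
    · exact ⟨1, Subalgebra.one_mem _, one_ne_zero, fun h1 h2 => absurd ⟨h1, h2⟩ hy⟩
  choose φ hφ hφx hφy using hsep
  have hmem : ∏ y, φ y ∈ T.comap (diagHom n d) := Subalgebra.prod_mem _ fun y _ => hφ y
  rw [Subalgebra.mem_comap, diagHom_apply, Finset.sum_eq_single_of_mem x
    (Finset.mem_filter.mpr ⟨Finset.mem_univ x, hx⟩)] at hmem
  · have h0 : (∏ y, φ y) x ≠ 0 := by
      rw [Finset.prod_apply]
      exact Finset.prod_ne_zero_iff.mpr fun y _ => hφx y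
    have := T.smul_mem hmem ((∏ y, φ y) x)⁻¹
    rwa [smul_smul, inv_mul_cancel₀ h0, one_smul] at this
  · intro y hy hyx
    have h0 : ∏ c, φ c y = 0 :=
      Finset.prod_eq_zero (Finset.mem_univ y) (hφy y (Finset.mem_filter.mp hy).2 hyx)
    rw [Finset.prod_apply, h0, zero_smul]

theorem smul_br (a : 𝒜) (x : DecMat n d) :
    a • br x = (a * vpow (-(x.orbitDim : ℤ) + x.imageDim)) • e x := by
  rw [br, smul_smul]

theorem adjoin_quantumGens_eq_top [NeZero n] :
    Algebra.adjoin Qv (toQ '' quantumGens n d) = ⊤ := by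
  classical
  set T := Algebra.adjoin Qv (toQ '' quantumGens n d) with hT
  have hgen : ∀ y ∈ quantumGens n d, y ∈ contraction T := fun y hy =>
    mem_contraction.mpr (Algebra.subset_adjoin (Set.mem_image_of_mem _ hy))
  have hdiag : ∀ x : DecMat n d, x.IsDiagEmpty → e x ∈ contraction T := fun x hx =>
    mem_contraction.mpr (toQ_e_mem_of_cartan (fun a => hgen _ (Or.inr (Or.inl ⟨1, a, rfl⟩))) hx)
  have hdim := dimElt_mem hdiag
  refine eq_top_of_gens fun x hx => ?_
  rcases hx with ⟨R, rfl, i, j, hij, hx | hx⟩ | hx | hx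
  · refine e_mem_of_br_mem ?_
    have := dimElt_mul_sum (fun x hx => charFamily_eq_dimFam_mul_upper hij hx)
      (fun y => vpow (-(y.orbitDim : ℤ) + y.imageDim)) hx
    rw [← br] at this
    rw [← this]
    exact Subalgebra.mul_mem _ (hdim _) (hgen _ (Or.inl ⟨i, j, hij, Or.inl rfl⟩))
  · refine e_mem_of_br_mem ?_
    have := dimElt_mul_sum (fun x hx => charFamily_eq_dimFam_mul_lower hij hx)
      (fun y => vpow (-(y.orbitDim : ℤ) + y.imageDim)) hx
    rw [← br] at this
    rw [← this]
    exact Subalgebra.mul_mem _ (hdim _) (hgen _ (Or.inl ⟨i, j, hij, Or.inr rfl⟩))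
  · exact hdiag x hx
  -- The diagonal part of L is already available. Removing it and multiplying by an idempotent
  -- leaves one e_{D',{(1,1)}} times a power of v.
  · have hL : L n d ∈ contraction T := hgen _ (Or.inr (Or.inr rfl))
    have h1 : (∑ x : DecMat n d with x.IsDiagEmpty, vpow (-2 * (x.A 0 0 : ℤ)) • br x) ∈
        contraction T := sum_mem fun y hy => Subalgebra.smul_mem _
          (Subalgebra.smul_mem _ (hdiag y (Finset.mem_filter.mp hy).2) _) _
    have h2 := Subalgebra.sub_mem _ hL h1
    rw [L, add_sub_cancel_left] at h2
    simp only [smul_br] at h2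
    have h3 := Subalgebra.mul_mem _ (hdim x.rowDims) h2
    rw [dimElt_mul_sum (fun x hx => charFamily_eq_dimFam_mul_vecFam hx) _ hx] at h3
    exact mem_contraction_of_smul_mem (mul_ne_zero (vpow_ne_zero _) (vpow_ne_zero _)) h3

end

end Mirabolic

end

theorem proposition4p2p1 (n d : ℕ) [NeZero n] (hd : 0 < d) :
    -- the `e_{A,Δ}` span the algebra over `ℤ[v, v⁻¹]`
    Submodule.span Mirabolic.𝒜 (Set.range (Mirabolic.e (n := n) (d := d))) = ⊤ ∧
    -- generators over `ℤ[v, v⁻¹]`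
    Algebra.adjoin Mirabolic.𝒜 (Mirabolic.gens n d Set.univ) = ⊤ ∧
    -- over `ℚ(v)` the multiplicity one is enough
    Algebra.adjoin Mirabolic.Qv (Mirabolic.toQ '' Mirabolic.gens n d {1}) = ⊤ ∧
    -- over `ℚ(v)` the elements `E_i`, `F_i`, `H_a^±`, `L` generate
    Algebra.adjoin Mirabolic.Qv (Mirabolic.toQ '' Mirabolic.quantumGens n d) = ⊤ := by
  exact ⟨Mirabolic.span_range_e_eq_top, Mirabolic.adjoin_gens_eq_top,
    Mirabolic.adjoin_gens_one_eq_top, Mirabolic.adjoin_quantumGens_eq_top⟩
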